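/- For a real $p_1\times p_2$ matrix $X$ let $\|X\|_F$, $\|X\|$ and $\|X\|_*$ denote the Frobenius norm, the spectral norm and the nuclear norm (the sum of the singular values). If $X=\sum_i a_iu_iv_i^{\top}$ is a singular value decomposition with $a_1\ge a_2\ge\dots\ge 0$, put $X_{-\max(r)}=\sum_{i\ge r+1}a_iu_iv_i^{\top}$. Let $p_1,p_2,r,n\ge 1$ be integers and $\sigma\ge 0$. Let $\beta^{(1)},\dots,\beta^{(n)}$ be random vectors in $\mathbb R^{p_1}$ and $\gamma^{(1)},\dots,\gamma^{(n)}$ random vectors in $\mathbb R^{p_2}$ whose entries are standard normal, and let $z_1,\dots,z_n\sim N(0,\sigma^2)$, all these random variables being mutually independent. Define the linear map $\mathcal X:\mathbb R^{p_1\times p_2}\to\mathbb R^n$ by $[\mathcal X(A)]_i=(\beta^{(i)})^{\top}A\gamma^{(i)}$ and its dual by $\mathcal X^*(w)=\sum_{i=1}^n w_i\,\beta^{(i)}(\gamma^{(i)})^{\top}$. Put $$\eta=\sigma\Bigl(12\sqrt{\log n}\,(p_1+p_2)+6\sqrt{2n(p_1+p_2)}\Bigr),\qquad \mathcal Z_G=\bigl\{w\in\mathbb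 R^n:\ \|w\|_1/n\le\sigma\ \text{ and }\ \|\mathcal X^*(w)\|\le\eta\bigr\}.$$ For a matrix $A$ let $y=\mathcal X(A)+z$ be the observation, and let the estimator $\hat A$ be any minimizer of $\|M\|_*$ over all $M\in\mathbb R^{p_1\times p_2}$ with $y-\mathcal X(M)\in\mathcal Z_G$. **Proposition 2.1.** There exist universal constants $C,W_1,W_2,\delta>0$ such that, whenever $n\ge Cr(p_1+p_2)$, with probability at least $1-11/n-3\exp(-\delta(p_1+p_2))$ the following holds for all matrices $A\in\mathbb R^{p_1\times p_2}$ simultaneously: a minimizer $\hat A$ exists, and every minimizer satisfies $$\|\hat A-A\|_F^2\le W_1\sigma^2\min\Bigl(\frac{r\,(\log n)\,(p_1+p_2)^2}{n^2}+\frac{r(p_1+p_2)}{n},\,1\Bigr)+W_2\,\frac{\|A_{-\max(r)}\|_*^2}{r}.$$ -/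

import Mathlib

open MeasureTheory ProbabilityTheory
open scoped Matrix

/-- The Frobenius norm of a real matrix. -/
noncomputable def frobNorm {p₁ p₂ : ℕ} (X : Matrix (Fin p₁) (Fin p₂) ℝ) : ℝ :=
  Real.sqrt (∑ i, ∑ j, X i j ^ 2)

/-- The spectral norm: the operator norm of `X` between Euclidean spaces. -/
noncomputable def specNorm {p₁ p₂ : ℕ} (X : Matrix (Fin p₁) (Fin p₂) ℝ) : ℝ :=
  ‖(Matrix.toEuclideanLin X).toContinuousLinearMap‖

/-- The nuclear norm: the sum of the `min p₁ p₂` singular values. -/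
noncomputable def nuclearNorm {p₁ p₂ : ℕ} (X : Matrix (Fin p₁) (Fin p₂) ℝ) : ℝ :=
  ∑ i ∈ Finset.range (min p₁ p₂), (Matrix.toEuclideanLin X).singularValues i

/-- `X = ∑ i, a i • u i (v i)ᵀ` is a singular value decomposition of `X`, with `k` terms and the
singular values in decreasing order. Terms with a zero singular value may be listed or left out. -/
structure IsSVD {p₁ p₂ k : ℕ} (X : Matrix (Fin p₁) (Fin p₂) ℝ) (a : Fin k → ℝ)
    (u : Fin k → EuclideanSpace ℝ (Fin p₁)) (v : Fin k → EuclideanSpace ℝ (Fin p₂)) : Prop where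
  antitone : Antitone a
  nonneg : ∀ i, 0 ≤ a i
  orthonormal_left : Orthonormal ℝ u
  orthonormal_right : Orthonormal ℝ v
  eq_sum : X = ∑ i, a i • Matrix.vecMulVec (u i) (v i)

/-- Every real matrix has a singular value decomposition in the above sense. -/
theorem exists_isSVD {p₁ p₂ : ℕ} (X : Matrix (Fin p₁) (Fin p₂) ℝ) :
    ∃ (k : ℕ) (a : Fin k → ℝ) (u : Fin k → EuclideanSpace ℝ (Fin p₁))
      (v : Fin k → EuclideanSpace ℝ (Fin p₂)), IsSVD X a u v := by
  classical
  set T := Matrix.toEuclideanLin X with hT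
  have hn : Module.finrank ℝ (EuclideanSpace ℝ (Fin p₂)) = p₂ := by simp
  set b := T.isSymmetric_adjoint_comp_self.eigenvectorBasis hn with hb
  set k := Module.finrank ℝ T.range with hk
  have hkp : k ≤ p₂ := by
    rw [← hn]; exact LinearMap.finrank_range_le T
  have hin : ∀ i j, inner ℝ (T (b i)) (T (b j)) =
      T.singularValues j ^ 2 * inner ℝ (b i) (b j) := by
    intro i j
    have h1 : LinearMap.adjoint T (T (b j)) = (T.singularValues j ^ 2 : ℝ) • b j := by
      have := T.isSymmetric_adjoint_comp_self.apply_eigenvectorBasis hn j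
      rw [T.sq_singularValues_fin hn j]
      exact this
    rw [← LinearMap.adjoint_inner_right, h1, inner_smul_right]
  have hpos : ∀ i : Fin k, 0 < T.singularValues i := fun i =>
    T.singularValues_pos_iff_lt_finrank_range.2 i.2
  have hzero : ∀ i : Fin p₂, k ≤ i.val → T (b i) = 0 := by
    intro i hi
    have h0 := T.singularValues_eq_zero_iff_le_finrank_range.2 hi
    have := hin i i
    rw [h0] at this
    simpa using this
  have hvec : ∀ (w : EuclideanSpace ℝ (Fin p₁)) (y x : EuclideanSpace ℝ (Fin p₂)),
      Matrix.toEuclideanLin (Matrix.vecMulVec w y) x = inner ℝ y x • w := by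
    intro w y x
    ext l
    simp [Matrix.vecMulVec_mulVec, PiLp.inner_apply, dotProduct, mul_comm]
  refine ⟨k, fun i => T.singularValues i,
    fun i => (T.singularValues i)⁻¹ • T (b (Fin.castLE hkp i)), fun i => b (Fin.castLE hkp i),
    ?_, ?_, ?_, ?_, ?_⟩
  · intro i j hij
    exact T.singularValues_antitone hij
  · intro i
    exact (hpos i).le
  · rw [orthonormal_iff_ite]
    intro i j
    rw [real_inner_smul_left, real_inner_smul_right, hin,
      orthonormal_iff_ite.1 b.orthonormal]
    by_cases h : i = j
    · subst h
      have := (hpos i).ne'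
      simp
      field_simp
    · have : Fin.castLE hkp i ≠ Fin.castLE hkp j := fun h' => h (Fin.castLE_injective hkp h')
      simp [h, this]
  · exact b.orthonormal.comp _ (Fin.castLE_injective hkp)
  · apply Matrix.toEuclideanLin.injective
    ext1 x
    have hx : T x = ∑ i, inner ℝ (b i) x • T (b i) := by
      conv_lhs => rw [← b.sum_repr' x]
      simp
    have hsub : ∑ i, inner ℝ (b i) x • T (b i) =
        ∑ i : Fin k, inner ℝ (b (Fin.castLE hkp i)) x • T (b (Fin.castLE hkp i)) := by
      have := Finset.sum_map (Finset.univ : Finset (Fin k)) (Fin.castLEEmb hkp)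
        (fun i => inner ℝ (b i) x • T (b i))
      simp only [Fin.castLEEmb_apply] at this
      rw [← this]
      symm
      apply Finset.sum_subset (Finset.subset_univ _)
      intro i _ hi
      rw [hzero i, smul_zero]
      by_contra hlt
      exact hi (Finset.mem_map.2 ⟨⟨i, not_le.1 hlt⟩, Finset.mem_univ _, rfl⟩)
    rw [← hT, hx, hsub, map_sum, LinearMap.sum_apply]
    refine Finset.sum_congr rfl fun i _ => ?_
    rw [map_smul, LinearMap.smul_apply, hvec, smul_comm, smul_smul, smul_smul]
    congr 1
    field_simp [(hpos i).ne']

/-- The matrix `X_{-max(r)} = ∑_{i ≥ r+1} a_i u_i v_iᵀ` of a singular value decomposition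
(indices start at `0` here, so that the first `r` terms are those with index less than `r`). -/
noncomputable def svdTail {p₁ p₂ k : ℕ} (a : Fin k → ℝ)
    (u : Fin k → EuclideanSpace ℝ (Fin p₁)) (v : Fin k → EuclideanSpace ℝ (Fin p₂)) (r : ℕ) :
    Matrix (Fin p₁) (Fin p₂) ℝ :=
  ∑ i with r ≤ i.val, a i • Matrix.vecMulVec (u i) (v i)

/-- The rank-one projection map `A ↦ ((β⁽ⁱ⁾)ᵀ A γ⁽ⁱ⁾)ᵢ`. -/
def ropMap {n p₁ p₂ : ℕ} (β : Fin n → Fin p₁ → ℝ) (γ : Fin n → Fin p₂ → ℝ)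
    (A : Matrix (Fin p₁) (Fin p₂) ℝ) : Fin n → ℝ :=
  fun i => β i ⬝ᵥ (A *ᵥ γ i)

/-- The dual map `z ↦ ∑ i, z i • β⁽ⁱ⁾ (γ⁽ⁱ⁾)ᵀ`. -/
def ropDual {n p₁ p₂ : ℕ} (β : Fin n → Fin p₁ → ℝ) (γ : Fin n → Fin p₂ → ℝ)
    (z : Fin n → ℝ) : Matrix (Fin p₁) (Fin p₂) ℝ :=
  ∑ i, z i • Matrix.vecMulVec (β i) (γ i)

/-- The threshold `η = σ (12 √(log n) (p₁ + p₂) + 6 √(2 n (p₁ + p₂)))`. -/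
noncomputable def dantzigThreshold (n p₁ p₂ : ℕ) (σ : ℝ) : ℝ :=
  σ * (12 * Real.sqrt (Real.log n) * ((p₁ : ℝ) + p₂)
    + 6 * Real.sqrt (2 * (n : ℝ) * ((p₁ : ℝ) + p₂)))

/-- The set `{z : ‖z‖₁ / n ≤ σ} ∩ {z : ‖𝒳*(z)‖ ≤ η}` of admissible residuals. -/
def residualSet {n p₁ p₂ : ℕ} (β : Fin n → Fin p₁ → ℝ) (γ : Fin n → Fin p₂ → ℝ) (σ : ℝ) :
    Set (Fin n → ℝ) :=
  {z | (∑ i, |z i|) / (n : ℝ) ≤ σ} ∩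
    {z | specNorm (ropDual β γ z) ≤ dantzigThreshold n p₁ p₂ σ}

/-- `M` is feasible for the data `y`: the residual `y - 𝒳(M)` is admissible. -/
def IsFeasible {n p₁ p₂ : ℕ} (β : Fin n → Fin p₁ → ℝ) (γ : Fin n → Fin p₂ → ℝ) (σ : ℝ)
    (y : Fin n → ℝ) (M : Matrix (Fin p₁) (Fin p₂) ℝ) : Prop :=
  y - ropMap β γ M ∈ residualSet β γ σ

/-- `Ahat` is a constrained nuclear norm minimizer: it is feasible and has the least nuclear norm
among all feasible matrices. -/
def IsNuclearNormEstimator {n p₁ p₂ : ℕ} (β : Fin n → Fin p₁ → ℝ) (γ : Fin n → Fin p₂ → ℝ)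
    (σ : ℝ) (y : Fin n → ℝ) (Ahat : Matrix (Fin p₁) (Fin p₂) ℝ) : Prop :=
  IsFeasible β γ σ y Ahat ∧
    ∀ M : Matrix (Fin p₁) (Fin p₂) ℝ, IsFeasible β γ σ y M → nuclearNorm Ahat ≤ nuclearNorm M

/-- The random design and noise: all entries of the `β⁽ⁱ⁾` and `γ⁽ⁱ⁾` are standard normal, the `z i`
are `N(0, σ²)`, and all these random variables together are independent. -/
structure IsGaussianROPModel {Ω : Type*} [MeasurableSpace Ω] (μ : Measure Ω) {n p₁ p₂ : ℕ} (σ : ℝ)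
    (β : Fin n → Fin p₁ → Ω → ℝ) (γ : Fin n → Fin p₂ → Ω → ℝ) (z : Fin n → Ω → ℝ) : Prop where
  law_left : ∀ i j, HasLaw (β i j) (gaussianReal 0 1) μ
  law_right : ∀ i j, HasLaw (γ i j) (gaussianReal 0 1) μ
  law_noise : ∀ i, HasLaw (z i) (gaussianReal 0 (σ ^ 2).toNNReal) μ
  indep : iIndepFun (Sum.elim (fun k : Fin n × Fin p₁ => β k.1 k.2)
    (Sum.elim (fun k : Fin n × Fin p₂ => γ k.1 k.2) z)) μ

/-! Three events carry the theorem: `‖z‖₁ ≤ σ n`, `‖𝒳*(z)‖ ≤ η`, and the restricted bound `‖𝒳(X)‖₁ ≥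
n ‖X‖_F / 768` for all `X` with `‖X‖_* ≤ 8 √r ‖X‖_F`. None of them involves `A`, so the conclusion
is uniform in `A`.

On these events (`frobNorm_sub_sq_le`) `A` is feasible, hence `X = Ahat - A` does not increase the
nuclear norm of `A`, and a dual certificate gives `‖X‖_* ≤ 3 √r ‖X‖_F + 2 ‖A_{-max(r)}‖_*`. Either
the tail dominates, or the restricted bound applies. In the latter case `‖𝒳(X)‖₁ ≤ 2 σ n` gives the
bound of order `σ²`, while `‖𝒳(X)‖₁² ≤ n ⟨X, 𝒳*𝒳(X)⟩ ≤ 2 n η ‖X‖_*` gives the rate.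

For one fixed matrix the restricted bound is a Chernoff bound for Gaussian chaoses `βᵀ h γ`
(`measure_ropSeminorm_le`). Matrices of rank at most `m`, a large multiple of `r`, are products `U
W` through `ℝᵐ`; nets for `U` and `W` live in dimension `m (p₁ + p₂)` in total, which `n ≥ C r (p₁ +
p₂)` pays for. A general `X` in the cone is cut into blocks of `m` singular values: the first block
carries the lower bound, and the Frobenius norms of the others add up to at most `‖X‖_* / √m`
(`le_seminorm_of_factorProd`).

For the spectral bound the noise is frozen, with `‖z‖₂² ≤ 2 n` and `max |z i| ≤ 2 √(log n)` for `σ =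
1`. Then `⟨u vᵀ, 𝒳*(z)⟩` is a weighted sum of independent chaoses with a Bernstein-type tail, and a
union bound over `1/4`-nets with `9 ^ (p₁ + p₂)` pairs finishes (`measure_noise_bilin_gt_le`,
`specNorm_le_of_net`). -/

/-! ### Nets and seminorms in finite-dimensional spaces -/

/-- A finite set of points of the unit ball that are at mutual distance at least `ε` has at most
`(1 + 2 / ε) ^ d` elements. -/
theorem card_le_of_separated_unitBall {V : Type*} [NormedAddCommGroup V] [NormedSpace ℝ V]
    [FiniteDimensional ℝ V] {ε : ℝ} (hε : 0 < ε) (s : Finset V) (hs : ∀ c ∈ s, ‖c‖ ≤ 1)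
    (h : ∀ c ∈ s, ∀ d ∈ s, c ≠ d → ε ≤ ‖c - d‖) :
    (s.card : ℝ) ≤ (1 + 2 / ε) ^ Module.finrank ℝ V := by
  borelize V
  let ν : Measure V := Measure.addHaar
  set d := Module.finrank ℝ V
  have hδ : 0 < ε / 2 := by positivity
  have hρ : 0 < 1 + ε / 2 := by positivity
  -- Volume comparison: disjoint balls of radius `ε / 2` lie in a ball of radius `1 + ε / 2`.
  have hD : Set.Pairwise (s : Set V)
      (Function.onFun Disjoint fun c => Metric.ball c (ε / 2)) := by
    rintro c hc d hd hcd
    apply Metric.ball_disjoint_ball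
    rw [dist_eq_norm]
    linarith [h c hc d hd hcd]
  have hsub : (⋃ c ∈ s, Metric.ball c (ε / 2)) ⊆ Metric.ball (0 : V) (1 + ε / 2) := by
    refine Set.iUnion₂_subset fun x hx => Metric.ball_subset_ball' ?_
    rw [dist_zero_right]
    linarith [hs x hx]
  have hI : (s.card : ENNReal) * ENNReal.ofReal ((ε / 2) ^ d) * ν (Metric.ball 0 1) ≤
      ENNReal.ofReal ((1 + ε / 2) ^ d) * ν (Metric.ball 0 1) :=
    calc
      _ = ν (⋃ c ∈ s, Metric.ball c (ε / 2)) := by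
        rw [measure_biUnion_finset hD fun c _ => measurableSet_ball]
        simp only [ν.addHaar_ball_of_pos _ hδ]
        simp only [Finset.sum_const, nsmul_eq_mul, mul_assoc, d]
      _ ≤ ν (Metric.ball (0 : V) (1 + ε / 2)) := measure_mono hsub
      _ = _ := by simp only [ν.addHaar_ball_of_pos _ hρ, d]
  have hJ : (s.card : ENNReal) * ENNReal.ofReal ((ε / 2) ^ d) ≤
      ENNReal.ofReal ((1 + ε / 2) ^ d) :=
    (ENNReal.mul_le_mul_iff_left (Metric.measure_ball_pos _ _ zero_lt_one).ne'
      measure_ball_lt_top.ne).1 hI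
  have hK := ENNReal.toReal_le_of_le_ofReal (pow_nonneg hρ.le _) hJ
  rw [ENNReal.toReal_mul, ENNReal.toReal_natCast, ENNReal.toReal_ofReal (by positivity)] at hK
  have : 1 + 2 / ε = (1 + ε / 2) / (ε / 2) := by field_simp; ring
  rw [this, div_pow, le_div_iff₀ (by positivity)]
  exact hK

/-- The unit ball of a `d`-dimensional normed space has an `ε`-net with `(1 + 2 / ε) ^ d` points. -/
theorem exists_net_unitBall (V : Type*) [NormedAddCommGroup V] [NormedSpace ℝ V]
    [FiniteDimensional ℝ V] {ε : ℝ} (hε : 0 < ε) :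
    ∃ N : Finset V, (N.card : ℝ) ≤ (1 + 2 / ε) ^ Module.finrank ℝ V ∧ (∀ y ∈ N, ‖y‖ ≤ 1) ∧
      ∀ x : V, ‖x‖ ≤ 1 → ∃ y ∈ N, ‖x - y‖ ≤ ε := by
  classical
  -- A separated set of maximal cardinality is a net: a point farther than `ε` from all of it could
  -- be added.
  let P : ℕ → Prop := fun k => ∃ s : Finset V, s.card = k ∧ (∀ c ∈ s, ‖c‖ ≤ 1) ∧
    ∀ c ∈ s, ∀ d ∈ s, c ≠ d → ε ≤ ‖c - d‖
  obtain ⟨B, hB⟩ := exists_nat_ge ((1 + 2 / ε) ^ Module.finrank ℝ V)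
  have hbound : ∀ k, P k → k ≤ B := by
    rintro k ⟨s, rfl, h1, h2⟩
    exact_mod_cast (card_le_of_separated_unitBall hε s h1 h2).trans hB
  have hP0 : P 0 := ⟨∅, by simp, by simp, by simp⟩
  obtain ⟨s, hcard, hs1, hs2⟩ : P (Nat.findGreatest P B) :=
    Nat.findGreatest_spec (Nat.zero_le B) hP0
  refine ⟨s, card_le_of_separated_unitBall hε s hs1 hs2, hs1, fun x hx => ?_⟩
  by_contra! hcon
  have hxs : x ∉ s := fun hxs => by
    have := hcon x hxs
    simp at this
    linarith
  have hP : P (s.card + 1) := by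
    refine ⟨insert x s, Finset.card_insert_of_notMem hxs, ?_, ?_⟩
    · intro c hc
      rcases Finset.mem_insert.1 hc with rfl | hc
      exacts [hx, hs1 c hc]
    · intro c hc d hd hcd
      rcases Finset.mem_insert.1 hc with h1 | h1 <;> rcases Finset.mem_insert.1 hd with h2 | h2
      · exact absurd (h1.trans h2.symm) hcd
      · rw [h1]; exact (hcon d h2).le
      · rw [h2, norm_sub_rev]; exact (hcon c h1).le
      · exact hs2 c h1 d h2 hcd
  have := Nat.le_findGreatest (hbound _ hP) hP
  omega

theorem Seminorm.continuous_of_finiteDimensional' {V : Type*} [NormedAddCommGroup V]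
    [NormedSpace ℝ V] [FiniteDimensional ℝ V] (q : Seminorm ℝ V) : Continuous q :=
  (ConvexOn.locallyLipschitz q.convexOn).continuous

/-- A seminorm that is bounded on a net is bounded on the space. -/
theorem Seminorm.le_of_net {V : Type*} [NormedAddCommGroup V] [NormedSpace ℝ V]
    [FiniteDimensional ℝ V] (q : Seminorm ℝ V) {ε c : ℝ} (hε : ε < 1) {N : Finset V}
    (hN : ∀ x : V, ‖x‖ ≤ 1 → ∃ y ∈ N, ‖x - y‖ ≤ ε) (hq : ∀ y ∈ N, q y ≤ c) (x : V) :
    q x ≤ c / (1 - ε) * ‖x‖ := by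
  have : ProperSpace V := FiniteDimensional.proper ℝ V
  -- At a maximizer `x₀` of `q` on the ball the bound feeds on itself: `q x₀ ≤ c + ε q x₀`.
  obtain ⟨x₀, hx₀, hmax⟩ := (isCompact_closedBall (0 : V) 1).exists_isMaxOn
    ⟨0, by simp⟩ q.continuous_of_finiteDimensional'.continuousOn
  have hball : ∀ w : V, q w ≤ ‖w‖ * q x₀ := by
    intro w
    rcases eq_or_ne w 0 with rfl | hw
    · simp
    have hpos : 0 < ‖w‖ := norm_pos_iff.2 hw
    have h1 : q (‖w‖⁻¹ • w) ≤ q x₀ := hmax (by simp [norm_smul, hpos.ne'])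
    rw [map_smul_eq_mul, norm_inv, norm_norm] at h1
    rwa [inv_mul_le_iff₀ hpos] at h1
  obtain ⟨y, hy, hxy⟩ := hN x₀ (by simpa using hx₀)
  have h1 : q x₀ ≤ c + ε * q x₀ := by
    calc q x₀ = q (y + (x₀ - y)) := by congr 1; abel
      _ ≤ q y + q (x₀ - y) := map_add_le_add q _ _
      _ ≤ c + ε * q x₀ := add_le_add (hq y hy)
          ((hball _).trans (mul_le_mul_of_nonneg_right hxy (apply_nonneg q _)))
  have h2 : q x₀ ≤ c / (1 - ε) := by
    rw [le_div_iff₀ (by linarith)]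
    linarith
  calc q x ≤ ‖x‖ * q x₀ := hball x
    _ ≤ ‖x‖ * (c / (1 - ε)) := by gcongr
    _ = _ := mul_comm _ _

/-! ### A singular value decomposition that computes the nuclear norm -/

/-- Every real matrix has a singular value decomposition whose values add up to the nuclear norm. -/
theorem exists_isSVD_sum_eq {p₁ p₂ : ℕ} (X : Matrix (Fin p₁) (Fin p₂) ℝ) :
    ∃ (k : ℕ) (a : Fin k → ℝ) (u : Fin k → EuclideanSpace ℝ (Fin p₁))
      (v : Fin k → EuclideanSpace ℝ (Fin p₂)), IsSVD X a u v ∧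
        ∑ i, a i = nuclearNorm X := by
  classical
  set T := Matrix.toEuclideanLin X with hT
  have hn : Module.finrank ℝ (EuclideanSpace ℝ (Fin p₂)) = p₂ := by simp
  set b := T.isSymmetric_adjoint_comp_self.eigenvectorBasis hn with hb
  set k := Module.finrank ℝ T.range with hk
  have hkp : k ≤ p₂ := by
    rw [← hn]; exact LinearMap.finrank_range_le T
  have hin : ∀ i j, inner ℝ (T (b i)) (T (b j)) =
      T.singularValues j ^ 2 * inner ℝ (b i) (b j) := by
    intro i j
    have h1 : LinearMap.adjoint T (T (b j)) = (T.singularValues j ^ 2 : ℝ) • b j := by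
      have := T.isSymmetric_adjoint_comp_self.apply_eigenvectorBasis hn j
      rw [T.sq_singularValues_fin hn j]
      exact this
    rw [← LinearMap.adjoint_inner_right, h1, inner_smul_right]
  have hpos : ∀ i : Fin k, 0 < T.singularValues i := fun i =>
    T.singularValues_pos_iff_lt_finrank_range.2 i.2
  have hzero : ∀ i : Fin p₂, k ≤ i.val → T (b i) = 0 := by
    intro i hi
    have h0 := T.singularValues_eq_zero_iff_le_finrank_range.2 hi
    have := hin i i
    rw [h0] at this
    simpa using this
  have hvec : ∀ (w : EuclideanSpace ℝ (Fin p₁)) (y x : EuclideanSpace ℝ (Fin p₂)),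
      Matrix.toEuclideanLin (Matrix.vecMulVec w y) x = inner ℝ y x • w := by
    intro w y x
    ext l
    simp [Matrix.vecMulVec_mulVec, PiLp.inner_apply, dotProduct, mul_comm]
  -- The right vectors are eigenvectors of `T* T`, the left ones their normalized images; stopping
  -- at the rank `k` keeps all divisors positive.
  refine ⟨k, fun i => T.singularValues i,
    fun i => (T.singularValues i)⁻¹ • T (b (Fin.castLE hkp i)), fun i => b (Fin.castLE hkp i),
    ⟨?_, ?_, ?_, ?_, ?_⟩, ?_⟩
  · intro i j hij
    exact T.singularValues_antitone hij
  · intro i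
    exact (hpos i).le
  · rw [orthonormal_iff_ite]
    intro i j
    rw [real_inner_smul_left, real_inner_smul_right, hin,
      orthonormal_iff_ite.1 b.orthonormal]
    by_cases h : i = j
    · subst h
      have := (hpos i).ne'
      simp
      field_simp
    · have : Fin.castLE hkp i ≠ Fin.castLE hkp j := fun h' => h (Fin.castLE_injective hkp h')
      simp [h, this]
  · exact b.orthonormal.comp _ (Fin.castLE_injective hkp)
  · apply Matrix.toEuclideanLin.injective
    ext1 x
    have hx : T x = ∑ i, inner ℝ (b i) x • T (b i) := by
      conv_lhs => rw [← b.sum_repr' x]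
      simp
    have hsub : ∑ i, inner ℝ (b i) x • T (b i) =
        ∑ i : Fin k, inner ℝ (b (Fin.castLE hkp i)) x • T (b (Fin.castLE hkp i)) := by
      have := Finset.sum_map (Finset.univ : Finset (Fin k)) (Fin.castLEEmb hkp)
        (fun i => inner ℝ (b i) x • T (b i))
      simp only [Fin.castLEEmb_apply] at this
      rw [← this]
      symm
      apply Finset.sum_subset (Finset.subset_univ _)
      intro i _ hi
      rw [hzero i, smul_zero]
      by_contra hlt
      exact hi (Finset.mem_map.2 ⟨⟨i, not_le.1 hlt⟩, Finset.mem_univ _, rfl⟩)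
    rw [← hT, hx, hsub, map_sum, LinearMap.sum_apply]
    refine Finset.sum_congr rfl fun i _ => ?_
    rw [map_smul, LinearMap.smul_apply, hvec, smul_comm, smul_smul, smul_smul]
    congr 1
    field_simp [(hpos i).ne']
  · have hkm : k ≤ min p₁ p₂ := by
      refine le_min ?_ hkp
      have := Submodule.finrank_le T.range
      simpa [hk] using this
    rw [nuclearNorm, Fin.sum_univ_eq_sum_range (fun i => T.singularValues i) k]
    refine Finset.sum_subset (Finset.range_mono hkm) fun i _ hi => ?_
    exact T.singularValues_eq_zero_iff_le_finrank_range.2 (by simpa using hi)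

/-! ### Trace inner product, Frobenius norm and spectral norm -/

section MatrixInner

variable {p₁ p₂ : ℕ}

/-- The trace inner product of two real matrices. -/
def matInner (X Y : Matrix (Fin p₁) (Fin p₂) ℝ) : ℝ := ∑ i, ∑ j, X i j * Y i j

theorem matInner_comm (X Y : Matrix (Fin p₁) (Fin p₂) ℝ) : matInner X Y = matInner Y X := by
  simp [matInner, mul_comm]

theorem matInner_add_left (X X' Y : Matrix (Fin p₁) (Fin p₂) ℝ) :
    matInner (X + X') Y = matInner X Y + matInner X' Y := by
  simp [matInner, add_mul, Finset.sum_add_distrib]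

theorem matInner_smul_left (c : ℝ) (X Y : Matrix (Fin p₁) (Fin p₂) ℝ) :
    matInner (c • X) Y = c * matInner X Y := by
  simp [matInner, mul_assoc, Finset.mul_sum]

theorem matInner_sum_left {ι : Type*} (s : Finset ι) (X : ι → Matrix (Fin p₁) (Fin p₂) ℝ)
    (Y : Matrix (Fin p₁) (Fin p₂) ℝ) :
    matInner (∑ i ∈ s, X i) Y = ∑ i ∈ s, matInner (X i) Y := by
  classical
  induction s using Finset.induction_on with
  | empty => simp [matInner]
  | insert i s hi ih => rw [Finset.sum_insert hi, Finset.sum_insert hi, matInner_add_left, ih]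

theorem matInner_neg_left (X Y : Matrix (Fin p₁) (Fin p₂) ℝ) :
    matInner (-X) Y = -matInner X Y := by
  simp [matInner]

theorem matInner_add_right (X Y Y' : Matrix (Fin p₁) (Fin p₂) ℝ) :
    matInner X (Y + Y') = matInner X Y + matInner X Y' := by
  simp [matInner, mul_add, Finset.sum_add_distrib]

theorem matInner_sum_right {ι : Type*} (s : Finset ι) (Y : ι → Matrix (Fin p₁) (Fin p₂) ℝ)
    (X : Matrix (Fin p₁) (Fin p₂) ℝ) :
    matInner X (∑ i ∈ s, Y i) = ∑ i ∈ s, matInner X (Y i) := by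
  simp_rw [matInner_comm X, matInner_sum_left]

theorem matInner_self (X : Matrix (Fin p₁) (Fin p₂) ℝ) : matInner X X = frobNorm X ^ 2 := by
  rw [frobNorm, Real.sq_sqrt (by positivity)]
  simp [matInner, sq]

theorem matInner_eq_trace (X Y : Matrix (Fin p₁) (Fin p₂) ℝ) : matInner X Y = (Xᵀ * Y).trace := by
  rw [matInner, Finset.sum_comm]
  simp [Matrix.trace, Matrix.mul_apply]

theorem matInner_mul_left (P : Matrix (Fin p₁) (Fin p₁) ℝ) (X Y : Matrix (Fin p₁) (Fin p₂) ℝ) :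
    matInner (P * X) Y = matInner X (Pᵀ * Y) := by
  rw [matInner_eq_trace, matInner_eq_trace, Matrix.transpose_mul, Matrix.mul_assoc]

theorem matInner_mul_right (Q : Matrix (Fin p₂) (Fin p₂) ℝ) (X Y : Matrix (Fin p₁) (Fin p₂) ℝ) :
    matInner (X * Q) Y = matInner X (Y * Qᵀ) := by
  rw [matInner_eq_trace, matInner_eq_trace, Matrix.transpose_mul, Matrix.mul_assoc,
    Matrix.trace_mul_comm, Matrix.mul_assoc]

/-- A matrix as a Euclidean vector. -/
def flatten (X : Matrix (Fin p₁) (Fin p₂) ℝ) : EuclideanSpace ℝ (Fin p₁ × Fin p₂) :=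
  WithLp.toLp 2 fun ij => X ij.1 ij.2

theorem norm_flatten (X : Matrix (Fin p₁) (Fin p₂) ℝ) : ‖flatten X‖ = frobNorm X := by
  simp [flatten, EuclideanSpace.norm_eq, frobNorm, Fintype.sum_prod_type]

theorem inner_flatten (X Y : Matrix (Fin p₁) (Fin p₂) ℝ) :
    inner ℝ (flatten X) (flatten Y) = matInner X Y := by
  simp [flatten, PiLp.inner_apply, matInner, Fintype.sum_prod_type, mul_comm]

theorem matInner_le_frobNorm (X Y : Matrix (Fin p₁) (Fin p₂) ℝ) :
    matInner X Y ≤ frobNorm X * frobNorm Y := by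
  rw [← inner_flatten, ← norm_flatten, ← norm_flatten]
  exact real_inner_le_norm _ _

theorem frobNorm_nonneg (X : Matrix (Fin p₁) (Fin p₂) ℝ) : 0 ≤ frobNorm X := Real.sqrt_nonneg _

theorem frobNorm_add_le (X Y : Matrix (Fin p₁) (Fin p₂) ℝ) :
    frobNorm (X + Y) ≤ frobNorm X + frobNorm Y := by
  simp_rw [← norm_flatten]
  exact norm_add_le (flatten X) (flatten Y)

theorem frobNorm_smul (c : ℝ) (X : Matrix (Fin p₁) (Fin p₂) ℝ) :
    frobNorm (c • X) = |c| * frobNorm X := by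
  simp_rw [← norm_flatten]
  exact norm_smul c (flatten X)

theorem frobNorm_eq_zero {X : Matrix (Fin p₁) (Fin p₂) ℝ} (h : frobNorm X = 0) : X = 0 := by
  rw [← norm_flatten, norm_eq_zero] at h
  ext i j
  simpa [flatten] using congrArg (fun f : EuclideanSpace ℝ (Fin p₁ × Fin p₂) => f (i, j)) h

theorem frobNorm_sum_le {ι : Type*} (s : Finset ι) (X : ι → Matrix (Fin p₁) (Fin p₂) ℝ) :
    frobNorm (∑ i ∈ s, X i) ≤ ∑ i ∈ s, frobNorm (X i) := by
  classical
  induction s using Finset.induction_on with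
  | empty => simp [frobNorm]
  | insert i s hi ih =>
    rw [Finset.sum_insert hi, Finset.sum_insert hi]
    exact (frobNorm_add_le _ _).trans (by gcongr)

theorem inner_toEuclideanLin (Y : Matrix (Fin p₁) (Fin p₂) ℝ) (u : EuclideanSpace ℝ (Fin p₁))
    (v : EuclideanSpace ℝ (Fin p₂)) :
    inner ℝ u (Matrix.toEuclideanLin Y v) = matInner (Matrix.vecMulVec u v) Y := by
  simp only [PiLp.inner_apply, matInner, Matrix.vecMulVec_apply]
  refine Finset.sum_congr rfl fun i _ => ?_
  simp [Matrix.mulVec, dotProduct, Finset.sum_mul]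
  refine Finset.sum_congr rfl fun j _ => by ring

theorem matInner_vecMulVec (u u' : EuclideanSpace ℝ (Fin p₁)) (v v' : EuclideanSpace ℝ (Fin p₂)) :
    matInner (Matrix.vecMulVec u v) (Matrix.vecMulVec u' v') = inner ℝ u u' * inner ℝ v v' := by
  simp only [matInner, Matrix.vecMulVec_apply, PiLp.inner_apply, Finset.sum_mul_sum]
  refine Finset.sum_congr rfl fun i _ => Finset.sum_congr rfl fun j _ => ?_
  simp
  ring

theorem toEuclideanLin_vecMulVec (w : EuclideanSpace ℝ (Fin p₁)) (y x : EuclideanSpace ℝ (Fin p₂)) :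
    Matrix.toEuclideanLin (Matrix.vecMulVec w y) x = inner ℝ y x • w := by
  ext l
  simp [Matrix.vecMulVec_mulVec, PiLp.inner_apply, dotProduct, mul_comm]

theorem norm_toEuclideanLin_le (Y : Matrix (Fin p₁) (Fin p₂) ℝ) (x : EuclideanSpace ℝ (Fin p₂)) :
    ‖Matrix.toEuclideanLin Y x‖ ≤ specNorm Y * ‖x‖ :=
  (Matrix.toEuclideanLin Y).toContinuousLinearMap.le_opNorm x

theorem specNorm_le {Y : Matrix (Fin p₁) (Fin p₂) ℝ} {c : ℝ} (hc : 0 ≤ c)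
    (h : ∀ x, ‖Matrix.toEuclideanLin Y x‖ ≤ c * ‖x‖) : specNorm Y ≤ c :=
  ContinuousLinearMap.opNorm_le_bound _ hc h

theorem specNorm_nonneg (Y : Matrix (Fin p₁) (Fin p₂) ℝ) : 0 ≤ specNorm Y := norm_nonneg _

theorem specNorm_smul (c : ℝ) (Y : Matrix (Fin p₁) (Fin p₂) ℝ) :
    specNorm (c • Y) = |c| * specNorm Y := by
  simp [specNorm, norm_smul]

theorem specNorm_sub_le (X Y : Matrix (Fin p₁) (Fin p₂) ℝ) :
    specNorm (X - Y) ≤ specNorm X + specNorm Y := by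
  simp only [specNorm, map_sub]
  exact norm_sub_le _ _

theorem matInner_vecMulVec_le (Y : Matrix (Fin p₁) (Fin p₂) ℝ) (u : EuclideanSpace ℝ (Fin p₁))
    (v : EuclideanSpace ℝ (Fin p₂)) :
    matInner (Matrix.vecMulVec u v) Y ≤ specNorm Y * (‖u‖ * ‖v‖) := by
  rw [← inner_toEuclideanLin]
  calc _ ≤ ‖u‖ * ‖Matrix.toEuclideanLin Y v‖ := real_inner_le_norm _ _
    _ ≤ ‖u‖ * (specNorm Y * ‖v‖) := by gcongr; exact norm_toEuclideanLin_le Y v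
    _ = _ := by ring

theorem specNorm_le_frobNorm (Y : Matrix (Fin p₁) (Fin p₂) ℝ) : specNorm Y ≤ frobNorm Y := by
  refine specNorm_le (frobNorm_nonneg _) fun x => ?_
  -- Testing `Y` against `w xᵀ` with `w = Y x` gives `‖w‖² ≤ ‖w‖ ‖x‖ ‖Y‖_F`.
  set w := Matrix.toEuclideanLin Y x with hw
  have h1 : ‖w‖ ^ 2 ≤ ‖w‖ * ‖x‖ * frobNorm Y := by
    rw [← real_inner_self_eq_norm_sq]
    nth_rw 2 [hw]
    rw [inner_toEuclideanLin]
    refine (matInner_le_frobNorm _ _).trans (le_of_eq ?_)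
    congr 1
    rw [← sq_eq_sq₀ (frobNorm_nonneg _) (by positivity), ← matInner_self, matInner_vecMulVec,
      real_inner_self_eq_norm_sq, real_inner_self_eq_norm_sq]
    ring
  rcases (norm_nonneg w).eq_or_lt with h | h
  · rw [← h]
    exact mul_nonneg (frobNorm_nonneg _) (norm_nonneg _)
  · nlinarith

end MatrixInner

/-! ### Duality of the nuclear and spectral norms -/

section NuclearNorm

variable {p₁ p₂ : ℕ}

/-- Linear combinations of orthogonal vectors of norm at most one. -/
theorem norm_sq_sum_smul_le {E ι : Type*} [NormedAddCommGroup E] [InnerProductSpace ℝ E]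
    (s : Finset ι) (u : ι → E) (c : ι → ℝ) (hu : ∀ i ∈ s, ‖u i‖ ≤ 1)
    (hort : ∀ i ∈ s, ∀ j ∈ s, i ≠ j → inner ℝ (u i) (u j) = 0) :
    ‖∑ i ∈ s, c i • u i‖ ^ 2 ≤ ∑ i ∈ s, c i ^ 2 := by
  classical
  rw [← real_inner_self_eq_norm_sq, sum_inner]
  refine Finset.sum_le_sum fun i hi => ?_
  rw [inner_sum, Finset.sum_eq_single_of_mem i hi]
  · rw [real_inner_smul_left, real_inner_smul_right, real_inner_self_eq_norm_sq]
    have : ‖u i‖ ^ 2 ≤ 1 := pow_le_one₀ (norm_nonneg _) (hu i hi)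
    nlinarith [sq_nonneg (c i)]
  · intro j hj hji
    rw [real_inner_smul_left, real_inner_smul_right, hort i hi j hj hji.symm]
    ring

theorem toEuclideanLin_sum_vecMulVec {ι : Type*} (s : Finset ι)
    (u : ι → EuclideanSpace ℝ (Fin p₁)) (v : ι → EuclideanSpace ℝ (Fin p₂))
    (x : EuclideanSpace ℝ (Fin p₂)) :
    Matrix.toEuclideanLin (∑ i ∈ s, Matrix.vecMulVec (u i) (v i)) x =
      ∑ i ∈ s, inner ℝ (v i) x • u i := by
  rw [map_sum, LinearMap.sum_apply]
  exact Finset.sum_congr rfl fun i _ => toEuclideanLin_vecMulVec _ _ _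

theorem Orthonormal.norm_sq_sum_smul_le {E ι : Type*} [NormedAddCommGroup E]
    [InnerProductSpace ℝ E] {u : ι → E} (hu : Orthonormal ℝ u) (s : Finset ι) (c : ι → ℝ) :
    ‖∑ i ∈ s, c i • u i‖ ^ 2 ≤ ∑ i ∈ s, c i ^ 2 :=
  _root_.norm_sq_sum_smul_le s u c (fun i _ => (hu.1 i).le) fun _ _ _ _ hij => hu.2 hij

theorem Orthonormal.sum_inner_sq_le {E ι : Type*} [NormedAddCommGroup E]
    [InnerProductSpace ℝ E] {v : ι → E} (hv : Orthonormal ℝ v) (s : Finset ι) (x : E) :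
    ∑ i ∈ s, inner ℝ (v i) x ^ 2 ≤ ‖x‖ ^ 2 := by
  simpa using hv.sum_inner_products_le x (s := s)

theorem specNorm_sum_vecMulVec_le {ι : Type*} {u : ι → EuclideanSpace ℝ (Fin p₁)}
    {v : ι → EuclideanSpace ℝ (Fin p₂)} (hu : Orthonormal ℝ u) (hv : Orthonormal ℝ v)
    (s : Finset ι) : specNorm (∑ i ∈ s, Matrix.vecMulVec (u i) (v i)) ≤ 1 := by
  refine specNorm_le zero_le_one fun x => ?_
  rw [toEuclideanLin_sum_vecMulVec, one_mul]
  exact le_of_sq_le_sq ((hu.norm_sq_sum_smul_le _ _).trans (hv.sum_inner_sq_le _ _))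
    (norm_nonneg _)

theorem matInner_le_of_isSVD {k : ℕ} {X Y : Matrix (Fin p₁) (Fin p₂) ℝ} {a : Fin k → ℝ}
    {u : Fin k → EuclideanSpace ℝ (Fin p₁)} {v : Fin k → EuclideanSpace ℝ (Fin p₂)}
    (h : IsSVD X a u v) (hY : specNorm Y ≤ 1) : matInner X Y ≤ ∑ i, a i := by
  rw [h.eq_sum, matInner_sum_left]
  refine Finset.sum_le_sum fun i _ => ?_
  rw [matInner_smul_left]
  have := matInner_vecMulVec_le Y (u i) (v i)
  rw [h.orthonormal_left.1, h.orthonormal_right.1] at this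
  nlinarith [h.nonneg i]

theorem matInner_sum_vecMulVec_of_isSVD {k : ℕ} {X : Matrix (Fin p₁) (Fin p₂) ℝ} {a : Fin k → ℝ}
    {u : Fin k → EuclideanSpace ℝ (Fin p₁)} {v : Fin k → EuclideanSpace ℝ (Fin p₂)}
    (h : IsSVD X a u v) : matInner X (∑ i, Matrix.vecMulVec (u i) (v i)) = ∑ i, a i := by
  rw [h.eq_sum, matInner_sum_left]
  refine Finset.sum_congr rfl fun i _ => ?_
  rw [matInner_smul_left, matInner_sum_right, Finset.sum_eq_single i]
  · rw [matInner_vecMulVec, real_inner_self_eq_norm_sq, real_inner_self_eq_norm_sq,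
      h.orthonormal_left.1, h.orthonormal_right.1]
    ring
  · intro j _ hj
    rw [matInner_vecMulVec, h.orthonormal_left.2 hj.symm, zero_mul]
  · simp

theorem matInner_le_nuclearNorm (X : Matrix (Fin p₁) (Fin p₂) ℝ) {Y : Matrix (Fin p₁) (Fin p₂) ℝ}
    (hY : specNorm Y ≤ 1) : matInner X Y ≤ nuclearNorm X := by
  obtain ⟨k, a, u, v, h, hsum⟩ := exists_isSVD_sum_eq X
  exact hsum ▸ matInner_le_of_isSVD h hY

/-- The nuclear norm is dual to the spectral norm. -/
theorem exists_matInner_eq_nuclearNorm (X : Matrix (Fin p₁) (Fin p₂) ℝ) :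
    ∃ Y, specNorm Y ≤ 1 ∧ matInner X Y = nuclearNorm X := by
  obtain ⟨k, a, u, v, h, hsum⟩ := exists_isSVD_sum_eq X
  exact ⟨_, specNorm_sum_vecMulVec_le h.orthonormal_left h.orthonormal_right _,
    hsum ▸ matInner_sum_vecMulVec_of_isSVD h⟩

/-- Both sides are the maximum of `⟨X, Y⟩` over `‖Y‖ ≤ 1`, so the sum does not depend on the
decomposition. This frees the theorem from any particular choice of singular vectors. -/
theorem IsSVD.sum_eq_nuclearNorm {k : ℕ} {X : Matrix (Fin p₁) (Fin p₂) ℝ} {a : Fin k → ℝ}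
    {u : Fin k → EuclideanSpace ℝ (Fin p₁)} {v : Fin k → EuclideanSpace ℝ (Fin p₂)}
    (h : IsSVD X a u v) : ∑ i, a i = nuclearNorm X := by
  refine le_antisymm ?_ ?_
  · rw [← matInner_sum_vecMulVec_of_isSVD h]
    exact matInner_le_nuclearNorm X
      (specNorm_sum_vecMulVec_le h.orthonormal_left h.orthonormal_right _)
  · obtain ⟨Y, hY, hXY⟩ := exists_matInner_eq_nuclearNorm X
    exact hXY ▸ matInner_le_of_isSVD h hY

theorem nuclearNorm_nonneg (X : Matrix (Fin p₁) (Fin p₂) ℝ) : 0 ≤ nuclearNorm X :=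
  Finset.sum_nonneg fun _ _ => LinearMap.singularValues_nonneg _ _

theorem nuclearNorm_add_le (X Y : Matrix (Fin p₁) (Fin p₂) ℝ) :
    nuclearNorm (X + Y) ≤ nuclearNorm X + nuclearNorm Y := by
  obtain ⟨D, hD, h⟩ := exists_matInner_eq_nuclearNorm (X + Y)
  rw [← h, matInner_add_left]
  exact add_le_add (matInner_le_nuclearNorm X hD) (matInner_le_nuclearNorm Y hD)

theorem matInner_le_specNorm_mul_nuclearNorm (X Y : Matrix (Fin p₁) (Fin p₂) ℝ) :
    matInner X Y ≤ specNorm Y * nuclearNorm X := by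
  rcases (specNorm_nonneg Y).eq_or_lt with h | h
  · have h0 : Matrix.toEuclideanLin Y = 0 := by
      have : (Matrix.toEuclideanLin Y).toContinuousLinearMap = 0 := norm_eq_zero.1 h.symm
      simpa using this
    have : Y = 0 := by simpa using h0
    subst this
    simp [matInner, ← h]
  · have h1 : specNorm ((specNorm Y)⁻¹ • Y) ≤ 1 := by
      rw [specNorm_smul, abs_of_pos (inv_pos.2 h), inv_mul_cancel₀ h.ne']
    have h2 := matInner_le_nuclearNorm X h1
    rw [matInner_comm, matInner_smul_left, inv_mul_le_iff₀ h, matInner_comm] at h2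
    exact h2

/-- Duality with `Y = X`: `‖X‖_F² ≤ ‖X‖ ‖X‖_* ≤ ‖X‖_F ‖X‖_*`. -/
theorem frobNorm_le_nuclearNorm (X : Matrix (Fin p₁) (Fin p₂) ℝ) :
    frobNorm X ≤ nuclearNorm X := by
  have h := matInner_le_specNorm_mul_nuclearNorm X X
  rw [matInner_self] at h
  have h2 := mul_le_mul_of_nonneg_right (specNorm_le_frobNorm X) (nuclearNorm_nonneg X)
  rcases (frobNorm_nonneg X).eq_or_lt with h0 | h0
  · rw [← h0]; exact nuclearNorm_nonneg X
  · nlinarith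

end NuclearNorm

/-! ### The cone condition for nuclear norm minimization -/

section Cone

variable {p₁ p₂ : ℕ}

/-- Bessel's inequality for every row of `X`, summed over the rows. -/
theorem sum_norm_toEuclideanLin_sq_le {ι : Type*} {v : ι → EuclideanSpace ℝ (Fin p₂)}
    (hv : Orthonormal ℝ v) (s : Finset ι) (X : Matrix (Fin p₁) (Fin p₂) ℝ) :
    ∑ i ∈ s, ‖Matrix.toEuclideanLin X (v i)‖ ^ 2 ≤ frobNorm X ^ 2 := by
  have h1 : ∀ i, ‖Matrix.toEuclideanLin X (v i)‖ ^ 2 =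
      ∑ l, inner ℝ (v i) (WithLp.toLp 2 (X l)) ^ 2 := by
    intro i
    rw [EuclideanSpace.norm_sq_eq]
    refine Finset.sum_congr rfl fun l _ => ?_
    simp [PiLp.inner_apply, Matrix.mulVec, dotProduct]
  simp_rw [h1]
  rw [Finset.sum_comm, frobNorm, Real.sq_sqrt (by positivity)]
  refine Finset.sum_le_sum fun l _ => ?_
  refine (hv.sum_inner_sq_le s (WithLp.toLp 2 (X l))).trans (le_of_eq ?_)
  rw [EuclideanSpace.norm_sq_eq]
  simp

theorem frobNorm_transpose (X : Matrix (Fin p₁) (Fin p₂) ℝ) : frobNorm Xᵀ = frobNorm X := by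
  rw [frobNorm, frobNorm, Finset.sum_comm]
  rfl

theorem sum_norm_toEuclideanLin_le {ι : Type*} {v : ι → EuclideanSpace ℝ (Fin p₂)}
    (hv : Orthonormal ℝ v) (s : Finset ι) {r : ℕ} (hs : s.card ≤ r)
    (X : Matrix (Fin p₁) (Fin p₂) ℝ) :
    ∑ i ∈ s, ‖Matrix.toEuclideanLin X (v i)‖ ≤ Real.sqrt r * frobNorm X := by
  refine le_of_sq_le_sq ?_ (by have := frobNorm_nonneg X; positivity)
  rw [mul_pow, Real.sq_sqrt (by positivity)]
  refine sq_sum_le_card_mul_sum_sq.trans ?_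
  have := sum_norm_toEuclideanLin_sq_le hv s X
  gcongr

/-- The orthogonal projection onto the span of `u i`, `i ∈ s`, for orthonormal `u`. -/
def projMatrix {ι : Type*} {p : ℕ} (u : ι → EuclideanSpace ℝ (Fin p)) (s : Finset ι) :
    Matrix (Fin p) (Fin p) ℝ :=
  ∑ i ∈ s, Matrix.vecMulVec (u i) (u i)

theorem toEuclideanLin_projMatrix {ι : Type*} {p : ℕ} (u : ι → EuclideanSpace ℝ (Fin p))
    (s : Finset ι) (x : EuclideanSpace ℝ (Fin p)) :
    Matrix.toEuclideanLin (projMatrix u s) x = ∑ i ∈ s, inner ℝ (u i) x • u i :=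
  toEuclideanLin_sum_vecMulVec s u u x

theorem transpose_projMatrix {ι : Type*} {p : ℕ} (u : ι → EuclideanSpace ℝ (Fin p))
    (s : Finset ι) : (projMatrix u s)ᵀ = projMatrix u s := by
  simp [projMatrix, Matrix.transpose_sum, Matrix.transpose_vecMulVec]

theorem inner_one_sub_projMatrix {ι : Type*} {p : ℕ} {u : ι → EuclideanSpace ℝ (Fin p)}
    (hu : Orthonormal ℝ u) (s : Finset ι) {i : ι} (hi : i ∈ s) (x : EuclideanSpace ℝ (Fin p)) :
    inner ℝ (u i) (Matrix.toEuclideanLin (1 - projMatrix u s) x) = 0 := by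
  rw [map_sub, LinearMap.sub_apply, toEuclideanLin_projMatrix, inner_sub_right, inner_sum,
    Finset.sum_eq_single_of_mem i hi]
  · rw [real_inner_smul_right, real_inner_self_eq_norm_sq, hu.1]
    simp
  · intro j _ hj
    rw [real_inner_smul_right, hu.2 hj.symm, mul_zero]

theorem norm_sq_one_sub_projMatrix {ι : Type*} {p : ℕ} {u : ι → EuclideanSpace ℝ (Fin p)}
    (hu : Orthonormal ℝ u) (s : Finset ι) (x : EuclideanSpace ℝ (Fin p)) :
    ‖Matrix.toEuclideanLin (1 - projMatrix u s) x‖ ^ 2 =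
      ‖x‖ ^ 2 - ∑ i ∈ s, inner ℝ (u i) x ^ 2 := by
  set y := Matrix.toEuclideanLin (1 - projMatrix u s) x with hy
  have hxy : y = x - ∑ i ∈ s, inner ℝ (u i) x • u i := by
    rw [hy, map_sub, LinearMap.sub_apply, toEuclideanLin_projMatrix]
    simp
  have h0 : inner ℝ (∑ i ∈ s, inner ℝ (u i) x • u i) y = 0 := by
    rw [sum_inner]
    refine Finset.sum_eq_zero fun i hi => ?_
    rw [real_inner_smul_left, hy, inner_one_sub_projMatrix hu s hi, mul_zero]
  rw [← real_inner_self_eq_norm_sq]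
  nth_rw 1 [hxy]
  rw [inner_sub_left, h0, sub_zero, hxy, inner_sub_right, real_inner_self_eq_norm_sq, inner_sum]
  congr 1
  refine Finset.sum_congr rfl fun i _ => ?_
  rw [real_inner_smul_right, real_inner_comm, sq]

theorem toEuclideanLin_mul {p₃ : ℕ} (X : Matrix (Fin p₁) (Fin p₂) ℝ)
    (Y : Matrix (Fin p₂) (Fin p₃) ℝ) (x : EuclideanSpace ℝ (Fin p₃)) :
    Matrix.toEuclideanLin (X * Y) x = Matrix.toEuclideanLin X (Matrix.toEuclideanLin Y x) := by
  ext i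
  simp [Matrix.mulVec_mulVec]

theorem norm_one_sub_projMatrix_le {ι : Type*} {p : ℕ} {u : ι → EuclideanSpace ℝ (Fin p)}
    (hu : Orthonormal ℝ u) (s : Finset ι) (x : EuclideanSpace ℝ (Fin p)) :
    ‖Matrix.toEuclideanLin (1 - projMatrix u s) x‖ ≤ ‖x‖ := by
  refine le_of_sq_le_sq ?_ (norm_nonneg _)
  rw [norm_sq_one_sub_projMatrix hu]
  linarith [Finset.sum_nonneg fun i (_ : i ∈ s) => sq_nonneg (inner ℝ (u i) x)]

theorem transpose_one_sub_projMatrix {ι : Type*} {p : ℕ} (u : ι → EuclideanSpace ℝ (Fin p))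
    (s : Finset ι) : (1 - projMatrix u s)ᵀ = 1 - projMatrix u s := by
  rw [Matrix.transpose_sub, transpose_projMatrix, Matrix.transpose_one]

/-- A dual certificate: partial isometry on the spans, contraction on the complements. -/
theorem specNorm_certificate_le {ι : Type*} {u : ι → EuclideanSpace ℝ (Fin p₁)}
    {v : ι → EuclideanSpace ℝ (Fin p₂)} (hu : Orthonormal ℝ u) (hv : Orthonormal ℝ v)
    (s : Finset ι) {D : Matrix (Fin p₁) (Fin p₂) ℝ} (hD : specNorm D ≤ 1) :
    specNorm (∑ i ∈ s, Matrix.vecMulVec (u i) (v i) +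
      (1 - projMatrix u s) * D * (1 - projMatrix v s)) ≤ 1 := by
  refine specNorm_le zero_le_one fun x => ?_
  rw [one_mul, map_add, LinearMap.add_apply, toEuclideanLin_sum_vecMulVec, Matrix.mul_assoc,
    toEuclideanLin_mul, toEuclideanLin_mul]
  set y := Matrix.toEuclideanLin (1 - projMatrix v s) x with hy
  set z := Matrix.toEuclideanLin D y
  have hz : ‖z‖ ≤ ‖y‖ := (norm_toEuclideanLin_le D y).trans
    (mul_le_of_le_one_left (norm_nonneg _) hD)
  refine le_of_sq_le_sq ?_ (norm_nonneg _)
  -- The two parts have orthogonal ranges and act on orthogonal components of `x`, so Pythagoras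
  -- applies on both sides.
  have hort : inner ℝ (∑ i ∈ s, inner ℝ (v i) x • u i)
      (Matrix.toEuclideanLin (1 - projMatrix u s) z) = 0 := by
    rw [sum_inner]
    refine Finset.sum_eq_zero fun i hi => ?_
    rw [real_inner_smul_left, inner_one_sub_projMatrix hu s hi, mul_zero]
  rw [norm_add_sq_real, hort, mul_zero, add_zero]
  have h1 := hu.norm_sq_sum_smul_le s fun i => inner ℝ (v i) x
  have h2 := norm_one_sub_projMatrix_le hu s z
  have h3 := norm_sq_one_sub_projMatrix hv s x
  have h4 : ‖Matrix.toEuclideanLin (1 - projMatrix u s) z‖ ^ 2 ≤ ‖y‖ ^ 2 :=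
    pow_le_pow_left₀ (norm_nonneg _) (h2.trans hz) 2
  rw [← hy] at h3
  linarith

theorem matInner_sum_vecMulVec_le {ι : Type*} {u : ι → EuclideanSpace ℝ (Fin p₁)}
    {v : ι → EuclideanSpace ℝ (Fin p₂)} (hu : Orthonormal ℝ u) (hv : Orthonormal ℝ v)
    (s : Finset ι) {r : ℕ} (hs : s.card ≤ r) (X : Matrix (Fin p₁) (Fin p₂) ℝ) :
    |matInner X (∑ i ∈ s, Matrix.vecMulVec (u i) (v i))| ≤ Real.sqrt r * frobNorm X := by
  rw [matInner_sum_right]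
  refine (Finset.abs_sum_le_sum_abs _ _).trans
    ((Finset.sum_le_sum fun i _ => ?_).trans (sum_norm_toEuclideanLin_le hv s hs X))
  rw [matInner_comm, ← inner_toEuclideanLin]
  simpa [hu.1 i] using abs_real_inner_le_norm (u i) (Matrix.toEuclideanLin X (v i))

/-- Off the tangent space at a rank `r` matrix, only a part of nuclear norm at most
`2 √r ‖X‖_F` is lost. -/
theorem nuclearNorm_le_compression_add {ι : Type*} {u : ι → EuclideanSpace ℝ (Fin p₁)}
    {v : ι → EuclideanSpace ℝ (Fin p₂)} (hu : Orthonormal ℝ u) (hv : Orthonormal ℝ v)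
    (s : Finset ι) {r : ℕ} (hs : s.card ≤ r) (X : Matrix (Fin p₁) (Fin p₂) ℝ) :
    nuclearNorm X ≤ nuclearNorm ((1 - projMatrix u s) * X * (1 - projMatrix v s)) +
      2 * Real.sqrt r * frobNorm X := by
  obtain ⟨D, hD, h⟩ := exists_matInner_eq_nuclearNorm X
  -- Each term other than the compression has rank at most `r` and costs `√r ‖X‖_F` when paired with
  -- the dual matrix `D`.
  have hdec : X = (1 - projMatrix u s) * X * (1 - projMatrix v s) +
      (projMatrix u s * X + (1 - projMatrix u s) * X * projMatrix v s) := by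
    simp only [Matrix.sub_mul, Matrix.mul_sub, Matrix.one_mul, Matrix.mul_one]
    abel
  have h1 : matInner (projMatrix u s * X) D ≤ Real.sqrt r * frobNorm X := by
    rw [projMatrix, Matrix.sum_mul, matInner_sum_left]
    have := sum_norm_toEuclideanLin_le hu s hs Xᵀ
    rw [frobNorm_transpose] at this
    refine (Finset.sum_le_sum fun i _ => ?_).trans this
    have heq : Matrix.vecMulVec (u i) (u i) * X =
        Matrix.vecMulVec (u i) (Matrix.toEuclideanLin Xᵀ (u i)) := by
      rw [Matrix.vecMulVec_mul]
      simp [Matrix.mulVec_transpose]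
    rw [heq]
    refine (matInner_vecMulVec_le D (u i) (Matrix.toEuclideanLin Xᵀ (u i))).trans ?_
    rw [hu.1, one_mul]
    exact mul_le_of_le_one_left (norm_nonneg _) hD
  have h2 : matInner ((1 - projMatrix u s) * X * projMatrix v s) D ≤
      Real.sqrt r * frobNorm X := by
    rw [projMatrix.eq_1 v, Matrix.mul_sum, matInner_sum_left]
    refine (Finset.sum_le_sum fun i _ => ?_).trans (sum_norm_toEuclideanLin_le hv s hs X)
    have heq : (1 - projMatrix u s) * X * Matrix.vecMulVec (v i) (v i) =
        Matrix.vecMulVec (Matrix.toEuclideanLin (1 - projMatrix u s)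
          (Matrix.toEuclideanLin X (v i))) (v i) := by
      rw [Matrix.mul_vecMulVec, ← toEuclideanLin_mul]
      rfl
    rw [heq]
    refine (matInner_vecMulVec_le D _ (v i)).trans ?_
    rw [hv.1, mul_one]
    exact (mul_le_of_le_one_left (norm_nonneg _) hD).trans (norm_one_sub_projMatrix_le hu s _)
  have h3 := matInner_le_nuclearNorm ((1 - projMatrix u s) * X * (1 - projMatrix v s)) hD
  rw [← h]
  nth_rw 1 [hdec]
  rw [matInner_add_left, matInner_add_left]
  linarith

/-- The cone condition: if adding `X` does not increase the nuclear norm of `A`, then the nuclear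
norm of `X` is controlled by its Frobenius norm and the tail of `A`. -/
theorem nuclearNorm_le_of_nuclearNorm_add_le {k : ℕ} {A X : Matrix (Fin p₁) (Fin p₂) ℝ}
    {a : Fin k → ℝ} {u : Fin k → EuclideanSpace ℝ (Fin p₁)}
    {v : Fin k → EuclideanSpace ℝ (Fin p₂)} (hA : IsSVD A a u v) (r : ℕ)
    (h : nuclearNorm (A + X) ≤ nuclearNorm A) :
    nuclearNorm X ≤ 3 * Real.sqrt r * frobNorm X + 2 * nuclearNorm (svdTail a u v r) := by
  classical
  have hu := hA.orthonormal_left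
  have hv := hA.orthonormal_right
  -- The leading singular indices; there are fewer than `r` of them when `k < r`.
  set s : Finset (Fin k) := Finset.univ.filter fun i => ¬ r ≤ i.val with hs_def
  have hs : s.card ≤ r := by
    have : s.image Fin.val ⊆ Finset.range r := by
      intro x hx
      obtain ⟨i, hi, rfl⟩ := Finset.mem_image.1 hx
      simpa [hs_def] using hi
    have := Finset.card_le_card this
    rwa [Finset.card_image_of_injective _ Fin.val_injective, Finset.card_range] at this
  have hsplit : A = svdTail a u v r + ∑ i ∈ s, a i • Matrix.vecMulVec (u i) (v i) := by
    rw [svdTail, hs_def, Finset.sum_filter_add_sum_filter_not]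
    exact hA.eq_sum
  set T := svdTail a u v r
  have hnucA : nuclearNorm A ≤ nuclearNorm T + ∑ i ∈ s, a i := by
    rw [← hA.sum_eq_nuclearNorm, ← Finset.sum_filter_add_sum_filter_not _ (fun i => r ≤ i.val)]
    gcongr
    refine le_trans (le_of_eq ?_) (matInner_le_nuclearNorm T
      (specNorm_sum_vecMulVec_le hu hv (Finset.univ.filter fun i : Fin k => r ≤ i.val)))
    rw [show T = ∑ i with r ≤ i.val, a i • Matrix.vecMulVec (u i) (v i) from rfl,
      matInner_sum_left]
    refine Finset.sum_congr rfl fun i hi => ?_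
    rw [matInner_smul_left, matInner_sum_right, Finset.sum_eq_single_of_mem i hi]
    · rw [matInner_vecMulVec, real_inner_self_eq_norm_sq, real_inner_self_eq_norm_sq, hu.1, hv.1]
      ring
    · intro j _ hj
      rw [matInner_vecMulVec, hu.2 hj.symm, zero_mul]
  -- The certificate `Y` pairs with the head of `A` to its full nuclear norm and with `X` to
  -- `‖X'‖_*` up to `√r ‖X‖_F`. Comparing `⟨A + X, Y⟩ ≤ ‖A + X‖_* ≤ ‖A‖_*` then bounds `‖X'‖_*`; the
  -- tail of `A` is lost twice, once in each estimate of `A`.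
  set X' := (1 - projMatrix u s) * X * (1 - projMatrix v s) with hX'
  obtain ⟨D, hD, hXD⟩ := exists_matInner_eq_nuclearNorm X'
  have hY := specNorm_certificate_le hu hv s hD
  set D' := (1 - projMatrix u s) * D * (1 - projMatrix v s) with hD'
  set Y := ∑ i ∈ s, Matrix.vecMulVec (u i) (v i) + D' with hYdef
  have hXD' : matInner X D' = nuclearNorm X' := by
    rw [← hXD, hX', hD', matInner_mul_right, matInner_mul_left, transpose_one_sub_projMatrix,
      transpose_one_sub_projMatrix, Matrix.mul_assoc]
  have hXY : nuclearNorm X' - Real.sqrt r * frobNorm X ≤ matInner X Y := by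
    rw [hYdef, matInner_add_right, hXD']
    have := abs_le.1 (matInner_sum_vecMulVec_le hu hv s hs X)
    linarith [this.1]
  have hAY : ∑ i ∈ s, a i - nuclearNorm T ≤ matInner A Y := by
    have h1 : -nuclearNorm T ≤ matInner T Y := by
      have hneg : specNorm (-Y) ≤ 1 := by
        have := specNorm_smul (-1) Y
        rw [neg_one_smul] at this
        simpa [this] using hY
      have := matInner_le_nuclearNorm T hneg
      rw [matInner_comm, matInner_neg_left, matInner_comm] at this
      linarith
    have h2 : matInner (∑ i ∈ s, a i • Matrix.vecMulVec (u i) (v i)) Y = ∑ i ∈ s, a i := by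
      rw [matInner_sum_left]
      refine Finset.sum_congr rfl fun i hi => ?_
      rw [matInner_smul_left, hYdef, matInner_add_right, matInner_sum_right,
        Finset.sum_eq_single_of_mem i hi]
      · rw [matInner_vecMulVec, real_inner_self_eq_norm_sq, real_inner_self_eq_norm_sq, hu.1,
          hv.1, ← inner_toEuclideanLin, hD', Matrix.mul_assoc, toEuclideanLin_mul,
          inner_one_sub_projMatrix hu s hi]
        ring
      · intro j _ hj
        rw [matInner_vecMulVec, hu.2 hj.symm, zero_mul]
    rw [hsplit, matInner_add_left, h2]
    linarith
  have hmain := matInner_le_nuclearNorm (A + X) hY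
  rw [matInner_add_left] at hmain
  have := nuclearNorm_le_compression_add hu hv s hs X
  linarith

end Cone

/-! ### Existence of a minimizer -/

section Minimizer

variable {p₁ p₂ : ℕ}

theorem abs_apply_le_frobNorm (X : Matrix (Fin p₁) (Fin p₂) ℝ) (i : Fin p₁) (j : Fin p₂) :
    |X i j| ≤ frobNorm X := by
  rw [← norm_flatten]
  exact PiLp.norm_apply_le (flatten X) (i, j)

theorem continuous_frobNorm : Continuous (frobNorm : Matrix (Fin p₁) (Fin p₂) ℝ → ℝ) := by
  unfold frobNorm
  fun_prop

/-- A dual matrix has entries of absolute value at most one. The constant is crude, but the bound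
only serves the continuity of the nuclear norm. -/
theorem nuclearNorm_le_frobNorm (X : Matrix (Fin p₁) (Fin p₂) ℝ) :
    nuclearNorm X ≤ (p₁ * p₂ : ℕ) * frobNorm X := by
  obtain ⟨k, a, u, v, h, hsum⟩ := exists_isSVD_sum_eq X
  obtain ⟨D, hD, hXD⟩ := exists_matInner_eq_nuclearNorm X
  have hent : ∀ i j, |D i j| ≤ 1 := by
    intro i j
    have h1 := matInner_vecMulVec_le D (EuclideanSpace.single i 1) (EuclideanSpace.single j 1)
    have h2 := matInner_vecMulVec_le D (-EuclideanSpace.single i 1) (EuclideanSpace.single j 1)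
    rw [← inner_toEuclideanLin] at h1 h2
    rw [inner_neg_left] at h2
    simp [EuclideanSpace.inner_single_left] at h1 h2
    exact abs_le.2 ⟨by linarith, by linarith⟩
  rw [← hXD, matInner]
  calc ∑ i, ∑ j, X i j * D i j ≤ ∑ i : Fin p₁, ∑ j : Fin p₂, frobNorm X := by
        refine Finset.sum_le_sum fun i _ => Finset.sum_le_sum fun j _ => ?_
        refine (le_abs_self _).trans ?_
        rw [abs_mul]
        exact (mul_le_of_le_one_right (abs_nonneg _) (hent i j)).trans
          (abs_apply_le_frobNorm X i j)
    _ = _ := by simp [mul_assoc]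

theorem continuous_nuclearNorm : Continuous (nuclearNorm : Matrix (Fin p₁) (Fin p₂) ℝ → ℝ) := by
  rw [continuous_iff_continuousAt]
  intro X
  have hlim : Filter.Tendsto (fun Y => ((p₁ * p₂ : ℕ) : ℝ) * frobNorm (Y - X)) (nhds X)
      (nhds 0) := by
    have : Continuous fun Y => ((p₁ * p₂ : ℕ) : ℝ) * frobNorm (Y - X) :=
      continuous_const.mul (continuous_frobNorm.comp (continuous_id.sub continuous_const))
    have h := this.tendsto X
    simpa [frobNorm] using h
  refine tendsto_iff_dist_tendsto_zero.2 (squeeze_zero (fun _ => dist_nonneg) (fun Y => ?_) hlim)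
  rw [Real.dist_eq]
  have h1 : nuclearNorm Y ≤ nuclearNorm X + nuclearNorm (Y - X) := by
    simpa using nuclearNorm_add_le X (Y - X)
  have h2 : nuclearNorm X ≤ nuclearNorm Y + nuclearNorm (X - Y) := by
    simpa using nuclearNorm_add_le Y (X - Y)
  have h3 := nuclearNorm_le_frobNorm (Y - X)
  have h4 := nuclearNorm_le_frobNorm (X - Y)
  have h5 : frobNorm (X - Y) = frobNorm (Y - X) := by
    have := frobNorm_smul (-1) (Y - X)
    simpa using this
  rw [h5] at h4
  exact abs_le.2 ⟨by linarith, by linarith⟩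

theorem continuous_specNorm : Continuous (specNorm : Matrix (Fin p₁) (Fin p₂) ℝ → ℝ) := by
  let f : Matrix (Fin p₁) (Fin p₂) ℝ →ₗ[ℝ]
      (EuclideanSpace ℝ (Fin p₂) →L[ℝ] EuclideanSpace ℝ (Fin p₁)) :=
    (Matrix.toEuclideanLin.trans LinearMap.toContinuousLinearMap).toLinearMap
  exact f.continuous_of_finiteDimensional.norm

theorem continuous_ropMap {n : ℕ} (β : Fin n → Fin p₁ → ℝ) (γ : Fin n → Fin p₂ → ℝ) :
    Continuous (ropMap β γ) := by
  unfold ropMap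
  fun_prop

theorem continuous_ropDual {n : ℕ} (β : Fin n → Fin p₁ → ℝ) (γ : Fin n → Fin p₂ → ℝ) :
    Continuous (ropDual β γ) := by
  unfold ropDual
  fun_prop

theorem isClosed_setOf_isFeasible {n : ℕ} (β : Fin n → Fin p₁ → ℝ) (γ : Fin n → Fin p₂ → ℝ)
    (σ : ℝ) (y : Fin n → ℝ) : IsClosed {M | IsFeasible β γ σ y M} := by
  have hc : Continuous fun M => y - ropMap β γ M := continuous_const.sub (continuous_ropMap β γ)
  refine IsClosed.preimage hc (IsClosed.inter ?_ ?_)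
  · exact isClosed_le (by fun_prop) continuous_const
  · exact isClosed_le (continuous_specNorm.comp (continuous_ropDual β γ)) continuous_const

/-- Feasible matrices of nuclear norm at most that of `A` form a compact set: feasibility is a
closed condition, and the nuclear norm bounds all entries. -/
theorem exists_isNuclearNormEstimator {n : ℕ} {β : Fin n → Fin p₁ → ℝ} {γ : Fin n → Fin p₂ → ℝ}
    {σ : ℝ} {y : Fin n → ℝ} {A : Matrix (Fin p₁) (Fin p₂) ℝ} (hA : IsFeasible β γ σ y A) :
    ∃ M, IsNuclearNormEstimator β γ σ y M := by
  set K : Set (Matrix (Fin p₁) (Fin p₂) ℝ) :=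
    {M | IsFeasible β γ σ y M} ∩ {M | nuclearNorm M ≤ nuclearNorm A} with hK
  have hclosed : IsClosed K := (isClosed_setOf_isFeasible β γ σ y).inter
    (isClosed_le continuous_nuclearNorm continuous_const)
  have hsub : K ⊆ Set.pi Set.univ fun _ => Set.pi Set.univ fun _ =>
      Set.Icc (-nuclearNorm A) (nuclearNorm A) := by
    intro M hM i _ j _
    exact abs_le.1 ((abs_apply_le_frobNorm M i j).trans
      ((frobNorm_le_nuclearNorm M).trans hM.2))
  have hcomp : IsCompact K := (isCompact_univ_pi fun _ => isCompact_univ_pi fun _ =>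
    isCompact_Icc).of_isClosed_subset hclosed hsub
  obtain ⟨M, hM, hmin⟩ := hcomp.exists_isMinOn ⟨A, hA, le_refl (nuclearNorm A)⟩
    continuous_nuclearNorm.continuousOn
  refine ⟨M, hM.1, fun M' hM' => ?_⟩
  rcases le_total (nuclearNorm M') (nuclearNorm A) with h | h
  · exact hmin ⟨hM', h⟩
  · exact le_trans hM.2 h

end Minimizer

/-! ### Factorization through `ℝᵐ` and the passage from low rank to the cone -/

section Factorization

/-- A seminorm of a bilinear map that is bounded on a product of nets is bounded. -/
theorem Seminorm.bilin_le_of_net {V W G : Type*} [NormedAddCommGroup V] [NormedSpace ℝ V]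
    [FiniteDimensional ℝ V] [NormedAddCommGroup W] [NormedSpace ℝ W] [FiniteDimensional ℝ W]
    [AddCommGroup G] [Module ℝ G] (q : Seminorm ℝ G) (Φ : V →ₗ[ℝ] W →ₗ[ℝ] G) {ε c : ℝ}
    (hε : ε < 1) {N : Finset V} {N' : Finset W}
    (hN : ∀ x : V, ‖x‖ ≤ 1 → ∃ y ∈ N, ‖x - y‖ ≤ ε)
    (hN' : ∀ x : W, ‖x‖ ≤ 1 → ∃ y ∈ N', ‖x - y‖ ≤ ε)
    (hq : ∀ x ∈ N, ∀ y ∈ N', q (Φ x y) ≤ c) (x : V) (y : W) :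
    q (Φ x y) ≤ c / (1 - ε) ^ 2 * (‖x‖ * ‖y‖) := by
  have h1 : ∀ y ∈ N', q (Φ x y) ≤ c / (1 - ε) * ‖x‖ := fun y hy =>
    (q.comp (Φ.flip y)).le_of_net hε hN (fun x hx => hq x hx y hy) x
  have h2 := (q.comp (Φ x)).le_of_net hε hN' h1 y
  refine h2.trans (le_of_eq ?_)
  have : 1 - ε ≠ 0 := by linarith
  field_simp

variable {m p₁ p₂ : ℕ}

/-- The product of `U : ℝᵐ → ℝ^p₁` and the `m × p₂` matrix `W`, the latter seen as a Euclidean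
vector. -/
def factorProd (m p₁ p₂ : ℕ) :
    (EuclideanSpace ℝ (Fin m) →L[ℝ] EuclideanSpace ℝ (Fin p₁)) →ₗ[ℝ]
      EuclideanSpace ℝ (Fin m × Fin p₂) →ₗ[ℝ] Matrix (Fin p₁) (Fin p₂) ℝ :=
  LinearMap.mk₂ ℝ (fun U W => Matrix.of fun i j => U (WithLp.toLp 2 fun l => W (l, j)) i)
    (fun U U' W => by ext i j; simp)
    (fun c U W => by ext i j; simp)
    (fun U W W' => by
      ext i j
      have : (WithLp.toLp 2 fun l => (W + W') (l, j) : EuclideanSpace ℝ (Fin m)) =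
          (WithLp.toLp 2 fun l => W (l, j)) + WithLp.toLp 2 fun l => W' (l, j) := rfl
      rw [Matrix.of_apply, this, map_add]
      rfl)
    (fun c U W => by
      ext i j
      have : (WithLp.toLp 2 fun l => (c • W) (l, j) : EuclideanSpace ℝ (Fin m)) =
          c • WithLp.toLp 2 fun l => W (l, j) := rfl
      rw [Matrix.of_apply, this, map_smul]
      rfl)

theorem factorProd_apply (U : EuclideanSpace ℝ (Fin m) →L[ℝ] EuclideanSpace ℝ (Fin p₁))
    (W : EuclideanSpace ℝ (Fin m × Fin p₂)) (i : Fin p₁) (j : Fin p₂) :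
    factorProd m p₁ p₂ U W i j = U (WithLp.toLp 2 fun l => W (l, j)) i := rfl

theorem frobNorm_factorProd_le
    (U : EuclideanSpace ℝ (Fin m) →L[ℝ] EuclideanSpace ℝ (Fin p₁))
    (W : EuclideanSpace ℝ (Fin m × Fin p₂)) :
    frobNorm (factorProd m p₁ p₂ U W) ≤ ‖U‖ * ‖W‖ := by
  refine le_of_sq_le_sq ?_ (by positivity)
  have hW : ‖W‖ ^ 2 = ∑ j, ∑ l, ‖W (l, j)‖ ^ 2 := by
    rw [EuclideanSpace.norm_sq_eq W, Fintype.sum_prod_type, Finset.sum_comm]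
  rw [frobNorm, Real.sq_sqrt (by positivity), Finset.sum_comm, mul_pow, hW, Finset.mul_sum]
  refine Finset.sum_le_sum (N := ℝ) fun j _ => ?_
  have h := U.le_opNorm (WithLp.toLp 2 fun l => W (l, j))
  have h2 := pow_le_pow_left₀ (norm_nonneg _) h 2
  rw [mul_pow, EuclideanSpace.norm_sq_eq, EuclideanSpace.norm_sq_eq] at h2
  simpa [factorProd_apply] using h2

/-- A lower bound by the Frobenius norm on a product of nets extends to all products. -/
theorem le_seminorm_factorProd_of_net (q : Seminorm ℝ (Matrix (Fin p₁) (Fin p₂) ℝ)) {ε c M : ℝ}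
    (hc : 0 ≤ c) (hM : 0 ≤ M)
    {N : Finset (EuclideanSpace ℝ (Fin m) →L[ℝ] EuclideanSpace ℝ (Fin p₁))}
    {N' : Finset (EuclideanSpace ℝ (Fin m × Fin p₂))} (hN1 : ∀ x ∈ N, ‖x‖ ≤ 1)
    (hN : ∀ x, ‖x‖ ≤ 1 → ∃ y ∈ N, ‖x - y‖ ≤ ε)
    (hN' : ∀ x, ‖x‖ ≤ 1 → ∃ y ∈ N', ‖x - y‖ ≤ ε)
    (hq : ∀ x ∈ N, ∀ y ∈ N', c * frobNorm (factorProd m p₁ p₂ x y) ≤ q (factorProd m p₁ p₂ x y))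
    (hqM : ∀ x y, q (factorProd m p₁ p₂ x y) ≤ M * (‖x‖ * ‖y‖))
    {U : EuclideanSpace ℝ (Fin m) →L[ℝ] EuclideanSpace ℝ (Fin p₁)} (hU : ‖U‖ ≤ 1)
    (W : EuclideanSpace ℝ (Fin m × Fin p₂)) :
    c * frobNorm (factorProd m p₁ p₂ U W) - 2 * ε * (c + M) * ‖W‖ ≤
      q (factorProd m p₁ p₂ U W) := by
  -- The error is measured by `‖W‖`, since `‖U W‖_F` may be much smaller than `‖U‖ ‖W‖`. The case
  -- `‖W‖ ≤ 1` suffices by homogeneity in `W`, which leaves `U` in the unit ball.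
  have key : ∀ W : EuclideanSpace ℝ (Fin m × Fin p₂), ‖W‖ ≤ 1 →
      c * frobNorm (factorProd m p₁ p₂ U W) - 2 * ε * (c + M) ≤ q (factorProd m p₁ p₂ U W) := by
    intro W hW
    obtain ⟨U', hU', hUU'⟩ := hN U hU
    obtain ⟨W', hW', hWW'⟩ := hN' W hW
    have hε : 0 ≤ ε := (norm_nonneg _).trans hUU'
    have hdec : factorProd m p₁ p₂ U' W' = factorProd m p₁ p₂ U W +
        (-factorProd m p₁ p₂ (U - U') W + -factorProd m p₁ p₂ U' (W - W')) := by
      simp only [map_sub, LinearMap.sub_apply]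
      abel
    have hdec' : factorProd m p₁ p₂ U W = factorProd m p₁ p₂ U' W' +
        (factorProd m p₁ p₂ (U - U') W + factorProd m p₁ p₂ U' (W - W')) := by
      simp only [map_sub, LinearMap.sub_apply]
      abel
    have b1 : ‖U - U'‖ * ‖W‖ ≤ ε := by
      nlinarith [norm_nonneg (U - U'), norm_nonneg W]
    have b2 : ‖U'‖ * ‖W - W'‖ ≤ ε := by
      nlinarith [norm_nonneg (W - W'), norm_nonneg U', hN1 U' hU']
    have e1 : q (factorProd m p₁ p₂ (U - U') W) ≤ M * ε :=
      (hqM _ _).trans (by gcongr)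
    have e2 : q (factorProd m p₁ p₂ U' (W - W')) ≤ M * ε :=
      (hqM _ _).trans (by gcongr)
    have e3 : q (factorProd m p₁ p₂ U' W') ≤ q (factorProd m p₁ p₂ U W) + (M * ε + M * ε) := by
      rw [hdec]
      refine (map_add_le_add q _ _).trans (add_le_add le_rfl ?_)
      refine (map_add_le_add q _ _).trans ?_
      rw [map_neg_eq_map, map_neg_eq_map]
      exact add_le_add e1 e2
    have e4 : frobNorm (factorProd m p₁ p₂ U W) ≤
        frobNorm (factorProd m p₁ p₂ U' W') + (ε + ε) := by
      rw [hdec']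
      refine (frobNorm_add_le _ _).trans (add_le_add le_rfl ?_)
      refine (frobNorm_add_le _ _).trans ?_
      exact add_le_add ((frobNorm_factorProd_le _ _).trans b1)
        ((frobNorm_factorProd_le _ _).trans b2)
    have e5 := hq U' hU' W' hW'
    have e6 := mul_le_mul_of_nonneg_left e4 hc
    nlinarith
  rcases eq_or_ne W 0 with rfl | hW
  · simp [frobNorm]
  have hpos : 0 < ‖W‖ := norm_pos_iff.2 hW
  have h := key (‖W‖⁻¹ • W) (by simp [norm_smul, hpos.ne'])
  rw [map_smul, frobNorm_smul, map_smul_eq_mul, Real.norm_eq_abs, abs_of_pos (inv_pos.2 hpos)] at h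
  have h2 := mul_le_mul_of_nonneg_left h hpos.le
  calc _ = ‖W‖ * (c * (‖W‖⁻¹ * frobNorm (factorProd m p₁ p₂ U W)) - 2 * ε * (c + M)) := by
        field_simp
    _ ≤ ‖W‖ * (‖W‖⁻¹ * q (factorProd m p₁ p₂ U W)) := h2
    _ = _ := by field_simp

/-- Sums of `m` orthogonal rank one matrices factor through `ℝᵐ`. -/
theorem exists_factorProd_eq (a : Fin m → ℝ) (u : Fin m → EuclideanSpace ℝ (Fin p₁))
    (v : Fin m → EuclideanSpace ℝ (Fin p₂)) (hu : ∀ i, ‖u i‖ ≤ 1) (hv : ∀ i, ‖v i‖ ≤ 1)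
    (hort : ∀ i j, i ≠ j → inner ℝ (u i) (u j) = 0) :
    ∃ U W, ‖U‖ ≤ 1 ∧ ‖W‖ ^ 2 ≤ ∑ i, a i ^ 2 ∧
      factorProd m p₁ p₂ U W = ∑ i, a i • Matrix.vecMulVec (u i) (v i) := by
  let U : EuclideanSpace ℝ (Fin m) →L[ℝ] EuclideanSpace ℝ (Fin p₁) :=
    ∑ i, (EuclideanSpace.proj i : EuclideanSpace ℝ (Fin m) →L[ℝ] ℝ).smulRight (u i)
  have hUx : ∀ x, U x = ∑ i, x i • u i := by
    intro x
    simp [U]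
  refine ⟨U, WithLp.toLp 2 fun lj => a lj.1 * v lj.1 lj.2, ?_, ?_, ?_⟩
  · refine ContinuousLinearMap.opNorm_le_bound _ zero_le_one fun x => ?_
    rw [one_mul, hUx]
    refine le_of_sq_le_sq ?_ (norm_nonneg _)
    rw [EuclideanSpace.norm_sq_eq x]
    simpa using norm_sq_sum_smul_le Finset.univ u x (fun i _ => hu i) fun i _ j _ => hort i j
  · rw [EuclideanSpace.norm_sq_eq, Fintype.sum_prod_type]
    refine Finset.sum_le_sum fun i _ => ?_
    have h1 : ‖v i‖ ^ 2 ≤ 1 := pow_le_one₀ (norm_nonneg _) (hv i)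
    rw [EuclideanSpace.norm_sq_eq] at h1
    simp only [Real.norm_eq_abs, sq_abs, mul_pow, ← Finset.mul_sum] at h1 ⊢
    nlinarith [sq_nonneg (a i)]
  · ext i j
    rw [factorProd_apply, hUx, Matrix.sum_apply]
    simp [Matrix.vecMulVec_apply]
    exact Finset.sum_congr rfl fun l _ => by ring

theorem IsSVD.sum_sq_eq {k : ℕ} {X : Matrix (Fin p₁) (Fin p₂) ℝ} {a : Fin k → ℝ}
    {u : Fin k → EuclideanSpace ℝ (Fin p₁)} {v : Fin k → EuclideanSpace ℝ (Fin p₂)}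
    (h : IsSVD X a u v) : ∑ i, a i ^ 2 = frobNorm X ^ 2 := by
  rw [← matInner_self]
  nth_rw 1 [h.eq_sum]
  rw [h.eq_sum, matInner_sum_left]
  refine Finset.sum_congr rfl fun i _ => ?_
  rw [matInner_smul_left, matInner_sum_right, Finset.sum_eq_single i]
  · rw [matInner_comm, matInner_smul_left, matInner_vecMulVec, real_inner_self_eq_norm_sq,
      real_inner_self_eq_norm_sq, h.orthonormal_left.1, h.orthonormal_right.1]
    ring
  · intro j _ hj
    rw [matInner_comm, matInner_smul_left, matInner_vecMulVec, h.orthonormal_left.2 hj,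
      zero_mul, mul_zero]
  · simp

/-- For a nonincreasing sequence, the `ℓ²` norms of all blocks of length `m` but the first add up
to at most the `ℓ¹` norm over `√m`. -/
theorem sum_sqrt_block_le {a : ℕ → ℝ} (ha : Antitone a) (ha0 : ∀ i, 0 ≤ a i) (hm : 0 < m)
    (L : ℕ) :
    ∑ l ∈ Finset.range L, Real.sqrt (∑ j : Fin m, a ((l + 1) * m + j) ^ 2) ≤
      (∑ i ∈ Finset.range (L * m), a i) / Real.sqrt m := by
  have hm' : (0 : ℝ) < m := by exact_mod_cast hm
  have hs : 0 < Real.sqrt m := Real.sqrt_pos.2 hm'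
  induction L with
  | zero => simp
  | succ L ih =>
    have hsplit : ∑ i ∈ Finset.range ((L + 1) * m), a i =
        ∑ i ∈ Finset.range (L * m), a i + ∑ j ∈ Finset.range m, a (L * m + j) := by
      rw [Nat.succ_mul, Finset.sum_range_add]
    rw [Finset.sum_range_succ, hsplit, add_div]
    refine add_le_add ih ?_
    -- All entries of a block are at most its first one, which is at most every entry of the
    -- preceding block.
    have h1 : ∑ j : Fin m, a ((L + 1) * m + j) ^ 2 ≤ m * a ((L + 1) * m) ^ 2 := by
      calc _ ≤ ∑ _j : Fin m, a ((L + 1) * m) ^ 2 := Finset.sum_le_sum fun j _ =>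
            pow_le_pow_left₀ (ha0 _) (ha (Nat.le_add_right _ _)) 2
        _ = _ := by simp
    have h2 : m * a ((L + 1) * m) ≤ ∑ j ∈ Finset.range m, a (L * m + j) := by
      calc _ = ∑ _j ∈ Finset.range m, a ((L + 1) * m) := by simp
        _ ≤ _ := Finset.sum_le_sum fun j hj => ha (by
          have := Finset.mem_range.1 hj
          rw [Nat.succ_mul]; omega)
    calc _ ≤ Real.sqrt (m * a ((L + 1) * m) ^ 2) := Real.sqrt_le_sqrt h1
      _ = Real.sqrt m * a ((L + 1) * m) := by
        rw [Real.sqrt_mul hm'.le, Real.sqrt_sq (ha0 _)]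
      _ = (m * a ((L + 1) * m)) / Real.sqrt m := by
        rw [eq_div_iff hs.ne']
        nth_rw 3 [← Real.mul_self_sqrt hm'.le]
        ring
      _ ≤ _ := by gcongr

theorem sum_range_mul_eq {G : Type*} [AddCommMonoid G] (f : ℕ → G) (L m : ℕ) :
    ∑ i ∈ Finset.range (L * m), f i = ∑ l ∈ Finset.range L, ∑ j : Fin m, f (l * m + j) := by
  induction L with
  | zero => simp
  | succ L ih =>
    rw [Finset.sum_range_succ, Nat.succ_mul, Finset.sum_range_add, ih,
      Fin.sum_univ_eq_sum_range (fun j => f (L * m + j))]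

/-- A seminorm that compares to the Frobenius norm on products of factors through `ℝᵐ` is bounded
below in terms of the Frobenius norm and the nuclear norm. -/
theorem le_seminorm_of_factorProd (q : Seminorm ℝ (Matrix (Fin p₁) (Fin p₂) ℝ)) {κ c M : ℝ}
    (hm : 0 < m) (hc : 0 ≤ c) (hM : 0 ≤ M) (hκ : 0 ≤ κ)
    (hqM : ∀ U W, q (factorProd m p₁ p₂ U W) ≤ M * (‖U‖ * ‖W‖))
    (hqc : ∀ U W, ‖U‖ ≤ 1 →
      c * frobNorm (factorProd m p₁ p₂ U W) - κ * ‖W‖ ≤ q (factorProd m p₁ p₂ U W))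
    (X : Matrix (Fin p₁) (Fin p₂) ℝ) :
    (c - κ) * frobNorm X - (c + M) * (nuclearNorm X / Real.sqrt m) ≤ q X := by
  obtain ⟨k, a, u, v, h⟩ := exists_isSVD X
  -- Padding by zeros makes all blocks have length `m`. The padded vectors are no longer
  -- orthonormal, only orthogonal of norm at most one, which is all that `exists_factorProd_eq`
  -- needs.
  let a' : ℕ → ℝ := fun i => if hi : i < k then a ⟨i, hi⟩ else 0
  let u' : ℕ → EuclideanSpace ℝ (Fin p₁) := fun i => if hi : i < k then u ⟨i, hi⟩ else 0
  let v' : ℕ → EuclideanSpace ℝ (Fin p₂) := fun i => if hi : i < k then v ⟨i, hi⟩ else 0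
  have ha0 : ∀ i, 0 ≤ a' i := fun i => by
    by_cases hi : i < k <;> simp [a', hi, h.nonneg]
  have ha : Antitone a' := by
    intro i j hij
    by_cases hj : j < k
    · simp only [a', hj, hij.trans_lt hj, dif_pos]
      exact h.antitone hij
    · simpa [a', hj] using ha0 i
  have hu : ∀ i, ‖u' i‖ ≤ 1 := fun i => by
    by_cases hi : i < k <;> simp [u', hi, h.orthonormal_left.1]
  have hv : ∀ i, ‖v' i‖ ≤ 1 := fun i => by
    by_cases hi : i < k <;> simp [v', hi, h.orthonormal_right.1]
  have hort : ∀ i j, i ≠ j → inner ℝ (u' i) (u' j) = 0 := by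
    intro i j hij
    by_cases hi : i < k <;> by_cases hj : j < k <;> simp [u', hi, hj]
    exact h.orthonormal_left.2 (by simpa using hij)
  have hext : ∀ {G : Type} [AddCommMonoid G] (f : ℕ → G) (g : Fin k → G),
      (∀ i : Fin k, f i = g i) → (∀ i, k ≤ i → f i = 0) →
      ∑ i, g i = ∑ i ∈ Finset.range ((k + 1) * m), f i := by
    intro G _ f g hfg hf0
    have hk : k ≤ (k + 1) * m := by nlinarith
    rw [← Finset.sum_subset (Finset.range_mono hk) fun i _ hi => hf0 i (by simpa using hi),
      ← Fin.sum_univ_eq_sum_range]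
    exact Finset.sum_congr rfl fun i _ => (hfg i).symm
  have hX : X = ∑ l ∈ Finset.range (k + 1), ∑ j : Fin m,
      a' (l * m + j) • Matrix.vecMulVec (u' (l * m + j)) (v' (l * m + j)) := by
    rw [← sum_range_mul_eq (fun i => a' i • Matrix.vecMulVec (u' i) (v' i))]
    rw [← hext (fun i => a' i • Matrix.vecMulVec (u' i) (v' i))
      (fun i => a i • Matrix.vecMulVec (u i) (v i)) (fun i => by simp [a', u', v'])
      (fun i hi => by simp [a', hi.not_gt])]
    exact h.eq_sum
  have hnuc : ∑ i ∈ Finset.range ((k + 1) * m), a' i = nuclearNorm X := by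
    rw [← h.sum_eq_nuclearNorm]
    exact (hext a' a (fun i => by simp [a']) (fun i hi => by simp [a', hi.not_gt])).symm
  have hfrob : ∑ l ∈ Finset.range (k + 1), ∑ j : Fin m, a' (l * m + j) ^ 2 = frobNorm X ^ 2 := by
    rw [← h.sum_sq_eq, ← sum_range_mul_eq (fun i => a' i ^ 2)]
    exact (hext (fun i => a' i ^ 2) (fun i => a i ^ 2) (fun i => by simp [a'])
      (fun i hi => by simp [a', hi.not_gt])).symm
  have hfac : ∀ l, ∃ U W, ‖U‖ ≤ 1 ∧ ‖W‖ ^ 2 ≤ ∑ j : Fin m, a' (l * m + j) ^ 2 ∧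
      factorProd m p₁ p₂ U W = ∑ j : Fin m,
        a' (l * m + j) • Matrix.vecMulVec (u' (l * m + j)) (v' (l * m + j)) := fun l =>
    exists_factorProd_eq _ _ _ (fun _ => hu _) (fun _ => hv _) fun i j hij => hort _ _ (by
      intro heq
      exact hij (Fin.ext (by omega)))
  choose U W hU hW hUW using hfac
  simp_rw [← hUW] at hX
  -- Block `0` is split off; the remaining `k` blocks form the remainder `R`.
  rw [Finset.sum_range_succ'] at hX
  set R := ∑ l ∈ Finset.range k, factorProd m p₁ p₂ (U (l + 1)) (W (l + 1)) with hR
  have hWsum : ∑ l ∈ Finset.range k, ‖W (l + 1)‖ ≤ nuclearNorm X / Real.sqrt m := by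
    calc _ ≤ ∑ l ∈ Finset.range k, Real.sqrt (∑ j : Fin m, a' ((l + 1) * m + j) ^ 2) :=
          Finset.sum_le_sum fun l _ => Real.le_sqrt_of_sq_le (hW _)
      _ ≤ (∑ i ∈ Finset.range (k * m), a' i) / Real.sqrt m := sum_sqrt_block_le ha ha0 hm k
      _ ≤ _ := by
        rw [← hnuc]
        gcongr
        · intro i _ _
          exact ha0 i
        · omega
  -- This turns the loss `κ ‖W 0‖` of the head into `κ ‖X‖_F`.
  have hW0 : ‖W 0‖ ≤ frobNorm X := by
    refine le_of_sq_le_sq ((hW 0).trans ?_) (frobNorm_nonneg X)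
    rw [← hfrob]
    exact Finset.single_le_sum (f := fun l => ∑ j : Fin m, a' (l * m + j) ^ 2)
      (fun l _ => by positivity) (by simp)
  have hqR : q R ≤ M * (nuclearNorm X / Real.sqrt m) := by
    calc q R ≤ ∑ l ∈ Finset.range k, q (factorProd m p₁ p₂ (U (l + 1)) (W (l + 1))) :=
          Finset.le_sum_of_subadditive q (map_zero q).le (map_add_le_add q) _ _
      _ ≤ ∑ l ∈ Finset.range k, M * ‖W (l + 1)‖ := Finset.sum_le_sum fun l _ =>
          (hqM _ _).trans (by gcongr; exact mul_le_of_le_one_left (norm_nonneg _) (hU _))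
      _ ≤ _ := by
        rw [← Finset.mul_sum]
        gcongr
  have hFR : frobNorm R ≤ nuclearNorm X / Real.sqrt m := by
    refine (frobNorm_sum_le _ _).trans ((Finset.sum_le_sum fun l _ => ?_).trans hWsum)
    exact (frobNorm_factorProd_le _ _).trans (mul_le_of_le_one_left (norm_nonneg _) (hU _))
  set Z := factorProd m p₁ p₂ (U 0) (W 0) with hZ
  have h1 := hqc (U 0) (W 0) (hU 0)
  rw [← hZ] at h1
  have h2 : q Z ≤ q X + q R := by
    have : Z = X + -R := by rw [hX]; abel
    rw [this]
    exact (map_add_le_add q _ _).trans (by rw [map_neg_eq_map])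
  have h3 : frobNorm X ≤ frobNorm R + frobNorm Z := by
    nth_rw 1 [hX]
    exact frobNorm_add_le _ _
  have h4 := mul_le_mul_of_nonneg_left (h3.trans (add_le_add hFR le_rfl)) hc
  have h5 := mul_le_mul_of_nonneg_left hW0 hκ
  linarith

end Factorization

/-! ### The deterministic error bound -/

section Estimate

variable {n p₁ p₂ : ℕ}

theorem ropMap_add (β : Fin n → Fin p₁ → ℝ) (γ : Fin n → Fin p₂ → ℝ)
    (X Y : Matrix (Fin p₁) (Fin p₂) ℝ) : ropMap β γ (X + Y) = ropMap β γ X + ropMap β γ Y := by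
  ext i
  simp [ropMap, Matrix.add_mulVec, dotProduct_add]

theorem ropMap_smul (β : Fin n → Fin p₁ → ℝ) (γ : Fin n → Fin p₂ → ℝ) (c : ℝ)
    (X : Matrix (Fin p₁) (Fin p₂) ℝ) : ropMap β γ (c • X) = c • ropMap β γ X := by
  ext i
  simp [ropMap, Matrix.smul_mulVec, dotProduct_smul]

theorem matInner_ropDual (β : Fin n → Fin p₁ → ℝ) (γ : Fin n → Fin p₂ → ℝ)
    (X : Matrix (Fin p₁) (Fin p₂) ℝ) (w : Fin n → ℝ) :
    matInner X (ropDual β γ w) = ∑ i, w i * ropMap β γ X i := by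
  rw [ropDual, matInner_sum_right]
  refine Finset.sum_congr rfl fun i _ => ?_
  rw [matInner_comm, matInner_smul_left, matInner, ropMap]
  simp only [Matrix.vecMulVec_apply, dotProduct, Matrix.mulVec, Finset.mul_sum]
  exact Finset.sum_congr rfl fun a _ => Finset.sum_congr rfl fun b _ => by ring

theorem ropDual_sub (β : Fin n → Fin p₁ → ℝ) (γ : Fin n → Fin p₂ → ℝ) (w w' : Fin n → ℝ) :
    ropDual β γ (w - w') = ropDual β γ w - ropDual β γ w' := by
  simp [ropDual, sub_smul]

/-- The `ℓ¹` norm of the rank-one projections. -/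
noncomputable def ropSeminorm (β : Fin n → Fin p₁ → ℝ) (γ : Fin n → Fin p₂ → ℝ) :
    Seminorm ℝ (Matrix (Fin p₁) (Fin p₂) ℝ) :=
  Seminorm.of (fun X => ∑ i, |ropMap β γ X i|)
    (fun X Y => by
      simp only [ropMap_add, Pi.add_apply, ← Finset.sum_add_distrib]
      exact Finset.sum_le_sum fun i _ => abs_add_le _ _)
    (fun c X => by simp [ropMap_smul, abs_mul, Finset.mul_sum])

theorem ropSeminorm_apply (β : Fin n → Fin p₁ → ℝ) (γ : Fin n → Fin p₂ → ℝ)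
    (X : Matrix (Fin p₁) (Fin p₂) ℝ) : ropSeminorm β γ X = ∑ i, |ropMap β γ X i| := rfl

/-- From `(a + b)² ≤ 2 a² + 2 b²`: the constants are `2 · 12²` and `2 · 6² · 2`. -/
theorem dantzigThreshold_sq_le (n p₁ p₂ : ℕ) (σ : ℝ) :
    dantzigThreshold n p₁ p₂ σ ^ 2 ≤
      σ ^ 2 * (288 * Real.log n * ((p₁ : ℝ) + p₂) ^ 2 + 144 * n * ((p₁ : ℝ) + p₂)) := by
  have h1 : Real.sqrt (Real.log n) ^ 2 = Real.log n := Real.sq_sqrt (Real.log_natCast_nonneg n)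
  have h2 : Real.sqrt (2 * (n : ℝ) * ((p₁ : ℝ) + p₂)) ^ 2 = 2 * (n : ℝ) * ((p₁ : ℝ) + p₂) :=
    Real.sq_sqrt (by positivity)
  rw [dantzigThreshold, mul_pow]
  refine mul_le_mul_of_nonneg_left ?_ (sq_nonneg σ)
  refine (add_sq_le).trans (le_of_eq ?_)
  rw [mul_pow, mul_pow, mul_pow, h1, h2]
  ring

/-- The deterministic part of the analysis of the nuclear norm estimator. -/
theorem frobNorm_sub_sq_le {β : Fin n → Fin p₁ → ℝ} {γ : Fin n → Fin p₂ → ℝ} {c σ : ℝ} {r : ℕ}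
    (hn : 0 < n) (hr : 0 < r) (hc : 0 < c) (hσ : 0 ≤ σ)
    (hq : ∀ X, nuclearNorm X ≤ 8 * Real.sqrt r * frobNorm X →
      c * n * frobNorm X ≤ ropSeminorm β γ X)
    {z : Fin n → ℝ} (hz : z ∈ residualSet β γ σ) {A M : Matrix (Fin p₁) (Fin p₂) ℝ}
    (hM : IsNuclearNormEstimator β γ σ (ropMap β γ A + z) M) {k : ℕ} {a : Fin k → ℝ}
    {u : Fin k → EuclideanSpace ℝ (Fin p₁)} {v : Fin k → EuclideanSpace ℝ (Fin p₂)}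
    (hA : IsSVD A a u v) :
    frobNorm (M - A) ^ 2 ≤ (4 / c ^ 2 + 73728 / c ^ 4) * σ ^ 2 *
        min ((r : ℝ) * Real.log n * ((p₁ : ℝ) + p₂) ^ 2 / (n : ℝ) ^ 2
          + (r : ℝ) * ((p₁ : ℝ) + p₂) / (n : ℝ)) 1
      + 1 * nuclearNorm (svdTail a u v r) ^ 2 / (r : ℝ) := by
  have hn' : (0 : ℝ) < n := by exact_mod_cast hn
  have hr' : (0 : ℝ) < r := by exact_mod_cast hr
  have hsr : 0 < Real.sqrt r := Real.sqrt_pos.2 hr'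
  have hsr2 : Real.sqrt r ^ 2 = r := Real.sq_sqrt hr'.le
  obtain ⟨hfeas, hmin⟩ := hM
  have hAfeas : IsFeasible β γ σ (ropMap β γ A + z) A := by
    rw [IsFeasible, add_sub_cancel_left]
    exact hz
  set X := M - A with hX
  have hMX : M = A + X := by rw [hX]; abel
  have hcone : nuclearNorm X ≤ 3 * Real.sqrt r * frobNorm X + 2 * nuclearNorm (svdTail a u v r) :=
    nuclearNorm_le_of_nuclearNorm_add_le hA r (hMX ▸ hmin A hAfeas)
  have hres : ropMap β γ A + z - ropMap β γ M = z - ropMap β γ X := by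
    rw [hMX, ropMap_add]; abel
  have hw : z - ropMap β γ X ∈ residualSet β γ σ := hres ▸ hfeas
  have hq2 : ropSeminorm β γ X ≤ 2 * σ * n := by
    have h1 := (div_le_iff₀ hn').1 hz.1
    have h2 := (div_le_iff₀ hn').1 hw.1
    rw [ropSeminorm_apply]
    calc ∑ i, |ropMap β γ X i| ≤ ∑ i, (|z i| + |(z - ropMap β γ X) i|) := by
          refine Finset.sum_le_sum fun i _ => ?_
          have := abs_sub (z i) ((z - ropMap β γ X) i)
          simpa using this
      _ ≤ _ := by rw [Finset.sum_add_distrib]; linarith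
  set η := dantzigThreshold n p₁ p₂ σ with hη
  have hdual : specNorm (ropDual β γ (ropMap β γ X)) ≤ 2 * η := by
    have h1 : specNorm (ropDual β γ z) ≤ η := hz.2
    have h2 : specNorm (ropDual β γ (z - ropMap β γ X)) ≤ η := hw.2
    have : ropMap β γ X = z - (z - ropMap β γ X) := by abel
    rw [this, ropDual_sub]
    exact (specNorm_sub_le _ _).trans (by linarith)
  -- Cauchy–Schwarz passes to `‖𝒳(X)‖₂² = ⟨X, 𝒳*𝒳(X)⟩`, and duality bounds this by `2 η ‖X‖_*`.
  have hsq : ropSeminorm β γ X ^ 2 ≤ n * (2 * η * nuclearNorm X) := by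
    have h1 := matInner_le_specNorm_mul_nuclearNorm X (ropDual β γ (ropMap β γ X))
    rw [matInner_ropDual] at h1
    have h2 := mul_le_mul_of_nonneg_right hdual (nuclearNorm_nonneg X)
    have h3 := sq_sum_le_card_mul_sum_sq (s := Finset.univ) (f := fun i => |ropMap β γ X i|)
    simp only [sq_abs, Finset.card_univ, Fintype.card_fin] at h3
    rw [ropSeminorm_apply]
    refine h3.trans (mul_le_mul_of_nonneg_left ?_ hn'.le)
    simp_rw [sq]
    exact h1.trans h2
  have hF := frobNorm_nonneg X
  have hT := nuclearNorm_nonneg (svdTail a u v r)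
  set F := frobNorm X
  set t := nuclearNorm (svdTail a u v r)
  have hlog := Real.log_natCast_nonneg n
  set x := (r : ℝ) * Real.log n * ((p₁ : ℝ) + p₂) ^ 2 / (n : ℝ) ^ 2
          + (r : ℝ) * ((p₁ : ℝ) + p₂) / (n : ℝ) with hx
  have hx0 : 0 ≤ x := by positivity
  have hmin0 : 0 ≤ min x 1 := le_min hx0 zero_le_one
  -- Outside the cone, `hcone` leaves `5 √r F < 2 t`, so the tail alone bounds the error.
  rcases lt_or_ge (8 * Real.sqrt r * F) (nuclearNorm X) with hcase | hcase
  · have h1 : Real.sqrt r * F ≤ t := by nlinarith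
    have h2 : r * F ^ 2 ≤ t ^ 2 := by
      have := pow_le_pow_left₀ (by positivity) h1 2
      rwa [mul_pow, hsr2] at this
    have h3 : F ^ 2 ≤ 1 * t ^ 2 / r := by
      rw [le_div_iff₀ hr']; linarith
    have : 0 ≤ (4 / c ^ 2 + 73728 / c ^ 4) * σ ^ 2 * min x 1 := by positivity
    linarith
  · have hlow := hq X hcase
    have ht0 : 0 ≤ 1 * t ^ 2 / r := by positivity
    have b1 : F ^ 2 ≤ 4 / c ^ 2 * σ ^ 2 := by
      have h1 : c * F ≤ 2 * σ := by
        refine le_of_mul_le_mul_right ?_ hn'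
        linarith
      have h2 := pow_le_pow_left₀ (by positivity) h1 2
      rw [div_mul_eq_mul_div, le_div_iff₀ (by positivity)]
      linarith
    have b2 : F ^ 2 ≤ 73728 / c ^ 4 * σ ^ 2 * x := by
      -- Here `16 = 2 · 8`, from `hsq` and the cone; one factor `n F` cancels. Squaring yields `16²
      -- · 288 = 73728`.
      have h1 : c ^ 2 * n * F ≤ 16 * η * Real.sqrt r := by
        rcases hF.eq_or_lt with h0 | h0
        · rw [← h0, mul_zero]
          have : 0 ≤ η := by rw [hη, dantzigThreshold]; positivity
          positivity
        · have h2 : (c * n * F) ^ 2 ≤ n * (2 * η * (8 * Real.sqrt r * F)) := by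
            refine (pow_le_pow_left₀ (by positivity) hlow 2).trans (hsq.trans ?_)
            have : 0 ≤ η := by rw [hη, dantzigThreshold]; positivity
            gcongr
          refine le_of_mul_le_mul_right ?_ (mul_pos hn' h0)
          linarith
      have h2 := pow_le_pow_left₀ (by positivity) h1 2
      have h3 := dantzigThreshold_sq_le n p₁ p₂ σ
      rw [← hη] at h3
      rw [mul_pow, mul_pow, mul_pow, mul_pow, hsr2] at h2
      have h4 : η ^ 2 * r ≤ 288 * σ ^ 2 * (n ^ 2 * x) := by
        have hxn : (n : ℝ) ^ 2 * x = r * Real.log n * ((p₁ : ℝ) + p₂) ^ 2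
            + r * n * ((p₁ : ℝ) + p₂) := by
          rw [hx]; field_simp
        rw [hxn]
        have h5 := mul_le_mul_of_nonneg_right h3 hr'.le
        have h6 : 0 ≤ σ ^ 2 * (r * n * ((p₁ : ℝ) + p₂)) := by positivity
        linarith
      have h7 : (n : ℝ) ^ 2 * (c ^ 4 * F ^ 2) ≤ n ^ 2 * (73728 * σ ^ 2 * x) := by
        linarith
      have h8 := le_of_mul_le_mul_left h7 (by positivity)
      rw [div_mul_eq_mul_div, div_mul_eq_mul_div, le_div_iff₀ (by positivity)]
      linarith
    have hW1 : 0 ≤ 4 / c ^ 2 * σ ^ 2 := by positivity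
    have hW2 : 0 ≤ 73728 / c ^ 4 * σ ^ 2 := by positivity
    have hmain : F ^ 2 ≤ (4 / c ^ 2 + 73728 / c ^ 4) * σ ^ 2 * min x 1 := by
      rcases le_total x 1 with h | h
      · rw [min_eq_left h]; nlinarith
      · rw [min_eq_right h]; nlinarith
    linarith

end Estimate

/-! ### Exponential moments and Chernoff's bound, by lower integrals -/

section Chernoff

/-- The integral of a product of functions of the coordinates. -/
theorem lintegral_pi_prod {ι : Type*} [Fintype ι] {S : ι → Type*} [∀ i, MeasurableSpace (S i)]
    (ν : ∀ i, Measure (S i)) [∀ i, IsProbabilityMeasure (ν i)] (f : ∀ i, S i → ENNReal)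
    (hf : ∀ i, Measurable (f i)) :
    ∫⁻ x, ∏ i, f i (x i) ∂(Measure.pi ν) = ∏ i, ∫⁻ y, f i y ∂(ν i) := by
  rw [lintegral_prod_eq_prod_lintegral_of_indepFun Finset.univ (fun i (x : ∀ i, S i) => f i (x i))
    (iIndepFun_pi fun i => (hf i).aemeasurable) fun i => (hf i).comp (measurable_pi_apply i)]
  refine Finset.prod_congr rfl fun i _ => ?_
  exact (measurePreserving_eval ν i).lintegral_comp (hf i)

/-- Markov's inequality for exponentials. -/
theorem measure_nonneg_le_lintegral_exp {S : Type*} [MeasurableSpace S] (ν : Measure S)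
    {f : S → ℝ} (hf : Measurable f) :
    ν {x | 0 ≤ f x} ≤ ∫⁻ x, ENNReal.ofReal (Real.exp (f x)) ∂ν := by
  have h := mul_meas_ge_le_lintegral (μ := ν)
    (f := fun x => ENNReal.ofReal (Real.exp (f x))) (by fun_prop) 1
  rw [one_mul] at h
  refine (measure_mono fun x hx => ?_).trans h
  have : (1 : ℝ) ≤ Real.exp (f x) := Real.one_le_exp hx
  simpa using ENNReal.ofReal_le_ofReal this

/-- Chernoff's bound for sums of independent random variables. -/
theorem measure_pi_sum_nonneg_le {n : ℕ} {S : Type*} [MeasurableSpace S] (ν : Measure S)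
    [IsProbabilityMeasure ν] {f : Fin n → S → ℝ} (hf : ∀ i, Measurable (f i)) {b : Fin n → ℝ}
    (hb : ∀ i, ∫⁻ y, ENNReal.ofReal (Real.exp (f i y)) ∂ν ≤ ENNReal.ofReal (Real.exp (b i))) :
    Measure.pi (fun _ : Fin n => ν) {x | 0 ≤ ∑ i, f i (x i)} ≤
      ENNReal.ofReal (Real.exp (∑ i, b i)) := by
  refine (measure_nonneg_le_lintegral_exp _ (by fun_prop)).trans ?_
  have h1 : ∀ x : Fin n → S, ENNReal.ofReal (Real.exp (∑ i, f i (x i))) =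
      ∏ i, ENNReal.ofReal (Real.exp (f i (x i))) := fun x => by
    rw [Real.exp_sum, ENNReal.ofReal_prod_of_nonneg fun i _ => (Real.exp_pos _).le]
  simp_rw [h1]
  rw [lintegral_pi_prod (fun _ => ν) (fun i y => ENNReal.ofReal (Real.exp (f i y)))
    fun i => by have := hf i; fun_prop, Real.exp_sum,
    ENNReal.ofReal_prod_of_nonneg fun i _ => (Real.exp_pos _).le]
  exact Finset.prod_le_prod' fun i _ => hb i

end Chernoff

/-! ### Gaussian vectors and the chaos of order two -/

section Gaussian

/-- The standard Gaussian measure on `ι → ℝ`. -/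
noncomputable abbrev gaussianPi (ι : Type*) [Fintype ι] : Measure (ι → ℝ) :=
  Measure.pi fun _ => gaussianReal 0 1

/-- Linear functionals of a standard Gaussian vector are Gaussian. -/
theorem gaussianPi_map_dotProduct {ι : Type*} [Fintype ι] (w : ι → ℝ) :
    (gaussianPi ι).map (fun b => b ⬝ᵥ w) = gaussianReal 0 (∑ i, w i ^ 2).toNNReal := by
  classical
  let L : StrongDual ℝ (EuclideanSpace ℝ ι) := innerSL ℝ (WithLp.toLp 2 w)
  have h1 := IsGaussian.map_eq_gaussianReal (μ := stdGaussian (EuclideanSpace ℝ ι)) L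
  rw [integral_strongDual_stdGaussian, variance_dual_stdGaussian, ← map_pi_eq_stdGaussian,
    Measure.map_map (by fun_prop) (by fun_prop), innerSL_apply_norm, EuclideanSpace.norm_sq_eq]
    at h1
  convert h1 using 2
  · ext b
    simp [L, PiLp.inner_apply, dotProduct]
  · simp

theorem lintegral_exp_mul_gaussianReal (v : NNReal) (t : ℝ) :
    ∫⁻ x, ENNReal.ofReal (Real.exp (t * x)) ∂(gaussianReal 0 v) =
      ENNReal.ofReal (Real.exp (v * t ^ 2 / 2)) := by
  rw [← ofReal_integral_eq_lintegral_ofReal (integrable_exp_mul_gaussianReal t)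
    (ae_of_all _ fun _ => (Real.exp_pos _).le)]
  have := congrFun (mgf_fun_id_gaussianReal (μ := 0) (v := v)) t
  rw [mgf] at this
  rw [this]
  simp

theorem lintegral_exp_dotProduct {ι : Type*} [Fintype ι] (w : ι → ℝ) (t : ℝ) :
    ∫⁻ b, ENNReal.ofReal (Real.exp (t * (b ⬝ᵥ w))) ∂(gaussianPi ι) =
      ENNReal.ofReal (Real.exp (t ^ 2 / 2 * ∑ i, w i ^ 2)) := by
  have h := lintegral_map (μ := gaussianPi ι)
    (f := fun x => ENNReal.ofReal (Real.exp (t * x))) (g := fun b : ι → ℝ => b ⬝ᵥ w)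
    (by fun_prop) (by fun_prop)
  rw [← h, gaussianPi_map_dotProduct, lintegral_exp_mul_gaussianReal,
    Real.coe_toNNReal _ (by positivity)]
  ring_nf

theorem lintegral_sq_dotProduct {ι : Type*} [Fintype ι] (w : ι → ℝ) :
    ∫⁻ b, ENNReal.ofReal ((b ⬝ᵥ w) ^ 2) ∂(gaussianPi ι) = ENNReal.ofReal (∑ i, w i ^ 2) := by
  have h := lintegral_map (μ := gaussianPi ι)
    (f := fun x => ENNReal.ofReal (x ^ 2)) (g := fun b : ι → ℝ => b ⬝ᵥ w)
    (by fun_prop) (by fun_prop)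
  rw [← h, gaussianPi_map_dotProduct]
  set v := (∑ i, w i ^ 2).toNNReal with hv
  have hint : Integrable (fun x : ℝ => x ^ 2) (gaussianReal 0 v) :=
    (memLp_id_gaussianReal 2).integrable_sq
  rw [← ofReal_integral_eq_lintegral_ofReal hint
    (ae_of_all _ fun _ => sq_nonneg _)]
  have h2 := variance_fun_id_gaussianReal (μ := 0) (v := v)
  rw [variance_of_integral_eq_zero (by fun_prop) integral_id_gaussianReal] at h2
  rw [h2, hv, Real.coe_toNNReal _ (by positivity)]

/-- The integrand times the density is again a Gaussian, with exponent `-(1/2 - s) x²`. -/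
theorem lintegral_exp_sq_gaussianReal {s : ℝ} (hs : s < 1 / 2) :
    ∫⁻ x, ENNReal.ofReal (Real.exp (s * x ^ 2)) ∂(gaussianReal 0 1) =
      ENNReal.ofReal (1 / Real.sqrt (1 - 2 * s)) := by
  rw [gaussianReal_of_var_ne_zero 0 one_ne_zero,
    lintegral_withDensity_eq_lintegral_mul _ (measurable_gaussianPDF 0 1) (by fun_prop)]
  have h1 : ∀ x, (gaussianPDF 0 1 * fun x => ENNReal.ofReal (Real.exp (s * x ^ 2))) x =
      ENNReal.ofReal ((Real.sqrt (2 * Real.pi))⁻¹ * Real.exp (-(1 / 2 - s) * x ^ 2)) := by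
    intro x
    rw [Pi.mul_apply, gaussianPDF, ← ENNReal.ofReal_mul (gaussianPDFReal_nonneg _ _ _),
      gaussianPDFReal]
    congr 1
    rw [mul_assoc, ← Real.exp_add]
    congr 2
    · simp
    · simp
      ring
  simp_rw [h1]
  have hb : 0 < 1 / 2 - s := by linarith
  rw [← ofReal_integral_eq_lintegral_ofReal ((integrable_exp_neg_mul_sq hb).const_mul _)
    (ae_of_all _ fun _ => by positivity), integral_const_mul, integral_gaussian]
  congr 1
  rw [← Real.sqrt_inv, ← Real.sqrt_mul (by positivity),
    show 1 / Real.sqrt (1 - 2 * s) = Real.sqrt (1 - 2 * s)⁻¹ by rw [Real.sqrt_inv, one_div]]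
  congr 1
  have : 1 - 2 * s ≠ 0 := by linarith
  have : 1 / 2 - s ≠ 0 := hb.ne'
  have := Real.pi_ne_zero
  field_simp

theorem lintegral_exp_sq_dotProduct {ι : Type*} [Fintype ι] {w : ι → ℝ} (hw : ∑ i, w i ^ 2 = 1)
    {s : ℝ} (hs : s < 1 / 2) :
    ∫⁻ b, ENNReal.ofReal (Real.exp (s * (b ⬝ᵥ w) ^ 2)) ∂(gaussianPi ι) =
      ENNReal.ofReal (1 / Real.sqrt (1 - 2 * s)) := by
  have h := lintegral_map (μ := gaussianPi ι)
    (f := fun x => ENNReal.ofReal (Real.exp (s * x ^ 2))) (g := fun b : ι → ℝ => b ⬝ᵥ w)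
    (by fun_prop) (by fun_prop)
  rw [← h, gaussianPi_map_dotProduct, hw, Real.toNNReal_one, lintegral_exp_sq_gaussianReal hs]

/-- Jensen's inequality for the exponential function and weights of sum at most one. -/
theorem exp_sum_mul_le {ι : Type*} [Fintype ι] (w τ : ι → ℝ) (hw : ∀ i, 0 ≤ w i)
    (hsum : ∑ i, w i ≤ 1) :
    Real.exp (∑ i, w i * τ i) ≤ (1 - ∑ i, w i) + ∑ i, w i * Real.exp (τ i) := by
  -- The missing mass `1 - ∑ w i` is placed at the point `0`, indexed by `none`.
  have h := convexOn_exp.map_sum_le (t := (Finset.univ : Finset (Option ι)))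
    (w := fun o => o.elim (1 - ∑ i, w i) w) (p := fun o => o.elim 0 τ)
    (by rintro (_ | i) _ <;> simp [hw, hsum]) (by simp [Fintype.sum_option]) (by simp)
  simpa [Fintype.sum_option] using h

variable {p₁ p₂ : ℕ}

/-- The exponential moment of the squared norm of the image of a Gaussian vector. -/
theorem lintegral_exp_norm_sq_mulVec_le {h : Matrix (Fin p₁) (Fin p₂) ℝ} (hF : frobNorm h ≤ 1)
    {s : ℝ} (hs0 : 0 ≤ s) (hs : s < 1 / 2) :
    ∫⁻ g, ENNReal.ofReal (Real.exp (s * ∑ i, (h *ᵥ g) i ^ 2)) ∂(gaussianPi (Fin p₂)) ≤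
      ENNReal.ofReal (1 / Real.sqrt (1 - 2 * s)) := by
  set w : Fin p₁ → ℝ := fun i => ∑ j, h i j ^ 2 with hw
  have hw0 : ∀ i, 0 ≤ w i := fun i => by positivity
  have hw1 : ∑ i, w i ≤ 1 := by
    have h1 : frobNorm h ^ 2 ≤ 1 := pow_le_one₀ (frobNorm_nonneg h) hF
    rwa [frobNorm, Real.sq_sqrt (by positivity)] at h1
  set K := 1 / Real.sqrt (1 - 2 * s) with hK
  have hpos : 0 < Real.sqrt (1 - 2 * s) := Real.sqrt_pos.2 (by linarith)
  have hK1 : 1 ≤ K := by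
    rw [hK, le_div_iff₀ hpos, one_mul]
    exact Real.sqrt_le_one.2 (by linarith)
  -- With the normalized rows `e i`, `‖h g‖²` is the weighted sum of `(g ⬝ᵥ e i)²`, and Jensen's
  -- inequality reduces to one Gaussian variable without diagonalizing `h`. A zero row has `e i =
  -- 0`, the inverse of `0` being `0`.
  let e : Fin p₁ → Fin p₂ → ℝ := fun i j => (Real.sqrt (w i))⁻¹ * h i j
  have hrow : ∀ i g, w i * (s * (g ⬝ᵥ e i) ^ 2) = s * (h *ᵥ g) i ^ 2 := by
    intro i g
    have hdot : g ⬝ᵥ e i = (Real.sqrt (w i))⁻¹ * (h *ᵥ g) i := by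
      simp only [dotProduct, e, Matrix.mulVec, Finset.mul_sum]
      exact Finset.sum_congr rfl fun j _ => by ring
    rcases (hw0 i).eq_or_lt with h0 | h0
    · have hz : ∀ j, h i j = 0 := by
        intro j
        have := (Finset.sum_eq_zero_iff_of_nonneg fun j _ => sq_nonneg (h i j)).1 h0.symm j
          (Finset.mem_univ j)
        exact pow_eq_zero_iff two_ne_zero |>.1 this
      have : (h *ᵥ g) i = 0 := by simp [Matrix.mulVec, dotProduct, hz]
      rw [← h0, this]
      simp
    · rw [hdot, mul_pow, inv_pow, Real.sq_sqrt h0.le]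
      field_simp
  have hint : ∀ i, ∫⁻ g, ENNReal.ofReal (w i * Real.exp (s * (g ⬝ᵥ e i) ^ 2))
      ∂(gaussianPi (Fin p₂)) ≤ ENNReal.ofReal (w i * K) := by
    intro i
    rcases (hw0 i).eq_or_lt with h0 | h0
    · simp [← h0]
    · have hunit : ∑ j, e i j ^ 2 = 1 := by
        simp only [e, mul_pow, inv_pow, Real.sq_sqrt h0.le, ← Finset.mul_sum]
        exact inv_mul_cancel₀ h0.ne'
      simp_rw [ENNReal.ofReal_mul (hw0 i)]
      rw [lintegral_const_mul _ (by fun_prop), lintegral_exp_sq_dotProduct hunit hs]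
  calc ∫⁻ g, ENNReal.ofReal (Real.exp (s * ∑ i, (h *ᵥ g) i ^ 2)) ∂(gaussianPi (Fin p₂))
      ≤ ∫⁻ g, (ENNReal.ofReal (1 - ∑ i, w i) +
          ∑ i, ENNReal.ofReal (w i * Real.exp (s * (g ⬝ᵥ e i) ^ 2))) ∂(gaussianPi (Fin p₂)) := by
        refine lintegral_mono fun g => ?_
        rw [← ENNReal.ofReal_sum_of_nonneg fun i _ => mul_nonneg (hw0 i) (Real.exp_pos _).le,
          ← ENNReal.ofReal_add (by linarith)
            (Finset.sum_nonneg fun i _ => mul_nonneg (hw0 i) (Real.exp_pos _).le)]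
        refine ENNReal.ofReal_le_ofReal ?_
        rw [Finset.mul_sum]
        simp_rw [← hrow]
        exact exp_sum_mul_le w _ hw0 hw1
    _ = ENNReal.ofReal (1 - ∑ i, w i) + ∑ i, ∫⁻ g,
          ENNReal.ofReal (w i * Real.exp (s * (g ⬝ᵥ e i) ^ 2)) ∂(gaussianPi (Fin p₂)) := by
        rw [lintegral_add_left (by fun_prop), lintegral_finsetSum _ (fun i _ => by fun_prop)]
        simp
    _ ≤ ENNReal.ofReal (1 - ∑ i, w i) + ∑ i, ENNReal.ofReal (w i * K) :=
        add_le_add le_rfl (Finset.sum_le_sum fun i _ => hint i)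
    _ = ENNReal.ofReal ((1 - ∑ i, w i) + ∑ i, w i * K) := by
        rw [ENNReal.ofReal_add (by linarith)
          (Finset.sum_nonneg fun i _ => mul_nonneg (hw0 i) (by linarith)),
          ENNReal.ofReal_sum_of_nonneg fun i _ => mul_nonneg (hw0 i) (by linarith)]
    _ ≤ ENNReal.ofReal K := by
        refine ENNReal.ofReal_le_ofReal ?_
        rw [← Finset.sum_mul]
        nlinarith

/-- The joint law of a pair of independent standard Gaussian vectors. -/
noncomputable abbrev gaussianPair (p₁ p₂ : ℕ) : Measure ((Fin p₁ → ℝ) × (Fin p₂ → ℝ)) :=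
  (gaussianPi (Fin p₁)).prod (gaussianPi (Fin p₂))

@[fun_prop]
theorem measurable_bilin (h : Matrix (Fin p₁) (Fin p₂) ℝ) :
    Measurable fun x : (Fin p₁ → ℝ) × (Fin p₂ → ℝ) => x.1 ⬝ᵥ (h *ᵥ x.2) := by
  have : Continuous fun x : (Fin p₁ → ℝ) × (Fin p₂ → ℝ) => x.1 ⬝ᵥ (h *ᵥ x.2) := by fun_prop
  exact this.measurable

/-- The moment generating function of a Gaussian chaos of order two. -/
theorem lintegral_exp_bilin_le {h : Matrix (Fin p₁) (Fin p₂) ℝ} (hF : frobNorm h ≤ 1) {t : ℝ}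
    (ht : t ^ 2 < 1) :
    ∫⁻ x, ENNReal.ofReal (Real.exp (t * (x.1 ⬝ᵥ (h *ᵥ x.2)))) ∂(gaussianPair p₁ p₂) ≤
      ENNReal.ofReal (1 / Real.sqrt (1 - t ^ 2)) := by
  -- For fixed right vector `g` the form is Gaussian with variance `‖h g‖²`, so the inner integral
  -- is `exp (t² ‖h g‖² / 2)`.
  rw [lintegral_prod_symm' _ (by fun_prop)]
  simp_rw [lintegral_exp_dotProduct]
  refine (lintegral_exp_norm_sq_mulVec_le hF (by positivity) (by linarith)).trans (le_of_eq ?_)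
  congr 4
  ring

end Gaussian

/-! ### Concentration of the `ℓ¹` norm of the projections of a fixed matrix -/

section Chaos

variable {p₁ p₂ : ℕ}

theorem exp_mul_abs_le (t x : ℝ) :
    Real.exp (t * |x|) ≤ Real.exp (t * x) + Real.exp (-t * x) := by
  rcases abs_cases x with ⟨h, _⟩ | ⟨h, _⟩ <;> rw [h]
  · linarith [Real.exp_pos (-t * x)]
  · rw [mul_neg, ← neg_mul]
    linarith [Real.exp_pos (t * x)]

theorem lintegral_exp_abs_bilin_le {h : Matrix (Fin p₁) (Fin p₂) ℝ} (hF : frobNorm h ≤ 1) {t : ℝ}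
    (ht : t ^ 2 < 1) :
    ∫⁻ x, ENNReal.ofReal (Real.exp (t * |x.1 ⬝ᵥ (h *ᵥ x.2)|)) ∂(gaussianPair p₁ p₂) ≤
      ENNReal.ofReal (2 / Real.sqrt (1 - t ^ 2)) := by
  calc _ ≤ ∫⁻ x, (ENNReal.ofReal (Real.exp (t * (x.1 ⬝ᵥ (h *ᵥ x.2)))) +
        ENNReal.ofReal (Real.exp (-t * (x.1 ⬝ᵥ (h *ᵥ x.2))))) ∂(gaussianPair p₁ p₂) := by
        refine lintegral_mono fun x => ?_
        rw [← ENNReal.ofReal_add (Real.exp_pos _).le (Real.exp_pos _).le]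
        exact ENNReal.ofReal_le_ofReal (exp_mul_abs_le _ _)
    _ ≤ ENNReal.ofReal (1 / Real.sqrt (1 - t ^ 2)) +
        ENNReal.ofReal (1 / Real.sqrt (1 - t ^ 2)) := by
        rw [lintegral_add_left (by fun_prop)]
        have h2 := lintegral_exp_bilin_le hF (t := -t) (by rwa [neg_sq])
        rw [neg_sq] at h2
        exact add_le_add (lintegral_exp_bilin_le hF ht) h2
    _ = _ := by
        rw [← ENNReal.ofReal_add (by positivity) (by positivity)]
        congr 1
        ring

theorem lintegral_sq_bilin (h : Matrix (Fin p₁) (Fin p₂) ℝ) :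
    ∫⁻ x, ENNReal.ofReal ((x.1 ⬝ᵥ (h *ᵥ x.2)) ^ 2) ∂(gaussianPair p₁ p₂) =
      ENNReal.ofReal (frobNorm h ^ 2) := by
  rw [lintegral_prod_symm' _ (by fun_prop)]
  simp_rw [lintegral_sq_dotProduct]
  have h1 : ∀ (g : Fin p₂ → ℝ) (i : Fin p₁), (h *ᵥ g) i = g ⬝ᵥ h i := fun g i => by
    rw [Matrix.mulVec, dotProduct_comm]
  simp_rw [ENNReal.ofReal_sum_of_nonneg fun i _ => sq_nonneg _, h1]
  rw [lintegral_finsetSum _ (fun i _ => by fun_prop)]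
  simp_rw [lintegral_sq_dotProduct]
  rw [← ENNReal.ofReal_sum_of_nonneg fun i _ => by positivity, frobNorm,
    Real.sq_sqrt (by positivity)]

/-- Because `(1 - y + y²/2) (1 + y + y²/2) = 1 + y⁴/4 ≥ 1`. -/
theorem exp_neg_le_quadratic {y : ℝ} (hy : 0 ≤ y) : Real.exp (-y) ≤ 1 - y + y ^ 2 / 2 := by
  have h1 := Real.quadratic_le_exp_of_nonneg hy
  have h2 : 0 < 1 - y + y ^ 2 / 2 := by nlinarith [sq_nonneg (y - 1)]
  rw [Real.exp_neg, inv_le_iff_one_le_mul₀ (Real.exp_pos _)]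
  calc (1 : ℝ) ≤ (1 - y + y ^ 2 / 2) * (1 + y + y ^ 2 / 2) := by nlinarith [sq_nonneg (y ^ 2)]
    _ ≤ _ := by gcongr

/-- The linear gain `|x| / 96` in the expansion of the exponential is traded for `x² / 4608`, whose
mean is known exactly for a chaos; the price `x⁴` is absorbed by `exp (|x| / 2)`. The square stands
on the left so that both sides are nonnegative and can be integrated as `ENNReal`. -/
theorem exp_neg_mul_abs_add_le (x : ℝ) :
    Real.exp (-(1 / 96) * |x|) + 1 / 4608 * x ^ 2 ≤
      1 + 1 / 18432 * x ^ 2 + 1 / 27648 * Real.exp (1 / 2 * |x|) := by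
  have h1 := exp_neg_le_quadratic (y := 1 / 96 * |x|) (by positivity)
  have h2 := Real.pow_div_factorial_le_exp (1 / 2 * |x|) (by positivity) 4
  rw [← sq_abs x]
  set y := |x| with hy
  have hy0 : 0 ≤ y := abs_nonneg x
  have h3 : y ^ 2 ≤ 48 * y + y ^ 4 / 2304 := by
    rcases le_total y 48 with h | h
    · nlinarith [pow_nonneg hy0 4]
    · have : (48 : ℝ) ^ 2 ≤ y ^ 2 := pow_le_pow_left₀ (by norm_num) h 2
      nlinarith [sq_nonneg y]
  have h4 : y ^ 4 ≤ 384 * Real.exp (1 / 2 * y) := by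
    norm_num [Nat.factorial] at h2 ⊢
    linarith
  rw [← neg_mul] at h1
  linarith

theorem two_div_sqrt_three_quarters_le : 2 / Real.sqrt (1 - (1 / 2 : ℝ) ^ 2) ≤ 12 / 5 := by
  have : (5 / 6 : ℝ) ≤ Real.sqrt (1 - (1 / 2 : ℝ) ^ 2) :=
    Real.le_sqrt_of_sq_le (by norm_num)
  rw [div_le_iff₀ (by linarith)]
  linarith

/-- A unit second moment and a bounded exponential moment prevent `|βᵀ h γ|` from concentrating at
`0`. In units of `1/18432` the balance is `1 + 1.6 - 4 < -1`. -/
theorem lintegral_exp_neg_abs_bilin_le {h : Matrix (Fin p₁) (Fin p₂) ℝ} (hF : frobNorm h = 1) :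
    ∫⁻ x, ENNReal.ofReal (Real.exp (-(1 / 96) * |x.1 ⬝ᵥ (h *ᵥ x.2)|)) ∂(gaussianPair p₁ p₂) ≤
      ENNReal.ofReal (Real.exp (-(1 / 18432))) := by
  have hsq := lintegral_sq_bilin h
  rw [hF, one_pow] at hsq
  have hexp := lintegral_exp_abs_bilin_le hF.le (t := 1 / 2) (by norm_num)
  replace hexp := hexp.trans (ENNReal.ofReal_le_ofReal two_div_sqrt_three_quarters_le)
  have hmono : ∫⁻ x, (ENNReal.ofReal (Real.exp (-(1 / 96) * |x.1 ⬝ᵥ (h *ᵥ x.2)|)) +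
        ENNReal.ofReal (1 / 4608) * ENNReal.ofReal ((x.1 ⬝ᵥ (h *ᵥ x.2)) ^ 2))
        ∂(gaussianPair p₁ p₂) ≤
      ∫⁻ x, (1 + ENNReal.ofReal (1 / 18432) * ENNReal.ofReal ((x.1 ⬝ᵥ (h *ᵥ x.2)) ^ 2) +
        ENNReal.ofReal (1 / 27648) *
          ENNReal.ofReal (Real.exp (1 / 2 * |x.1 ⬝ᵥ (h *ᵥ x.2)|))) ∂(gaussianPair p₁ p₂) := by
    refine lintegral_mono fun x => ?_
    rw [← ENNReal.ofReal_mul (by norm_num), ← ENNReal.ofReal_mul (by norm_num),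
      ← ENNReal.ofReal_mul (by norm_num), ← ENNReal.ofReal_one,
      ← ENNReal.ofReal_add (by positivity) (by positivity),
      ← ENNReal.ofReal_add (by positivity) (by positivity),
      ← ENNReal.ofReal_add (by positivity) (by positivity)]
    exact ENNReal.ofReal_le_ofReal (exp_neg_mul_abs_add_le _)
  rw [lintegral_add_left (by fun_prop), lintegral_const_mul _ (by fun_prop), hsq,
    lintegral_add_left (by fun_prop), lintegral_add_left (by fun_prop),
    lintegral_const_mul _ (by fun_prop), lintegral_const_mul _ (by fun_prop), hsq] at hmono
  have h2 : (∫⁻ x, ENNReal.ofReal (Real.exp (-(1 / 96) * |x.1 ⬝ᵥ (h *ᵥ x.2)|))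
      ∂(gaussianPair p₁ p₂)) + ENNReal.ofReal (1 / 4608) ≤
      ENNReal.ofReal (1 + 1 / 18432 + 1 / 27648 * (12 / 5)) := by
    rw [ENNReal.ofReal_add (by norm_num) (by norm_num),
      ENNReal.ofReal_add (by norm_num) (by norm_num),
      ENNReal.ofReal_mul (p := 1 / 27648) (by norm_num)]
    have h1 := hmono.trans (add_le_add le_rfl (mul_le_mul_right hexp _))
    rw [lintegral_const, measure_univ, ENNReal.ofReal_one, mul_one, mul_one, mul_one] at h1
    rw [ENNReal.ofReal_one]
    exact h1
  have h3 := ENNReal.le_sub_of_add_le_right ENNReal.ofReal_ne_top h2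
  refine h3.trans ?_
  rw [← ENNReal.ofReal_sub _ (by norm_num)]
  refine ENNReal.ofReal_le_ofReal ?_
  have := Real.add_one_le_exp (-(1 / 18432 : ℝ))
  linarith

/-- The law of `n` independent pairs of independent standard Gaussian vectors. -/
noncomputable abbrev gaussianPairs (n p₁ p₂ : ℕ) :
    Measure (Fin n → (Fin p₁ → ℝ) × (Fin p₂ → ℝ)) :=
  Measure.pi fun _ => gaussianPair p₁ p₂

theorem lintegral_exp_half_abs_bilin_sub_le {h : Matrix (Fin p₁) (Fin p₂) ℝ}
    (hF : frobNorm h = 1) :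
    ∫⁻ x, ENNReal.ofReal (Real.exp (1 / 2 * |x.1 ⬝ᵥ (h *ᵥ x.2)| - 2)) ∂(gaussianPair p₁ p₂) ≤
      ENNReal.ofReal (Real.exp (-1)) := by
  simp_rw [sub_eq_add_neg, Real.exp_add, ENNReal.ofReal_mul (Real.exp_pos _).le]
  rw [lintegral_mul_const _ (by fun_prop)]
  refine (mul_le_mul_left ((lintegral_exp_abs_bilin_le hF.le (t := 1 / 2)
    (by norm_num)).trans (ENNReal.ofReal_le_ofReal two_div_sqrt_three_quarters_le)) _).trans ?_
  rw [← ENNReal.ofReal_mul (by norm_num)]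
  refine ENNReal.ofReal_le_ofReal ?_
  rw [show (-1 : ℝ) = 1 + -2 by norm_num, Real.exp_add 1]
  gcongr
  linarith [Real.exp_one_gt_d9]

theorem lintegral_exp_neg_abs_bilin_add_le {h : Matrix (Fin p₁) (Fin p₂) ℝ}
    (hF : frobNorm h = 1) :
    ∫⁻ x, ENNReal.ofReal (Real.exp (-(1 / 96) * |x.1 ⬝ᵥ (h *ᵥ x.2)| + 1 / 36864))
      ∂(gaussianPair p₁ p₂) ≤ ENNReal.ofReal (Real.exp (-(1 / 36864))) := by
  simp_rw [Real.exp_add, ENNReal.ofReal_mul (Real.exp_pos _).le]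
  rw [lintegral_mul_const _ (by fun_prop)]
  refine (mul_le_mul_left (lintegral_exp_neg_abs_bilin_le hF) _).trans ?_
  rw [← ENNReal.ofReal_mul (Real.exp_pos _).le, ← Real.exp_add]
  refine ENNReal.ofReal_le_ofReal (Real.exp_le_exp.2 ?_)
  norm_num

theorem ropSeminorm_pairs_smul {n : ℕ} {F : ℝ} (hF : 0 < F) (g : Matrix (Fin p₁) (Fin p₂) ℝ)
    (x : Fin n → (Fin p₁ → ℝ) × (Fin p₂ → ℝ)) :
    ropSeminorm (fun i => (x i).1) (fun i => (x i).2) (F • g) =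
      F * ∑ i, |(x i).1 ⬝ᵥ (g *ᵥ (x i).2)| := by
  rw [map_smul_eq_mul, Real.norm_eq_abs, abs_of_pos hF, ropSeminorm_apply]
  rfl

/-- The `ℓ¹` norm of the rank-one projections of a fixed matrix concentrates. -/
theorem measure_ropSeminorm_le (n : ℕ) (h : Matrix (Fin p₁) (Fin p₂) ℝ) :
    gaussianPairs n p₁ p₂ {x | ¬ (1 / 384 * n * frobNorm h ≤
        ropSeminorm (fun i => (x i).1) (fun i => (x i).2) h ∧
      ropSeminorm (fun i => (x i).1) (fun i => (x i).2) h ≤ 4 * n * frobNorm h)} ≤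
      ENNReal.ofReal (2 * Real.exp (-(n / 36864))) := by
  rcases (frobNorm_nonneg h).eq_or_lt with h0 | h0
  · have hz : h = 0 := frobNorm_eq_zero h0.symm
    subst hz
    simp [← h0]
  obtain ⟨g, hgF, hgh⟩ : ∃ g, frobNorm g = 1 ∧ h = frobNorm h • g :=
    ⟨(frobNorm h)⁻¹ • h, by rw [frobNorm_smul, abs_of_pos (inv_pos.2 h0), inv_mul_cancel₀ h0.ne'],
      by rw [smul_smul, mul_inv_cancel₀ h0.ne', one_smul]⟩
  have hscale := fun x => ropSeminorm_pairs_smul (n := n) h0 g x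
  rw [← hgh] at hscale
  generalize frobNorm h = F at *
  -- The two centred sums become nonnegative exactly when the `ℓ¹` norm is at least `4 n`,
  -- respectively at most `96 n / 36864 = n / 384`.
  have hup := measure_pi_sum_nonneg_le (n := n) (gaussianPair p₁ p₂)
    (f := fun _ x => 1 / 2 * |x.1 ⬝ᵥ (g *ᵥ x.2)| - 2) (fun _ => by fun_prop) (b := fun _ => -1)
    (fun _ => lintegral_exp_half_abs_bilin_sub_le hgF)
  have hlow := measure_pi_sum_nonneg_le (n := n) (gaussianPair p₁ p₂)
    (f := fun _ x => -(1 / 96) * |x.1 ⬝ᵥ (g *ᵥ x.2)| + 1 / 36864) (fun _ => by fun_prop)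
    (b := fun _ => -(1 / 36864)) (fun _ => lintegral_exp_neg_abs_bilin_add_le hgF)
  have hcover : {x : Fin n → (Fin p₁ → ℝ) × (Fin p₂ → ℝ) | ¬ (1 / 384 * n * F ≤
        ropSeminorm (fun i => (x i).1) (fun i => (x i).2) h ∧
      ropSeminorm (fun i => (x i).1) (fun i => (x i).2) h ≤ 4 * n * F)} ⊆
      {x | 0 ≤ ∑ i, (1 / 2 * |(x i).1 ⬝ᵥ (g *ᵥ (x i).2)| - 2)} ∪
        {x | 0 ≤ ∑ i, (-(1 / 96) * |(x i).1 ⬝ᵥ (g *ᵥ (x i).2)| + 1 / 36864)} := by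
    intro x hx
    replace hx : ¬ (1 / 384 * n * F ≤ F * ∑ i, |(x i).1 ⬝ᵥ (g *ᵥ (x i).2)| ∧
        F * ∑ i, |(x i).1 ⬝ᵥ (g *ᵥ (x i).2)| ≤ 4 * n * F) := by
      rw [← hscale]
      exact hx
    rw [not_and_or, not_le, not_le] at hx
    have h1 : ∑ i, (1 / 2 * |(x i).1 ⬝ᵥ (g *ᵥ (x i).2)| - 2) =
        1 / 2 * ∑ i, |(x i).1 ⬝ᵥ (g *ᵥ (x i).2)| - n * 2 := by
      rw [Finset.sum_sub_distrib, ← Finset.mul_sum]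
      simp
    have h2 : ∑ i, (-(1 / 96) * |(x i).1 ⬝ᵥ (g *ᵥ (x i).2)| + 1 / 36864) =
        -(1 / 96) * ∑ i, |(x i).1 ⬝ᵥ (g *ᵥ (x i).2)| + n * (1 / 36864) := by
      rw [Finset.sum_add_distrib, ← Finset.mul_sum]
      simp
    rw [Set.mem_union, Set.mem_ofPred_eq, Set.mem_ofPred_eq, h1, h2]
    generalize ∑ i, |(x i).1 ⬝ᵥ (g *ᵥ (x i).2)| = Y at *
    rcases hx with hx | hx
    · right
      have : Y < 1 / 384 * n := by
        refine lt_of_mul_lt_mul_left ?_ h0.le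
        linarith
      linarith
    · left
      have : 4 * n < Y := by
        refine lt_of_mul_lt_mul_left ?_ h0.le
        linarith
      linarith
  refine (measure_mono hcover).trans
    ((measure_union_le _ _).trans ((add_le_add hup hlow).trans ?_))
  rw [← ENNReal.ofReal_add (Real.exp_pos _).le (Real.exp_pos _).le]
  refine ENNReal.ofReal_le_ofReal ?_
  have h1 : ∑ _i : Fin n, (-1 : ℝ) ≤ -(n / 36864) := by
    have : (0 : ℝ) ≤ n := Nat.cast_nonneg n
    rw [Finset.sum_const, Finset.card_univ, Fintype.card_fin, nsmul_eq_mul]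
    linarith
  have h2 : ∑ _i : Fin n, (-(1 / 36864) : ℝ) ≤ -(n / 36864) := by
    rw [Finset.sum_const, Finset.card_univ, Fintype.card_fin, nsmul_eq_mul]
    linarith
  rw [two_mul]
  exact add_le_add (Real.exp_le_exp.2 h1) (Real.exp_le_exp.2 h2)

end Chaos

/-! ### Tail bounds for the noise and its image under the dual map -/

section Noise

theorem integral_abs_gaussianReal :
    ∫ x, |x| ∂(gaussianReal 0 1) = 2 / Real.sqrt (2 * Real.pi) := by
  rw [integral_gaussianReal_eq_integral_smul one_ne_zero]
  have h1 : ∀ x : ℝ, gaussianPDFReal 0 1 x • |x| =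
      (Real.sqrt (2 * Real.pi))⁻¹ * ((fun y => y * Real.exp (-(1 / 2) * y ^ 2)) |x|) := by
    intro x
    simp only [gaussianPDFReal, sq_abs, NNReal.coe_one, mul_one, sub_zero, smul_eq_mul]
    rw [show -x ^ 2 / 2 = -(1 / 2) * x ^ 2 by ring]
    ring
  simp_rw [h1]
  rw [integral_const_mul,
    integral_comp_abs (f := fun y => y * Real.exp (-(1 / 2) * y ^ 2))]
  have h2 := integral_rpow_mul_exp_neg_mul_rpow (p := 2) (q := 1) (b := 1 / 2) (by norm_num)
    (by norm_num) (by norm_num)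
  norm_num [Real.rpow_neg_one] at h2
  have h3 : ∫ x in Set.Ioi (0 : ℝ), x * Real.exp (-(1 / 2) * x ^ 2) = 1 := by
    simp_rw [neg_mul]
    exact h2
  rw [h3]
  ring

/-- The mean `√(2/π)` of `|x|` is below `1`; this gap is what makes the constraint `‖z‖₁ / n ≤ σ`
hold with overwhelming probability. -/
theorem integral_abs_sub_one_gaussianReal_neg :
    ∫ x, (|x| - 1) ∂(gaussianReal 0 1) < 0 := by
  have hint : Integrable (fun x : ℝ => |x|) (gaussianReal 0 1) :=
    ((memLp_id_gaussianReal 1).integrable le_rfl).abs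
  rw [integral_sub hint (integrable_const _), integral_abs_gaussianReal]
  have h2 : (2 : ℝ) < Real.sqrt (2 * Real.pi) :=
    Real.lt_sqrt_of_sq_lt (by linarith [Real.pi_gt_three])
  have : 2 / Real.sqrt (2 * Real.pi) < 1 := by
    rw [div_lt_one (by linarith)]
    exact h2
  rw [integral_const, probReal_univ, one_smul]
  linarith

/-- The `ℓ¹` norm of a standard Gaussian vector is at most `n`, but for a set of exponentially
small measure. -/
theorem exists_measure_sum_abs_le :
    ∃ c : ℝ, 0 < c ∧ ∀ n : ℕ, gaussianPi (Fin n) {z | (n : ℝ) < ∑ i, |z i|} ≤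
      ENNReal.ofReal (Real.exp (-(c * n))) := by
  set X : ℝ → ℝ := fun x => |x| - 1 with hX
  have hint : ∀ t : ℝ, Integrable (fun x => Real.exp (t * X x)) (gaussianReal 0 1) := by
    intro t
    have h := integrable_exp_mul_abs (μ := gaussianReal 0 1) (X := id) (t := t)
      (integrable_exp_mul_gaussianReal t) (integrable_exp_mul_gaussianReal (-t))
    have h2 := h.mul_const (Real.exp (-t))
    refine h2.congr (ae_of_all _ fun x => ?_)
    simp only [hX, id, ← Real.exp_add]
    congr 1
    ring
  have hset : integrableExpSet X (gaussianReal 0 1) = Set.univ := by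
    ext t
    simpa [integrableExpSet] using hint t
  -- The moment generating function of `|x| - 1` is `1` at `0` with negative derivative, hence below
  -- `1` at some `t > 0`; minus its logarithm there is the rate `c`.
  have h0 : (0 : ℝ) ∈ interior (integrableExpSet X (gaussianReal 0 1)) := by simp [hset]
  have hd := hasDerivAt_mgf h0
  simp only [zero_mul, Real.exp_zero, mul_one] at hd
  have hslope := hasDerivAt_iff_tendsto_slope.1 hd
  have hev := hslope.eventually_lt_const integral_abs_sub_one_gaussianReal_neg
  have hev2 : ∀ᶠ t in nhdsWithin (0 : ℝ) (Set.Ioi 0),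
      slope (mgf X (gaussianReal 0 1)) 0 t < 0 :=
    hev.filter_mono (nhdsWithin_mono _ fun t ht => (Set.mem_Ioi.1 ht).ne')
  obtain ⟨t, ht, ht0⟩ := (hev2.and self_mem_nhdsWithin).exists
  replace ht0 : 0 < t := ht0
  rw [slope_def_field, mgf_zero, sub_zero, div_lt_iff₀ ht0, zero_mul] at ht
  have hpos : 0 < mgf X (gaussianReal 0 1) t := mgf_pos (hint t)
  refine ⟨-Real.log (mgf X (gaussianReal 0 1) t), neg_pos.2 (Real.log_neg hpos (by linarith)),
    fun n => ?_⟩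
  have h := measure_pi_sum_nonneg_le (n := n) (gaussianReal 0 1) (f := fun _ x => t * X x)
    (fun _ => by fun_prop) (b := fun _ => Real.log (mgf X (gaussianReal 0 1) t)) (fun _ => by
      rw [← ofReal_integral_eq_lintegral_ofReal (hint t) (ae_of_all _ fun _ => (Real.exp_pos _).le),
        Real.exp_log hpos]
      rfl)
  refine (measure_mono fun z hz => ?_).trans (h.trans (le_of_eq ?_))
  · replace hz : (n : ℝ) < ∑ i, |z i| := hz
    rw [Set.mem_ofPred_eq, ← Finset.mul_sum]
    refine mul_nonneg ht0.le ?_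
    simp only [hX, Finset.sum_sub_distrib]
    simp
    linarith
  · congr 2
    simp
    ring

/-- Chernoff's bound at `s = 1/4`, where the exponential moment of `x²` is `√2 ≤ exp (4/10)`. -/
theorem measure_sum_sq_le (n : ℕ) :
    gaussianPi (Fin n) {z | 2 * (n : ℝ) < ∑ i, z i ^ 2} ≤
      ENNReal.ofReal (Real.exp (-(n / 10))) := by
  have h := measure_pi_sum_nonneg_le (n := n) (gaussianReal 0 1)
    (f := fun _ x => 1 / 4 * x ^ 2 + -(1 / 2))
    (fun _ => by fun_prop) (b := fun _ => -(1 / 10)) (fun _ => by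
      simp_rw [Real.exp_add, ENNReal.ofReal_mul (Real.exp_pos _).le]
      rw [lintegral_mul_const _ (by fun_prop), lintegral_exp_sq_gaussianReal (by norm_num),
        ← ENNReal.ofReal_mul (by positivity)]
      refine ENNReal.ofReal_le_ofReal ?_
      have h1 : (7 / 10 : ℝ) ≤ Real.sqrt (1 - 2 * (1 / 4)) :=
        Real.le_sqrt_of_sq_le (by norm_num)
      have h0 : 0 < Real.sqrt (1 - 2 * (1 / 4 : ℝ)) := by linarith
      have h2 : (10 / 7 : ℝ) ≤ Real.exp (4 / 10) := by
        have := Real.quadratic_le_exp_of_nonneg (x := 4 / 10) (by norm_num)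
        linarith
      rw [show (-(1 / 10) : ℝ) = 4 / 10 + -(1 / 2) by norm_num, Real.exp_add (4 / 10)]
      gcongr
      refine le_trans ?_ h2
      rw [div_le_iff₀ h0]
      linarith)
  refine (measure_mono fun z hz => ?_).trans (h.trans (le_of_eq ?_))
  · replace hz : 2 * (n : ℝ) < ∑ i, z i ^ 2 := hz
    rw [Set.mem_ofPred_eq, Finset.sum_add_distrib, ← Finset.mul_sum]
    simp
    linarith
  · congr 2
    simp
    ring

theorem gaussianReal_abs_gt_le {s : ℝ} (hs : 0 ≤ s) :
    gaussianReal 0 1 {x | s < |x|} ≤ ENNReal.ofReal (2 * Real.exp (-(s ^ 2 / 2))) := by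
  have h := measure_nonneg_le_lintegral_exp (gaussianReal 0 1) (f := fun x => s * |x| + -s ^ 2)
    (by fun_prop)
  have h2 : ∫⁻ x, ENNReal.ofReal (Real.exp (s * |x| + -s ^ 2)) ∂(gaussianReal 0 1) ≤
      ENNReal.ofReal (2 * Real.exp (-(s ^ 2 / 2))) := by
    simp_rw [Real.exp_add, ENNReal.ofReal_mul (Real.exp_pos _).le]
    rw [lintegral_mul_const _ (by fun_prop)]
    have h3 : ∫⁻ x, ENNReal.ofReal (Real.exp (s * |x|)) ∂(gaussianReal 0 1) ≤
        ENNReal.ofReal (2 * Real.exp (s ^ 2 / 2)) := by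
      calc _ ≤ ∫⁻ x, (ENNReal.ofReal (Real.exp (s * x)) + ENNReal.ofReal (Real.exp (-s * x)))
            ∂(gaussianReal 0 1) := by
            refine lintegral_mono fun x => ?_
            rw [← ENNReal.ofReal_add (Real.exp_pos _).le (Real.exp_pos _).le]
            exact ENNReal.ofReal_le_ofReal (exp_mul_abs_le _ _)
        _ = _ := by
            rw [lintegral_add_left (by fun_prop), lintegral_exp_mul_gaussianReal,
              lintegral_exp_mul_gaussianReal,
              ← ENNReal.ofReal_add (Real.exp_pos _).le (Real.exp_pos _).le]
            congr 1
            simp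
            ring
    refine (mul_le_mul_left h3 _).trans ?_
    rw [← ENNReal.ofReal_mul (by positivity), mul_assoc, ← Real.exp_add]
    refine ENNReal.ofReal_le_ofReal (le_of_eq ?_)
    congr 2
    ring
  refine (measure_mono fun x hx => ?_).trans (h.trans h2)
  replace hx : s < |x| := hx
  rw [Set.mem_ofPred_eq]
  nlinarith

/-- Each coordinate exceeds the level with probability at most `2 exp (-2 log n) = 2 / n²`. -/
theorem measure_exists_abs_gt_le {n : ℕ} (hn : 0 < n) :
    gaussianPi (Fin n) {z | ∃ i, 2 * Real.sqrt (Real.log n) < |z i|} ≤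
      ENNReal.ofReal (2 / n) := by
  have hn' : (0 : ℝ) < n := by exact_mod_cast hn
  have hset : {z : Fin n → ℝ | ∃ i, 2 * Real.sqrt (Real.log n) < |z i|} =
      ⋃ i, (fun z => z i) ⁻¹' {x | 2 * Real.sqrt (Real.log n) < |x|} := by
    ext z
    simp
  rw [hset]
  have hmeas : MeasurableSet {x : ℝ | 2 * Real.sqrt (Real.log n) < |x|} :=
    measurableSet_lt measurable_const (by fun_prop)
  refine (measure_iUnion_le _).trans ?_
  rw [tsum_fintype]
  have h1 : ∀ i : Fin n, gaussianPi (Fin n)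
      ((fun z => z i) ⁻¹' {x | 2 * Real.sqrt (Real.log n) < |x|}) ≤
      ENNReal.ofReal (2 / n ^ 2) := by
    intro i
    have h2 := (measurePreserving_eval (fun _ : Fin n => gaussianReal 0 1) i).measure_preimage
      hmeas.nullMeasurableSet
    refine (le_of_eq h2).trans ((gaussianReal_abs_gt_le (by positivity)).trans
      (ENNReal.ofReal_le_ofReal (le_of_eq ?_)))
    rw [mul_pow, Real.sq_sqrt (Real.log_natCast_nonneg n),
      show -(2 ^ 2 * Real.log n / 2) = -(Real.log n + Real.log n) by ring, Real.exp_neg,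
      Real.exp_add, Real.exp_log hn', div_eq_mul_inv, sq]
  refine (Finset.sum_le_sum fun i _ => h1 i).trans ?_
  rw [← ENNReal.ofReal_sum_of_nonneg fun i _ => by positivity]
  refine ENNReal.ofReal_le_ofReal (le_of_eq ?_)
  simp
  field_simp

variable {p₁ p₂ : ℕ}

/-- From `1 / (1 - x) ≤ exp (x / (1 - x))` and `1 / (1 - x) ≤ 100/51`, halved by the square root. -/
theorem one_div_sqrt_one_sub_le {x : ℝ} (hx0 : 0 ≤ x) (hx : x ≤ 49 / 100) :
    1 / Real.sqrt (1 - x) ≤ Real.exp (50 / 51 * x) := by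
  have h1 : 0 < 1 - x := by linarith
  have h2 : 1 / (1 - x) ≤ Real.exp (50 / 51 * x) ^ 2 := by
    rw [← Real.exp_nat_mul]
    have h3 : 1 / (1 - x) = x / (1 - x) + 1 := by field_simp; ring
    rw [h3]
    refine (Real.add_one_le_exp _).trans (Real.exp_le_exp.2 ?_)
    rw [div_le_iff₀ h1]
    push_cast
    nlinarith
  rw [← Real.sqrt_one, ← Real.sqrt_div zero_le_one, Real.sqrt_one]
  exact Real.sqrt_le_iff.2 ⟨(Real.exp_pos _).le, h2⟩

/-- A one-sided tail bound for weighted sums of independent Gaussian chaoses. -/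
theorem measure_le_sum_mul_bilin_le {n : ℕ} (hn : 0 < n) {h : Matrix (Fin p₁) (Fin p₂) ℝ}
    (hF : frobNorm h ≤ 1) {z : Fin n → ℝ} {l : ℝ} (hl : ∀ i, (l * z i) ^ 2 ≤ 49 / 100) (t : ℝ) :
    gaussianPairs n p₁ p₂ {x | l * t ≤ l * ∑ i, z i * ((x i).1 ⬝ᵥ (h *ᵥ (x i).2))} ≤
      ENNReal.ofReal (Real.exp (50 / 51 * (l ^ 2 * ∑ i, z i ^ 2) - l * t)) := by
  have hn' : (n : ℝ) ≠ 0 := by exact_mod_cast hn.ne'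
  -- The threshold `l t` is spread evenly over the `n` summands.
  have hmain := measure_pi_sum_nonneg_le (n := n) (gaussianPair p₁ p₂)
    (f := fun i x => l * z i * (x.1 ⬝ᵥ (h *ᵥ x.2)) + -(l * t / n)) (fun _ => by fun_prop)
    (b := fun i => 50 / 51 * (l * z i) ^ 2 + -(l * t / n)) (fun i => by
      simp_rw [Real.exp_add, ENNReal.ofReal_mul (Real.exp_pos _).le]
      rw [lintegral_mul_const _ (by fun_prop)]
      refine mul_le_mul_left ((lintegral_exp_bilin_le hF (by linarith [hl i])).trans
        (ENNReal.ofReal_le_ofReal (one_div_sqrt_one_sub_le (sq_nonneg _) (hl i)))) _)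
  refine (measure_mono fun x hx => ?_).trans (hmain.trans (le_of_eq ?_))
  · replace hx : l * t ≤ l * ∑ i, z i * ((x i).1 ⬝ᵥ (h *ᵥ (x i).2)) := hx
    rw [Set.mem_ofPred_eq, Finset.sum_add_distrib]
    simp_rw [mul_assoc, ← Finset.mul_sum]
    rw [Finset.sum_const, Finset.card_univ, Fintype.card_fin, nsmul_eq_mul, mul_neg,
      mul_div_cancel₀ _ hn']
    linarith
  · congr 2
    rw [Finset.sum_add_distrib]
    simp_rw [mul_pow, ← Finset.mul_sum]
    rw [Finset.sum_const, Finset.card_univ, Fintype.card_fin, nsmul_eq_mul, mul_neg,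
      mul_div_cancel₀ _ hn']
    ring

theorem measure_abs_sum_mul_bilin_gt_le {n : ℕ} (hn : 0 < n) {h : Matrix (Fin p₁) (Fin p₂) ℝ}
    (hF : frobNorm h ≤ 1) {z : Fin n → ℝ} {l : ℝ} (hl0 : 0 < l)
    (hl : ∀ i, (l * z i) ^ 2 ≤ 49 / 100) (t : ℝ) :
    gaussianPairs n p₁ p₂ {x | t < |∑ i, z i * ((x i).1 ⬝ᵥ (h *ᵥ (x i).2))|} ≤
      ENNReal.ofReal (2 * Real.exp (50 / 51 * (l ^ 2 * ∑ i, z i ^ 2) - l * t)) := by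
  have h1 := measure_le_sum_mul_bilin_le hn hF hl t
  have h2 := measure_le_sum_mul_bilin_le hn hF (l := -l) (fun i => by
    have := hl i
    rwa [neg_mul, neg_sq]) (-t)
  rw [neg_mul_neg, neg_sq] at h2
  rw [two_mul, ENNReal.ofReal_add (Real.exp_pos _).le (Real.exp_pos _).le]
  refine le_trans (measure_mono fun x hx => ?_)
    ((measure_union_le _ _).trans (add_le_add h1 h2))
  replace hx : t < |∑ i, z i * ((x i).1 ⬝ᵥ (h *ᵥ (x i).2))| := hx
  rw [Set.mem_union, Set.mem_ofPred_eq, Set.mem_ofPred_eq]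
  rcases lt_abs.1 hx with hx | hx
  · left
    nlinarith
  · right
    nlinarith

/-- The choice of the parameter in the exponential moment bound. -/
theorem exists_chernoff_parameter {n : ℕ} (hn : 2 ≤ n) {p : ℝ} (hp : 0 < p) :
    ∃ l : ℝ, 0 < l ∧ l * (2 * Real.sqrt (Real.log n)) ≤ 7 / 10 ∧
      50 / 51 * (l ^ 2 * (2 * n)) - l * (9 / 16 *
        (12 * Real.sqrt (Real.log n) * p + 6 * Real.sqrt (2 * n * p))) ≤ -(2.36 * p) := by
  have hn' : (0 : ℝ) < n := by exact_mod_cast (by omega : 0 < n)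
  have hlog : 0 < Real.log n := Real.log_pos (by exact_mod_cast (by omega : 1 < n))
  set L := Real.sqrt (Real.log n) with hL
  have hL0 : 0 < L := Real.sqrt_pos.2 hlog
  set s := Real.sqrt (p / n) with hs
  have hs0 : 0 < s := Real.sqrt_pos.2 (by positivity)
  have hs2 : n * s ^ 2 = p := by
    rw [hs, Real.sq_sqrt (by positivity)]
    field_simp
  have hroot : 1.414 * (n * s) ≤ Real.sqrt (2 * n * p) := by
    refine Real.le_sqrt_of_sq_le ?_
    rw [mul_pow, mul_pow, ← hs2]
    nlinarith [sq_nonneg (n * s)]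
  set R := Real.sqrt (2 * n * p)
  -- Here `6.75 = 9/16 · 12`, and `2.81` lies below `9/16 · 6 · 1.414 - 100/51`, the second term
  -- being the quadratic part of the exponent.
  have key : ∀ l : ℝ, 0 ≤ l → l ≤ s →
      50 / 51 * (l ^ 2 * (2 * n)) - l * (9 / 16 * (12 * L * p + 6 * R)) ≤
        -(l * (6.75 * L * p)) - 2.81 * (l * (n * s)) := by
    intro l hl hls
    have h1 : l ^ 2 * (2 * n) ≤ 2 * (l * (n * s)) := by
      have : l * l ≤ l * s := mul_le_mul_of_nonneg_left hls hl
      nlinarith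
    have h2 := mul_le_mul_of_nonneg_left hroot hl
    have h3 : 0 ≤ l * (n * s) := by positivity
    linarith
  -- The choice is `l = min (0.35 / L) s`: the first value is the largest allowed by `max |z i| ≤ 2
  -- L`, the second balances `l² n` against `p`. The exponents `2.3625 p` and `2.81 p` both beat the
  -- entropy `p log 9` of the nets.
  rcases le_total (0.35 / L) s with hcase | hcase
  · refine ⟨0.35 / L, by positivity, ?_, (key _ (by positivity) hcase).trans ?_⟩
    · rw [div_mul_eq_mul_div, div_le_iff₀ hL0]
      linarith
    · have h1 : 0.35 / L * (6.75 * L * p) = 2.3625 * p := by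
        field_simp
        norm_num
      have h2 : 0 ≤ 0.35 / L * (n * s) := by positivity
      rw [h1]
      linarith
  · refine ⟨s, hs0, ?_, (key s hs0.le le_rfl).trans ?_⟩
    · rw [le_div_iff₀ hL0] at hcase
      linarith
    · have h1 : s * (n * s) = p := by rw [← hs2]; ring
      have h2 : 0 ≤ s * (6.75 * L * p) := by positivity
      rw [h1]
      linarith

/-- By Fubini the noise is frozen. Its bounds are part of the event, so for every frozen `z` either
the section is empty or the tail bound for fixed weights applies. -/
theorem measure_noise_bilin_gt_le {n : ℕ} (hn : 2 ≤ n) {h : Matrix (Fin p₁) (Fin p₂) ℝ}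
    (hF : frobNorm h ≤ 1) {p : ℝ} (hp : 0 < p) :
    ((gaussianPairs n p₁ p₂).prod (gaussianPi (Fin n)))
      {y | ((∀ i, |y.2 i| ≤ 2 * Real.sqrt (Real.log n)) ∧ ∑ i, y.2 i ^ 2 ≤ 2 * (n : ℝ)) ∧
        9 / 16 * (12 * Real.sqrt (Real.log n) * p + 6 * Real.sqrt (2 * n * p)) <
          |∑ i, y.2 i * ((y.1 i).1 ⬝ᵥ (h *ᵥ (y.1 i).2))|} ≤
      ENNReal.ofReal (2 * Real.exp (-(2.36 * p))) := by
  obtain ⟨l, hl0, hl1, hl2⟩ := exists_chernoff_parameter hn hp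
  set t := 9 / 16 * (12 * Real.sqrt (Real.log n) * p + 6 * Real.sqrt (2 * n * p))
  have hmeas : MeasurableSet {y : (Fin n → (Fin p₁ → ℝ) × (Fin p₂ → ℝ)) × (Fin n → ℝ) |
      ((∀ i, |y.2 i| ≤ 2 * Real.sqrt (Real.log n)) ∧ ∑ i, y.2 i ^ 2 ≤ 2 * (n : ℝ)) ∧
        t < |∑ i, y.2 i * ((y.1 i).1 ⬝ᵥ (h *ᵥ (y.1 i).2))|} := by
    refine MeasurableSet.inter (MeasurableSet.inter ?_ ?_) ?_
    · exact measurableSet_setOfPred.2 (Measurable.forall fun i => measurableSet_setOfPred.1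
        (measurableSet_le (by fun_prop) measurable_const))
    · have hc : Continuous fun y : (Fin n → (Fin p₁ → ℝ) × (Fin p₂ → ℝ)) × (Fin n → ℝ) =>
          ∑ i, y.2 i ^ 2 := by fun_prop
      exact measurableSet_le hc.measurable measurable_const
    · have hc : Continuous fun y : (Fin n → (Fin p₁ → ℝ) × (Fin p₂ → ℝ)) × (Fin n → ℝ) =>
          |∑ i, y.2 i * ((y.1 i).1 ⬝ᵥ (h *ᵥ (y.1 i).2))| := by fun_prop
      exact measurableSet_lt measurable_const hc.measurable
  rw [Measure.prod_apply_symm hmeas]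
  refine (lintegral_mono (g := fun _ => ENNReal.ofReal (2 * Real.exp (-(2.36 * p))))
    fun z => ?_).trans (by simp)
  by_cases hz : (∀ i, |z i| ≤ 2 * Real.sqrt (Real.log n)) ∧ ∑ i, z i ^ 2 ≤ 2 * (n : ℝ)
  · refine (measure_mono fun x hx => ?_).trans
      ((measure_abs_sum_mul_bilin_gt_le (by omega) hF (z := z) hl0 (fun i => ?_) t).trans ?_)
    · exact hx.2
    · have h1 : l * |z i| ≤ 7 / 10 := (mul_le_mul_of_nonneg_left (hz.1 i) hl0.le).trans hl1
      have h2 := pow_le_pow_left₀ (by positivity) h1 2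
      rw [mul_pow, sq_abs] at h2
      rw [mul_pow]
      linarith
    · refine ENNReal.ofReal_le_ofReal ?_
      have h1 : l ^ 2 * ∑ i, z i ^ 2 ≤ l ^ 2 * (2 * n) :=
        mul_le_mul_of_nonneg_left hz.2 (sq_nonneg l)
      gcongr
      linarith
  · refine (measure_mono_null (fun x hx => ?_) (measure_empty (μ := gaussianPairs n p₁ p₂))).le.trans
      zero_le
    exact hz hx.1

end Noise

/-! ### The good event and its consequences -/

section GoodEvent

variable {n p₁ p₂ m : ℕ}

/-- The product of a left and a right vector as a rank-one matrix, paired with `D`. -/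
noncomputable def rankOnePairing (D : Matrix (Fin p₁) (Fin p₂) ℝ) :
    EuclideanSpace ℝ (Fin p₁) →ₗ[ℝ] EuclideanSpace ℝ (Fin p₂) →ₗ[ℝ] ℝ :=
  LinearMap.mk₂ ℝ (fun u v => inner ℝ u (Matrix.toEuclideanLin D v))
    (fun _ _ _ => inner_add_left _ _ _) (fun _ _ _ => real_inner_smul_left _ _ _)
    (fun _ _ _ => by rw [map_add, inner_add_right])
    (fun _ _ _ => by rw [map_smul, real_inner_smul_right]; rfl)

/-- Passing from `1/4`-nets to both balls costs `(1 - 1/4)⁻² = 16/9`, which explains the factor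
`9/16`. -/
theorem specNorm_le_of_net {D : Matrix (Fin p₁) (Fin p₂) ℝ} {c : ℝ} (hc : 0 ≤ c)
    {N : Finset (EuclideanSpace ℝ (Fin p₁))} {N' : Finset (EuclideanSpace ℝ (Fin p₂))}
    (hN : ∀ x, ‖x‖ ≤ 1 → ∃ y ∈ N, ‖x - y‖ ≤ 1 / 4)
    (hN' : ∀ x, ‖x‖ ≤ 1 → ∃ y ∈ N', ‖x - y‖ ≤ 1 / 4)
    (h : ∀ u ∈ N, ∀ v ∈ N', |matInner (Matrix.vecMulVec u v) D| ≤ 9 / 16 * c) :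
    specNorm D ≤ c := by
  have key := (normSeminorm ℝ ℝ).bilin_le_of_net (rankOnePairing D) (c := 9 / 16 * c)
    (by norm_num : (1 / 4 : ℝ) < 1) hN hN' (fun u hu v hv => by
      have := h u hu v hv
      rw [← inner_toEuclideanLin] at this
      exact this)
  refine specNorm_le hc fun x => ?_
  set w := Matrix.toEuclideanLin D x with hw
  have h1 : |inner ℝ w w| ≤ 9 / 16 * c / (1 - 1 / 4) ^ 2 * (‖w‖ * ‖x‖) := key w x
  have h2 : 9 / 16 * c / (1 - 1 / 4) ^ 2 = c := by norm_num
  rw [real_inner_self_eq_norm_sq, abs_of_nonneg (sq_nonneg _), h2] at h1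
  rcases (norm_nonneg w).eq_or_lt with h0 | h0
  · rw [← h0]; positivity
  · refine le_of_mul_le_mul_left ?_ h0
    linarith

/-- The constraints on the design and the noise under which the estimator is analysed. -/
def goodSet (σ : ℝ) (N₁ : Finset (EuclideanSpace ℝ (Fin p₁)))
    (N₂ : Finset (EuclideanSpace ℝ (Fin p₂)))
    (N : Finset (EuclideanSpace ℝ (Fin m) →L[ℝ] EuclideanSpace ℝ (Fin p₁)))
    (N' : Finset (EuclideanSpace ℝ (Fin m × Fin p₂))) :
    Set ((Fin n → Fin p₁ → ℝ) × (Fin n → Fin p₂ → ℝ) × (Fin n → ℝ)) :=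
  {x | ∑ i, |x.2.2 i| ≤ σ * n ∧
    (∀ u ∈ N₁, ∀ v ∈ N₂, |∑ i, x.2.2 i * ropMap x.1 x.2.1 (Matrix.vecMulVec u v) i| ≤
      9 / 16 * dantzigThreshold n p₁ p₂ σ) ∧
    ∀ U ∈ N, ∀ W ∈ N',
      1 / 384 * n * frobNorm (factorProd m p₁ p₂ U W) ≤
        ∑ i, |ropMap x.1 x.2.1 (factorProd m p₁ p₂ U W) i| ∧
      ∑ i, |ropMap x.1 x.2.1 (factorProd m p₁ p₂ U W) i| ≤
        4 * n * frobNorm (factorProd m p₁ p₂ U W)}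

/-- Needed for measurability only: finitely many test matrices give finitely many closed conditions.
-/
theorem isClosed_goodSet (σ : ℝ) (N₁ : Finset (EuclideanSpace ℝ (Fin p₁)))
    (N₂ : Finset (EuclideanSpace ℝ (Fin p₂)))
    (N : Finset (EuclideanSpace ℝ (Fin m) →L[ℝ] EuclideanSpace ℝ (Fin p₁)))
    (N' : Finset (EuclideanSpace ℝ (Fin m × Fin p₂))) :
    IsClosed (goodSet (n := n) σ N₁ N₂ N N') := by
  have hrop : ∀ (X : Matrix (Fin p₁) (Fin p₂) ℝ) (i : Fin n), Continuous
      fun x : (Fin n → Fin p₁ → ℝ) × (Fin n → Fin p₂ → ℝ) × (Fin n → ℝ) =>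
        ropMap x.1 x.2.1 X i := by
    intro X i
    unfold ropMap
    fun_prop
  simp only [goodSet, Set.ofPred_and, Set.ofPred_forall]
  refine IsClosed.inter (isClosed_le (by fun_prop) continuous_const) (IsClosed.inter ?_ ?_)
  · refine isClosed_iInter fun u => isClosed_iInter fun _ => isClosed_iInter fun v =>
      isClosed_iInter fun _ => isClosed_le ?_ continuous_const
    have := hrop (Matrix.vecMulVec u v)
    fun_prop
  · refine isClosed_iInter fun U => isClosed_iInter fun _ => isClosed_iInter fun W =>
      isClosed_iInter fun _ => ?_
    have := hrop (factorProd m p₁ p₂ U W)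
    exact IsClosed.inter (isClosed_le continuous_const (by fun_prop))
      (isClosed_le (by fun_prop) continuous_const)

theorem mem_residualSet_of_mem_goodSet {σ : ℝ} (hσ : 0 ≤ σ) (hn : 0 < n)
    {N₁ : Finset (EuclideanSpace ℝ (Fin p₁))} {N₂ : Finset (EuclideanSpace ℝ (Fin p₂))}
    {N : Finset (EuclideanSpace ℝ (Fin m) →L[ℝ] EuclideanSpace ℝ (Fin p₁))}
    {N' : Finset (EuclideanSpace ℝ (Fin m × Fin p₂))}
    (hN₁ : ∀ x, ‖x‖ ≤ 1 → ∃ y ∈ N₁, ‖x - y‖ ≤ 1 / 4)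
    (hN₂ : ∀ x, ‖x‖ ≤ 1 → ∃ y ∈ N₂, ‖x - y‖ ≤ 1 / 4)
    {x : (Fin n → Fin p₁ → ℝ) × (Fin n → Fin p₂ → ℝ) × (Fin n → ℝ)}
    (hx : x ∈ goodSet σ N₁ N₂ N N') : x.2.2 ∈ residualSet x.1 x.2.1 σ := by
  have hn' : (0 : ℝ) < n := by exact_mod_cast hn
  refine ⟨(div_le_iff₀ hn').2 hx.1, ?_⟩
  refine specNorm_le_of_net (by rw [dantzigThreshold]; positivity) hN₁ hN₂ fun u hu v hv => ?_
  rw [matInner_ropDual]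
  exact hx.2.1 u hu v hv

/-- On the good event, the `ℓ¹` norm of the projections dominates the Frobenius norm on the cone
of matrices of small nuclear norm. -/
theorem le_ropSeminorm_of_mem_goodSet {σ : ℝ} {r : ℕ} (hr : 0 < r) (hm : m = 240000 ^ 2 * r)
    {N₁ : Finset (EuclideanSpace ℝ (Fin p₁))} {N₂ : Finset (EuclideanSpace ℝ (Fin p₂))}
    {N : Finset (EuclideanSpace ℝ (Fin m) →L[ℝ] EuclideanSpace ℝ (Fin p₁))}
    {N' : Finset (EuclideanSpace ℝ (Fin m × Fin p₂))}
    (hN1 : ∀ x ∈ N, ‖x‖ ≤ 1) (hN1' : ∀ x ∈ N', ‖x‖ ≤ 1)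
    (hN : ∀ x, ‖x‖ ≤ 1 → ∃ y ∈ N, ‖x - y‖ ≤ 1 / 60000)
    (hN' : ∀ x, ‖x‖ ≤ 1 → ∃ y ∈ N', ‖x - y‖ ≤ 1 / 60000)
    {x : (Fin n → Fin p₁ → ℝ) × (Fin n → Fin p₂ → ℝ) × (Fin n → ℝ)}
    (hx : x ∈ goodSet σ N₁ N₂ N N') (X : Matrix (Fin p₁) (Fin p₂) ℝ)
    (hX : nuclearNorm X ≤ 8 * Real.sqrt r * frobNorm X) :
    1 / 768 * n * frobNorm X ≤ ropSeminorm x.1 x.2.1 X := by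
  set q := ropSeminorm x.1 x.2.1
  have hn : (0 : ℝ) ≤ n := Nat.cast_nonneg n
  have hr' : (0 : ℝ) < r := by exact_mod_cast hr
  have hF := frobNorm_nonneg X
  have hup : ∀ U W, q (factorProd m p₁ p₂ U W) ≤ 16 * n * (‖U‖ * ‖W‖) := by
    intro U W
    refine (q.bilin_le_of_net (factorProd m p₁ p₂) (c := 4 * n)
      (by norm_num : (1 / 60000 : ℝ) < 1) hN hN' (fun U hU W hW => ?_) U W).trans ?_
    · refine ((hx.2.2 U hU W hW).2).trans ?_
      have h1 := frobNorm_factorProd_le U W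
      have h2 : ‖U‖ * ‖W‖ ≤ 1 := mul_le_one₀ (hN1 U hU) (norm_nonneg _) (hN1' W hW)
      exact mul_le_of_le_one_right (by positivity) (h1.trans h2)
    · refine mul_le_mul_of_nonneg_right ?_ (by positivity)
      rw [div_le_iff₀ (by norm_num)]
      norm_num
      linarith
  have hlow := fun U W (hU : ‖U‖ ≤ 1) => le_seminorm_factorProd_of_net q
    (c := 1 / 384 * n) (M := 16 * n) (by positivity) (by positivity) hN1 hN hN'
    (fun U hU W hW => (hx.2.2 U hU W hW).1) hup hU W
  -- The net error and the tail blocks each lose at most `(1/384 + 16) n ‖X‖_F / 30000`. Together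
  -- this is less than half of `n ‖X‖_F / 384`, whence `1/768`; the numbers `60000` and `240000` are
  -- chosen for this.
  have hmain := le_seminorm_of_factorProd q
    (κ := 2 * (1 / 60000) * (1 / 384 * n + 16 * n)) (c := 1 / 384 * n) (M := 16 * n)
    (by rw [hm]; positivity) (by positivity) (by positivity) (by positivity) hup hlow X
  have hsm : Real.sqrt m = 240000 * Real.sqrt r := by
    rw [hm, Nat.cast_mul, Nat.cast_pow, Nat.cast_ofNat, Real.sqrt_mul (by positivity),
      Real.sqrt_sq (by norm_num)]
  have hsr : 0 < Real.sqrt r := Real.sqrt_pos.2 hr'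
  have hnuc : nuclearNorm X / Real.sqrt m ≤ 1 / 30000 * frobNorm X := by
    rw [hsm, div_le_iff₀ (by positivity)]
    linarith
  have h3 : (1 / 384 * n + 16 * n) * (nuclearNorm X / Real.sqrt m) ≤
      (1 / 384 * n + 16 * n) * (1 / 30000 * frobNorm X) :=
    mul_le_mul_of_nonneg_left hnuc (by positivity)
  have h4 : 0 ≤ n * frobNorm X := by positivity
  linarith

end GoodEvent

/-! ### The joint law of design and noise -/

section Transfer

variable {n p₁ p₂ : ℕ}

theorem gaussianReal_const_mul_apply (σ : ℝ) {s : Set ℝ} (hs : MeasurableSet s) :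
    gaussianReal 0 1 ((fun x => σ * x) ⁻¹' s) = gaussianReal 0 (σ ^ 2).toNNReal s := by
  have h := gaussianReal_map_const_mul (μ := 0) (v := 1) σ
  rw [mul_zero, mul_one] at h
  have h2 : (σ ^ 2).toNNReal = NNReal.mk (σ ^ 2) (sq_nonneg σ) := Real.toNNReal_of_nonneg (sq_nonneg σ)
  rw [h2, ← h, Measure.map_apply (by fun_prop) hs]

/-- The joint law of the design and the noise. -/
theorem IsGaussianROPModel.map_eq {Ω : Type*} [MeasurableSpace Ω] {μ : Measure Ω}
    [IsProbabilityMeasure μ] {σ : ℝ} {β : Fin n → Fin p₁ → Ω → ℝ} {γ : Fin n → Fin p₂ → Ω → ℝ}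
    {z : Fin n → Ω → ℝ} (h : IsGaussianROPModel μ σ β γ z) :
    AEMeasurable (fun ω => ((fun i j => β i j ω, fun i j => γ i j ω, fun i => z i ω) :
      (Fin n → Fin p₁ → ℝ) × (Fin n → Fin p₂ → ℝ) × (Fin n → ℝ))) μ ∧
    μ.map (fun ω => ((fun i j => β i j ω, fun i j => γ i j ω, fun i => z i ω) :
      (Fin n → Fin p₁ → ℝ) × (Fin n → Fin p₂ → ℝ) × (Fin n → ℝ))) =
    ((gaussianPairs n p₁ p₂).prod (gaussianPi (Fin n))).map
      (fun y => (fun i => (y.1 i).1, fun i => (y.1 i).2, fun i => σ * y.2 i)) := by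
  set X : (Fin n × Fin p₁) ⊕ (Fin n × Fin p₂) ⊕ Fin n → Ω → ℝ :=
    Sum.elim (fun k : Fin n × Fin p₁ => β k.1 k.2)
      (Sum.elim (fun k : Fin n × Fin p₂ => γ k.1 k.2) z) with hX
  have hXm : ∀ k, AEMeasurable (X k) μ := by
    rintro (k | k | k)
    exacts [(h.law_left _ _).aemeasurable, (h.law_right _ _).aemeasurable,
      (h.law_noise _).aemeasurable]
  let law : (Fin n × Fin p₁) ⊕ (Fin n × Fin p₂) ⊕ Fin n → Measure ℝ :=
    Sum.elim (fun _ => gaussianReal 0 1)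
      (Sum.elim (fun _ => gaussianReal 0 1) fun _ => gaussianReal 0 (σ ^ 2).toNNReal)
  have hlaw : ∀ k, μ.map (X k) = law k := by
    rintro (k | k | k)
    exacts [(h.law_left _ _).map_eq, (h.law_right _ _).map_eq, (h.law_noise _).map_eq]
  have hprob : ∀ k, IsProbabilityMeasure (law k) := fun k => by
    rw [← hlaw]; exact Measure.isProbabilityMeasure_map (hXm k)
  have hjoint : μ.map (fun ω k => X k ω) = Measure.pi law := by
    rw [(iIndepFun_iff_map_fun_eq_pi_map hXm).1 h.indep]
    simp_rw [hlaw]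
  -- The noise is written as `σ` times a standard Gaussian vector, so that the probability estimates
  -- involve no `σ`; this covers `σ = 0` as well.
  let G : (Fin n → (Fin p₁ → ℝ) × (Fin p₂ → ℝ)) × (Fin n → ℝ) →
      ((Fin n × Fin p₁) ⊕ (Fin n × Fin p₂) ⊕ Fin n → ℝ) := fun y =>
    Sum.elim (fun k => (y.1 k.1).1 k.2) (Sum.elim (fun k => (y.1 k.1).2 k.2) fun i => σ * y.2 i)
  have hG : Measurable G := by
    refine measurable_pi_iff.2 ?_
    rintro (k | k | k)
    · change Measurable fun y : (Fin n → (Fin p₁ → ℝ) × (Fin p₂ → ℝ)) × (Fin n → ℝ) => (y.1 k.1).1 k.2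
      fun_prop
    · change Measurable fun y : (Fin n → (Fin p₁ → ℝ) × (Fin p₂ → ℝ)) × (Fin n → ℝ) => (y.1 k.1).2 k.2
      fun_prop
    · change Measurable fun y : (Fin n → (Fin p₁ → ℝ) × (Fin p₂ → ℝ)) × (Fin n → ℝ) => σ * y.2 k
      fun_prop
  have hGlaw : ((gaussianPairs n p₁ p₂).prod (gaussianPi (Fin n))).map G = Measure.pi law := by
    symm
    -- Equality with the product law is checked on boxes, whose preimage under `G` is again a box.
    refine Measure.pi_eq fun s hs => ?_
    rw [Measure.map_apply hG (MeasurableSet.univ_pi hs)]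
    have hpre : G ⁻¹' Set.univ.pi s =
        (Set.univ.pi fun i => (Set.univ.pi fun j => s (Sum.inl (i, j))) ×ˢ
          (Set.univ.pi fun j => s (Sum.inr (Sum.inl (i, j))))) ×ˢ
        (Set.univ.pi fun i => (fun x => σ * x) ⁻¹' s (Sum.inr (Sum.inr i))) := by
      ext y
      simp only [Set.mem_preimage, Set.mem_univ_pi, Set.mem_prod, Sum.forall, Prod.forall, G,
        Sum.elim_inl, Sum.elim_inr, forall_and]
      tauto
    rw [hpre, Measure.prod_prod, Measure.pi_pi, Measure.pi_pi]
    simp_rw [Measure.prod_prod, Measure.pi_pi]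
    rw [Finset.prod_mul_distrib, Fintype.prod_sum_type, Fintype.prod_sum_type,
      Fintype.prod_prod_type, Fintype.prod_prod_type, mul_assoc]
    congr 2
    exact Finset.prod_congr rfl fun i _ => gaussianReal_const_mul_apply σ (hs _)
  let H : ((Fin n × Fin p₁) ⊕ (Fin n × Fin p₂) ⊕ Fin n → ℝ) →
      (Fin n → Fin p₁ → ℝ) × (Fin n → Fin p₂ → ℝ) × (Fin n → ℝ) := fun x =>
    (fun i j => x (Sum.inl (i, j)), fun i j => x (Sum.inr (Sum.inl (i, j))),
      fun i => x (Sum.inr (Sum.inr i)))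
  have hH : Measurable H := by fun_prop
  have hJ : AEMeasurable (fun ω k => X k ω) μ := aemeasurable_pi_iff.2 hXm
  refine ⟨hH.comp_aemeasurable hJ, ?_⟩
  have h1 := AEMeasurable.map_map_of_aemeasurable hH.aemeasurable hJ
  rw [hjoint, ← hGlaw, Measure.map_map hH hG] at h1
  exact h1.symm

end Transfer

/-! ### Union bounds over the nets -/

section UnionBound

variable {n p₁ p₂ : ℕ}

theorem measure_biUnion_biUnion_le {S A B : Type*} [MeasurableSpace S] (ν : Measure S)
    (N : Finset A) (N' : Finset B) (T : A → B → Set S) {K K' b : ℝ} (hb : 0 ≤ b)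
    (hN : (N.card : ℝ) ≤ K) (hN' : (N'.card : ℝ) ≤ K')
    (hT : ∀ x ∈ N, ∀ y ∈ N', ν (T x y) ≤ ENNReal.ofReal b) :
    ν (⋃ x ∈ N, ⋃ y ∈ N', T x y) ≤ ENNReal.ofReal (K * K' * b) := by
  have h1 : ∀ x ∈ N, ν (⋃ y ∈ N', T x y) ≤ ENNReal.ofReal (N'.card * b) := fun x hx => by
    refine (measure_biUnion_finset_le N' _).trans ((Finset.sum_le_sum (hT x hx)).trans ?_)
    rw [Finset.sum_const, nsmul_eq_mul, ENNReal.ofReal_mul (Nat.cast_nonneg _),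
      ENNReal.ofReal_natCast]
  refine (measure_biUnion_finset_le N _).trans ((Finset.sum_le_sum h1).trans ?_)
  rw [Finset.sum_const, nsmul_eq_mul, ← ENNReal.ofReal_natCast,
    ← ENNReal.ofReal_mul (Nat.cast_nonneg _)]
  refine ENNReal.ofReal_le_ofReal ?_
  rw [mul_assoc]
  have : (0 : ℝ) ≤ N.card := Nat.cast_nonneg _
  have : (0 : ℝ) ≤ K := this.trans hN
  gcongr

theorem finrank_continuousLinearMap_euclidean (m p : ℕ) :
    Module.finrank ℝ (EuclideanSpace ℝ (Fin m) →L[ℝ] EuclideanSpace ℝ (Fin p)) = m * p := by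
  rw [← (LinearMap.toContinuousLinearMap (𝕜 := ℝ) (E := EuclideanSpace ℝ (Fin m))
    (F' := EuclideanSpace ℝ (Fin p))).finrank_eq, Module.finrank_linearMap]
  simp

theorem frobNorm_vecMulVec (u : EuclideanSpace ℝ (Fin p₁)) (v : EuclideanSpace ℝ (Fin p₂)) :
    frobNorm (Matrix.vecMulVec u v) = ‖u‖ * ‖v‖ := by
  rw [← sq_eq_sq₀ (frobNorm_nonneg _) (by positivity), ← matInner_self, matInner_vecMulVec,
    real_inner_self_eq_norm_sq, real_inner_self_eq_norm_sq]
  ring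

/-- Since `9⁴ ≤ e⁹`, `9 ≤ exp (9/4)`, and `2.36 - 2.25` still exceeds `1/10`. -/
theorem nine_pow_mul_exp_le (p : ℕ) :
    (9 : ℝ) ^ p * (2 * Real.exp (-(2.36 * p))) ≤ 2 * Real.exp (-(p / 10)) := by
  have h9 : (9 : ℝ) ≤ Real.exp (9 / 4) := by
    have h1 : (9 : ℝ) ^ 4 ≤ Real.exp (9 / 4) ^ 4 := by
      rw [← Real.exp_nat_mul, show ((4 : ℕ) : ℝ) * (9 / 4) = (9 : ℕ) * 1 by norm_num,
        Real.exp_nat_mul]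
      refine le_trans ?_ (pow_le_pow_left₀ (by norm_num) Real.exp_one_gt_d9.le 9)
      norm_num
    exact le_of_pow_le_pow_left₀ (by norm_num) (Real.exp_pos _).le h1
  have h2 : (9 : ℝ) ^ p ≤ Real.exp (p * (9 / 4)) := by
    rw [Real.exp_nat_mul]
    exact pow_le_pow_left₀ (by norm_num) h9 p
  calc (9 : ℝ) ^ p * (2 * Real.exp (-(2.36 * p)))
      ≤ Real.exp (p * (9 / 4)) * (2 * Real.exp (-(2.36 * p))) := by gcongr
    _ = 2 * Real.exp (p * (9 / 4) + -(2.36 * p)) := by rw [Real.exp_add]; ring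
    _ ≤ _ := by
      have : (0 : ℝ) ≤ p := Nat.cast_nonneg p
      gcongr
      linarith

/-- The nets cost `exp (12 · 240000² r p)` because `120001 ≤ exp 12`. The factor `10 ^ 17` in the
sample size exceeds `36864 · (12 · 240000² + 1)`. -/
theorem net_pow_mul_exp_le {p r : ℕ} (hr : 0 < r)
    (hn : 10 ^ 17 * (r : ℝ) * p ≤ n) :
    (1 + 2 / (1 / 60000 : ℝ)) ^ (240000 ^ 2 * r * p) * (2 * Real.exp (-(n / 36864))) ≤
      2 * Real.exp (-p) := by
  have h12 : (1 + 2 / (1 / 60000 : ℝ)) ≤ Real.exp 12 := by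
    rw [show (12 : ℝ) = (12 : ℕ) * 1 by norm_num, Real.exp_nat_mul]
    refine le_trans ?_ (pow_le_pow_left₀ (by norm_num) Real.exp_one_gt_d9.le 12)
    norm_num
  have hr' : (1 : ℝ) ≤ r := by exact_mod_cast hr
  have hp : (0 : ℝ) ≤ p := Nat.cast_nonneg p
  have hrp : (p : ℝ) ≤ r * p := le_mul_of_one_le_left hp hr'
  have h2 : (1 + 2 / (1 / 60000 : ℝ)) ^ (240000 ^ 2 * r * p) ≤
      Real.exp (240000 ^ 2 * r * p * 12) := by
    have h3 := pow_le_pow_left₀ (by norm_num) h12 (240000 ^ 2 * r * p)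
    rw [← Real.exp_nat_mul] at h3
    refine h3.trans (le_of_eq ?_)
    rw [Nat.cast_mul, Nat.cast_mul, Nat.cast_pow, Nat.cast_ofNat]
  calc _ ≤ Real.exp (240000 ^ 2 * r * p * 12) * (2 * Real.exp (-(n / 36864))) := by gcongr
    _ = 2 * Real.exp (240000 ^ 2 * r * p * 12 + -(n / 36864)) := by rw [Real.exp_add]; ring
    _ ≤ _ := by
      gcongr
      linarith

/-- The good event has large probability. -/
theorem measure_compl_goodSet_le {σ : ℝ} (hσ : 0 ≤ σ) {r : ℕ} (hr : 0 < r) (hn : 2 ≤ n)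
    (hp : 0 < p₁ + p₂) (hnp : 10 ^ 17 * (r : ℝ) * ((p₁ + p₂ : ℕ) : ℝ) ≤ n) {c : ℝ}
    (hc : gaussianPi (Fin n) {z | (n : ℝ) < ∑ i, |z i|} ≤ ENNReal.ofReal (Real.exp (-(c * n))))
    (hcn : ((p₁ + p₂ : ℕ) : ℝ) ≤ c * n)
    {N₁ : Finset (EuclideanSpace ℝ (Fin p₁))} {N₂ : Finset (EuclideanSpace ℝ (Fin p₂))}
    {N : Finset (EuclideanSpace ℝ (Fin (240000 ^ 2 * r)) →L[ℝ] EuclideanSpace ℝ (Fin p₁))}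
    {N' : Finset (EuclideanSpace ℝ (Fin (240000 ^ 2 * r) × Fin p₂))}
    (hN₁ : ∀ x ∈ N₁, ‖x‖ ≤ 1) (hN₂ : ∀ x ∈ N₂, ‖x‖ ≤ 1)
    (hN₁c : (N₁.card : ℝ) ≤ 9 ^ p₁) (hN₂c : (N₂.card : ℝ) ≤ 9 ^ p₂)
    (hNc : (N.card : ℝ) ≤ (1 + 2 / (1 / 60000 : ℝ)) ^ (240000 ^ 2 * r * p₁))
    (hNc' : (N'.card : ℝ) ≤ (1 + 2 / (1 / 60000 : ℝ)) ^ (240000 ^ 2 * r * p₂)) :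
    ((gaussianPairs n p₁ p₂).prod (gaussianPi (Fin n)))
      {y | ((fun i => (y.1 i).1, fun i => (y.1 i).2, fun i => σ * y.2 i) :
        (Fin n → Fin p₁ → ℝ) × (Fin n → Fin p₂ → ℝ) × (Fin n → ℝ)) ∉ goodSet σ N₁ N₂ N N'} ≤
      ENNReal.ofReal (2 / n + 6 * Real.exp (-((p₁ + p₂ : ℕ) / 10))) := by
  set p := p₁ + p₂ with hpdef
  have hp' : (0 : ℝ) < (p : ℕ) := by exact_mod_cast hp
  have hn' : (0 : ℝ) < n := by exact_mod_cast (by omega : 0 < n)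
  set t := 9 / 16 * (12 * Real.sqrt (Real.log n) * p + 6 * Real.sqrt (2 * n * p)) with ht
  have hthr : 9 / 16 * dantzigThreshold n p₁ p₂ σ = σ * t := by
    rw [dantzigThreshold, ht, hpdef]
    push_cast
    ring
  set Q := (gaussianPairs n p₁ p₂).prod (gaussianPi (Fin n))
  let S₁ : Set (Fin n → ℝ) := {z | (n : ℝ) < ∑ i, |z i|}
  let S₂ : Set (Fin n → ℝ) := {z | 2 * (n : ℝ) < ∑ i, z i ^ 2}
  let S₃ : Set (Fin n → ℝ) := {z | ∃ i, 2 * Real.sqrt (Real.log n) < |z i|}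
  -- The noise bounds are built into `S₄`; their failure is counted only once, in `S₂` and `S₃`.
  let S₄ : EuclideanSpace ℝ (Fin p₁) → EuclideanSpace ℝ (Fin p₂) →
      Set ((Fin n → (Fin p₁ → ℝ) × (Fin p₂ → ℝ)) × (Fin n → ℝ)) := fun u v =>
    {y | ((∀ i, |y.2 i| ≤ 2 * Real.sqrt (Real.log n)) ∧ ∑ i, y.2 i ^ 2 ≤ 2 * (n : ℝ)) ∧
        t < |∑ i, y.2 i * ((y.1 i).1 ⬝ᵥ (Matrix.vecMulVec u v *ᵥ (y.1 i).2))|}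
  let S₅ : (EuclideanSpace ℝ (Fin (240000 ^ 2 * r)) →L[ℝ] EuclideanSpace ℝ (Fin p₁)) →
      EuclideanSpace ℝ (Fin (240000 ^ 2 * r) × Fin p₂) →
      Set (Fin n → (Fin p₁ → ℝ) × (Fin p₂ → ℝ)) := fun U W =>
    {x | ¬ (1 / 384 * n * frobNorm (factorProd _ p₁ p₂ U W) ≤
        ropSeminorm (fun i => (x i).1) (fun i => (x i).2) (factorProd _ p₁ p₂ U W) ∧
      ropSeminorm (fun i => (x i).1) (fun i => (x i).2) (factorProd _ p₁ p₂ U W) ≤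
        4 * n * frobNorm (factorProd _ p₁ p₂ U W))}
  have hsnd : ∀ S : Set (Fin n → ℝ), Q (Set.univ ×ˢ S) = gaussianPi (Fin n) S := fun S => by
    rw [Measure.prod_prod, measure_univ, one_mul]
  have hfst : ∀ S, Q (S ×ˢ Set.univ) = gaussianPairs n p₁ p₂ S := fun S => by
    rw [Measure.prod_prod, measure_univ, mul_one]
  have b1 : Q (Set.univ ×ˢ S₁) ≤ ENNReal.ofReal (Real.exp (-(p / 10))) := by
    rw [hsnd]
    exact hc.trans (ENNReal.ofReal_le_ofReal (Real.exp_le_exp.2 (by linarith)))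
  have hpn : (p : ℝ) ≤ n := by
    have hr' : (1 : ℝ) ≤ r := by exact_mod_cast hr
    nlinarith
  have b2 : Q (Set.univ ×ˢ S₂) ≤ ENNReal.ofReal (Real.exp (-(p / 10))) := by
    rw [hsnd]
    exact (measure_sum_sq_le n).trans
      (ENNReal.ofReal_le_ofReal (Real.exp_le_exp.2 (by linarith)))
  have b3 : Q (Set.univ ×ˢ S₃) ≤ ENNReal.ofReal (2 / n) := by
    rw [hsnd]
    exact measure_exists_abs_gt_le (by omega)
  have b4 : Q (⋃ u ∈ N₁, ⋃ v ∈ N₂, S₄ u v) ≤ ENNReal.ofReal (2 * Real.exp (-(p / 10))) := by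
    refine (measure_biUnion_biUnion_le Q N₁ N₂ S₄ (b := 2 * Real.exp (-(2.36 * p)))
      (by positivity) hN₁c hN₂c fun u hu v hv => ?_).trans (ENNReal.ofReal_le_ofReal ?_)
    · refine measure_noise_bilin_gt_le hn ?_ hp'
      rw [frobNorm_vecMulVec]
      exact mul_le_one₀ (hN₁ u hu) (norm_nonneg _) (hN₂ v hv)
    · rw [← pow_add]
      exact nine_pow_mul_exp_le p
  have b5 : Q (⋃ U ∈ N, ⋃ W ∈ N', S₅ U W ×ˢ Set.univ) ≤
      ENNReal.ofReal (2 * Real.exp (-(p / 10))) := by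
    refine (measure_biUnion_biUnion_le Q N N' (fun U W => S₅ U W ×ˢ Set.univ)
      (b := 2 * Real.exp (-(n / 36864))) (by positivity) hNc hNc'
      fun U _ W _ => ?_).trans (ENNReal.ofReal_le_ofReal ?_)
    · rw [hfst]
      exact measure_ropSeminorm_le n _
    · rw [← pow_add, ← mul_add]
      refine (net_pow_mul_exp_le hr hnp).trans ?_
      gcongr
      linarith
  have hcover : {y : (Fin n → (Fin p₁ → ℝ) × (Fin p₂ → ℝ)) × (Fin n → ℝ) |
      ((fun i => (y.1 i).1, fun i => (y.1 i).2, fun i => σ * y.2 i) :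
        (Fin n → Fin p₁ → ℝ) × (Fin n → Fin p₂ → ℝ) × (Fin n → ℝ)) ∉ goodSet σ N₁ N₂ N N'} ⊆
      ((((Set.univ ×ˢ S₁) ∪ (Set.univ ×ˢ S₂)) ∪ (Set.univ ×ˢ S₃)) ∪
        ⋃ u ∈ N₁, ⋃ v ∈ N₂, S₄ u v) ∪ ⋃ U ∈ N, ⋃ W ∈ N', S₅ U W ×ˢ Set.univ := by
    intro y hy
    by_contra hcon
    simp only [Set.mem_union, not_or, Set.mem_prod, Set.mem_univ, true_and, and_true,
      Set.mem_iUnion, not_exists] at hcon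
    obtain ⟨⟨⟨⟨h1, h2⟩, h3⟩, h4⟩, h5⟩ := hcon
    replace h1 : ∑ i, |y.2 i| ≤ n := not_lt.1 h1
    replace h2 : ∑ i, y.2 i ^ 2 ≤ 2 * (n : ℝ) := not_lt.1 h2
    replace h3 : ∀ i, |y.2 i| ≤ 2 * Real.sqrt (Real.log n) := fun i =>
      not_lt.1 fun hi => h3 ⟨i, hi⟩
    refine hy ⟨?_, fun u hu v hv => ?_, fun U hU W hW => not_not.1 (h5 U hU W hW)⟩
    · simp only [abs_mul, ← Finset.mul_sum, abs_of_nonneg hσ]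
      exact mul_le_mul_of_nonneg_left h1 hσ
    · have h6 : |∑ i, y.2 i * ((y.1 i).1 ⬝ᵥ (Matrix.vecMulVec u v *ᵥ (y.1 i).2))| ≤ t :=
        not_lt.1 fun hlt => h4 u hu v hv ⟨⟨h3, h2⟩, hlt⟩
      rw [hthr]
      simp only [mul_assoc, ← Finset.mul_sum, abs_mul, abs_of_nonneg hσ]
      exact mul_le_mul_of_nonneg_left h6 hσ
  have he := Real.exp_pos (-((p : ℝ) / 10))
  calc _ ≤ Q (((((Set.univ ×ˢ S₁) ∪ (Set.univ ×ˢ S₂)) ∪ (Set.univ ×ˢ S₃)) ∪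
        ⋃ u ∈ N₁, ⋃ v ∈ N₂, S₄ u v) ∪ ⋃ U ∈ N, ⋃ W ∈ N', S₅ U W ×ˢ Set.univ) :=
        measure_mono hcover
    _ ≤ (((Q (Set.univ ×ˢ S₁) + Q (Set.univ ×ˢ S₂)) + Q (Set.univ ×ˢ S₃)) +
          Q (⋃ u ∈ N₁, ⋃ v ∈ N₂, S₄ u v)) + Q (⋃ U ∈ N, ⋃ W ∈ N', S₅ U W ×ˢ Set.univ) := by
        refine (measure_union_le _ _).trans (add_le_add ?_ le_rfl)
        refine (measure_union_le _ _).trans (add_le_add ?_ le_rfl)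
        refine (measure_union_le _ _).trans (add_le_add ?_ le_rfl)
        exact measure_union_le _ _
    -- The factor `6 = 1 + 1 + 2 + 2` collects the exponential terms; only the maximum of the noise
    -- contributes `2 / n`.
    _ ≤ (((ENNReal.ofReal (Real.exp (-(p / 10))) + ENNReal.ofReal (Real.exp (-(p / 10)))) +
          ENNReal.ofReal (2 / n)) + ENNReal.ofReal (2 * Real.exp (-(p / 10)))) +
          ENNReal.ofReal (2 * Real.exp (-(p / 10))) := by gcongr
    _ = _ := by
        rw [← ENNReal.ofReal_add (by positivity) (by positivity),
          ← ENNReal.ofReal_add (by positivity) (by positivity),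
          ← ENNReal.ofReal_add (by positivity) (by positivity),
          ← ENNReal.ofReal_add (by positivity) (by positivity)]
        congr 1
        ring

end UnionBound

/-! ### The main theorem -/

theorem proposition2p1 :
    ∃ C W₁ W₂ δ : ℝ, 0 < C ∧ 0 < W₁ ∧ 0 < W₂ ∧ 0 < δ ∧
      ∀ (p₁ p₂ r n : ℕ) (σ : ℝ), 0 < p₁ → 0 < p₂ → 0 < r → 0 ≤ σ →
        C * (r : ℝ) * ((p₁ : ℝ) + p₂) ≤ (n : ℝ) →
      ∀ (Ω : Type*) [MeasurableSpace Ω] (μ : Measure Ω) [IsProbabilityMeasure μ]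
        (β : Fin n → Fin p₁ → Ω → ℝ) (γ : Fin n → Fin p₂ → Ω → ℝ) (z : Fin n → Ω → ℝ),
        IsGaussianROPModel μ σ β γ z →
        ∃ E : Set Ω, MeasurableSet E ∧
          1 - 11 / (n : ℝ) - 3 * Real.exp (-δ * ((p₁ : ℝ) + p₂)) ≤ μ.real E ∧
          ∀ ω ∈ E, ∀ A : Matrix (Fin p₁) (Fin p₂) ℝ,
            (∃ Ahat : Matrix (Fin p₁) (Fin p₂) ℝ,
              IsNuclearNormEstimator (fun i j => β i j ω) (fun i j => γ i j ω) σ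
                (ropMap (fun i j => β i j ω) (fun i j => γ i j ω) A + fun i => z i ω) Ahat) ∧
            ∀ Ahat : Matrix (Fin p₁) (Fin p₂) ℝ,
              IsNuclearNormEstimator (fun i j => β i j ω) (fun i j => γ i j ω) σ
                (ropMap (fun i j => β i j ω) (fun i j => γ i j ω) A + fun i => z i ω) Ahat →
              ∀ (k : ℕ) (a : Fin k → ℝ) (u : Fin k → EuclideanSpace ℝ (Fin p₁))
                (v : Fin k → EuclideanSpace ℝ (Fin p₂)), IsSVD A a u v →
                frobNorm (Ahat - A) ^ 2 ≤
                  W₁ * σ ^ 2 * min ((r : ℝ) * Real.log n * ((p₁ : ℝ) + p₂) ^ 2 / (n : ℝ) ^ 2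
                    + (r : ℝ) * ((p₁ : ℝ) + p₂) / (n : ℝ)) 1
                  + W₂ * nuclearNorm (svdTail a u v r) ^ 2 / (r : ℝ) := by
  obtain ⟨c, hc, hnoise⟩ := exists_measure_sum_abs_le
  -- The term `10 ^ 17` pays for the nets, and `1 / c` makes the `ℓ¹` failure of the noise at most
  -- `exp (-(p₁ + p₂))`. The value `1/768` is the constant of the restricted lower bound.
  refine ⟨10 ^ 17 + 1 / c, 4 / (1 / 768) ^ 2 + 73728 / (1 / 768) ^ 4, 1, 1 / 20, by positivity,
    by norm_num, one_pos, by norm_num, ?_⟩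
  intro p₁ p₂ r n σ hp₁ hp₂ hr hσ hn Ω _ μ _ β γ z hmodel
  have hr' : (1 : ℝ) ≤ r := by exact_mod_cast hr
  have hp' : (2 : ℝ) ≤ (p₁ : ℝ) + p₂ := by exact_mod_cast (by omega : 2 ≤ p₁ + p₂)
  have hrp : (p₁ : ℝ) + p₂ ≤ r * ((p₁ : ℝ) + p₂) := le_mul_of_one_le_left (by linarith) hr'
  have hsplit : 10 ^ 17 * (r : ℝ) * ((p₁ : ℝ) + p₂) + 1 / c * (r * ((p₁ : ℝ) + p₂)) ≤ n := by
    linarith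
  have hcr : 0 ≤ 1 / c * (r * ((p₁ : ℝ) + p₂)) := by positivity
  have hn2 : 2 ≤ n := by
    have : (2 : ℝ) ≤ n := by linarith
    exact_mod_cast this
  have hn0 : (0 : ℝ) < n := by exact_mod_cast (by omega : 0 < n)
  have hcn : ((p₁ + p₂ : ℕ) : ℝ) ≤ c * n := by
    push_cast
    have h1 : 1 / c * (r * ((p₁ : ℝ) + p₂)) ≤ n := by
      have : 0 ≤ 10 ^ 17 * (r : ℝ) * ((p₁ : ℝ) + p₂) := by positivity
      linarith
    rw [one_div, inv_mul_le_iff₀ hc] at h1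
    linarith
  obtain ⟨N₁, hN₁c, hN₁, hN₁n⟩ := exists_net_unitBall (EuclideanSpace ℝ (Fin p₁))
    (by norm_num : (0 : ℝ) < 1 / 4)
  obtain ⟨N₂, hN₂c, hN₂, hN₂n⟩ := exists_net_unitBall (EuclideanSpace ℝ (Fin p₂))
    (by norm_num : (0 : ℝ) < 1 / 4)
  obtain ⟨N, hNc, hN, hNn⟩ := exists_net_unitBall
    (EuclideanSpace ℝ (Fin (240000 ^ 2 * r)) →L[ℝ] EuclideanSpace ℝ (Fin p₁))
    (by norm_num : (0 : ℝ) < 1 / 60000)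
  obtain ⟨N', hNc', hN', hNn'⟩ := exists_net_unitBall
    (EuclideanSpace ℝ (Fin (240000 ^ 2 * r) × Fin p₂)) (by norm_num : (0 : ℝ) < 1 / 60000)
  rw [finrank_euclideanSpace_fin, show (1 + 2 / (1 / 4) : ℝ) = 9 by norm_num] at hN₁c hN₂c
  rw [finrank_continuousLinearMap_euclidean] at hNc
  rw [finrank_euclideanSpace, Fintype.card_prod, Fintype.card_fin, Fintype.card_fin] at hNc'
  obtain ⟨hmeas, hlaw⟩ := hmodel.map_eq
  set f : Ω → (Fin n → Fin p₁ → ℝ) × (Fin n → Fin p₂ → ℝ) × (Fin n → ℝ) :=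
    fun ω => (fun i j => β i j ω, fun i j => γ i j ω, fun i => z i ω)
  set G := goodSet (n := n) σ N₁ N₂ N N'
  have hbad : μ (f ⁻¹' Gᶜ) ≤
      ENNReal.ofReal (2 / n + 6 * Real.exp (-((p₁ + p₂ : ℕ) / 10))) := by
    refine (Measure.le_map_apply hmeas _).trans ?_
    rw [hlaw, Measure.map_apply (by fun_prop)
      (isClosed_goodSet σ N₁ N₂ N N').measurableSet.compl]
    exact measure_compl_goodSet_le hσ hr hn2 (by omega)
      (by push_cast; linarith) (hnoise n) hcn hN₁ hN₂ hN₁c hN₂c hNc hNc'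
  -- The data are only almost everywhere measurable, so a measurable hull of the bad event is
  -- removed.
  refine ⟨(toMeasurable μ (f ⁻¹' Gᶜ))ᶜ, (measurableSet_toMeasurable _ _).compl, ?_, ?_⟩
  · rw [probReal_compl_eq_one_sub (measurableSet_toMeasurable _ _), measureReal_def,
      measure_toMeasurable]
    have h1 : (μ (f ⁻¹' Gᶜ)).toReal ≤ 2 / n + 6 * Real.exp (-((p₁ + p₂ : ℕ) / 10)) :=
      ENNReal.toReal_le_of_le_ofReal (by positivity) hbad
    have h2 : (μ (f ⁻¹' Gᶜ)).toReal ≤ 1 := by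
      have := ENNReal.toReal_mono ENNReal.one_ne_top (prob_le_one (μ := μ) (s := f ⁻¹' Gᶜ))
      simpa using this
    have h3 : Real.exp (-(((p₁ + p₂ : ℕ) : ℝ) / 10)) =
        Real.exp (-(1 / 20) * ((p₁ : ℝ) + p₂)) ^ 2 := by
      rw [← Real.exp_nat_mul]
      congr 1
      push_cast
      ring
    rw [h3] at h1
    set y := Real.exp (-(1 / 20) * ((p₁ : ℝ) + p₂))
    have hy : 0 < y := Real.exp_pos _
    have h4 : 2 / (n : ℝ) ≤ 11 / n := by gcongr; norm_num
    have h5 : 0 ≤ 2 / (n : ℝ) := by positivity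
    -- For `y ≤ 1/2`, `6 y² ≤ 3 y`; otherwise `3 y > 1` and the claimed lower bound for the
    -- probability is negative.
    rcases le_total y (1 / 2) with hle | hle
    · nlinarith
    · linarith
  · intro ω hω A
    have hgood : f ω ∈ G := by
      by_contra hcon
      exact hω (subset_toMeasurable μ _ hcon)
    have hz := mem_residualSet_of_mem_goodSet hσ (by omega) hN₁n hN₂n hgood
    refine ⟨exists_isNuclearNormEstimator (A := A) ?_, fun M hM k a u v hA => ?_⟩
    · rw [IsFeasible, add_sub_cancel_left]
      exact hz
    · exact frobNorm_sub_sq_le (by omega) hr (by norm_num) hσ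
        (fun X hX => le_ropSeminorm_of_mem_goodSet hr rfl hN hN' hNn hNn' hgood X hX) hz hM hA
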